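/- Let $\mathbb F_q$ be a finite field with $q$ elements, $F=\mathbb F_q(\!(t^{-1})\!)$, $\mathcal O=\mathbb F_q[\![t^{-1}]\!]$, $G=PGL(3,F)$ and $\Gamma=PGL(3,\mathbb F_q[t])\subset G$. Let $\mathcal B=\mathcal B(G)$ be the Bruhat–Tits building of $G$: its vertices are the classes $[L]$ of $\mathcal O$-lattices $L\subset F^3$ of rank $3$ up to scaling by $F^\times$, two vertices $x,y$ are adjacent ($x\sim y$) if $x=[L]$, $y=[M]$ with $t^{-1}L\subsetneq M\subsetneq L$, and the color is $\tau([L])=\log_q[\mathcal O^3:t^{-i}L]\in\mathbb Z/3\mathbb Z$ for any $i$ with $t^{-i}L\subseteq\mathcal O^3$. For $j=1,2$ let $$A_jf(x)=\sum_{y\sim x,\ \tau(y)=\tau(x)+j}f(y)$$ and let $\mathcal S^3\subset\mathbb C^2$ be the simultaneous spectrum of $(A_1,A_2)$ on $L^2(\mathcal B)$ (functions on vertices): the set of $(\lambda_1,\lambda_2)$ for which there are unit vectors $f_n$ with $\|A_jf_n-\lambda_jf_n\|\to0$ for $j=1,2$. The group $\Gamma$ preserves adjacency and the difference of the colors of two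 vertices (indeed the colors). On the quotient $\Gamma\backslash\mathcal B$ put the weights $w(u)=c/|\Gamma_x|$ on the vertex $u=\Gamma x$ and $w(u,v)=c/|\Gamma_x\cap\Gamma_y|$ on the edge from $u$ to $v$ represented by an edge $(x,y)$ of $\mathcal B$, where $c=q^3(q+1)(q-1)^2$. Let $L^2_w(\Gamma\backslash\mathcal B)$ be the space of functions on the vertices of $\Gamma\backslash\mathcal B$ with norm $\|f\|=\bigl(\sum_u|f(u)|^2w(u)\bigr)^{1/2}<\infty$, and let $$A_w^\pm f(u)=\sum_{(u,v)\in E,\ \tau(v)=\tau(u)\pm1}\frac{w(u,v)}{w(u)}f(v)$$ be the weighted adjacency operators, induced by $A_1$ and $A_2$. The automorphic spectrum of $A_w^\pm$ is the set of $(\lambda^+,\lambda^-)\in\mathbb C^2$ for which there are unit vectors $f_n\in L^2_w(\Gamma\backslash\mathcal B)$ with $\|A_w^\pm f_n-\lambda^\pm f_n\|\to0$ (for both signs). A point $(\lambda^+,\lambda^-)$ is trivial if it is the pair of eigenvalues of a function of the form $f([L])=\xi^{\tau([L])}$ with $\xi^3=1$. The quotient $\Gamma\backslash\mathcal B$ is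 called Ramanujan if every non-trivial point of its automorphic spectrum lies in $\mathcal S^3$. Then: 1. $PGL(3,\mathbb F_q[t])\backslash\mathcal B(G)$ is not Ramanujan. 2. For every point $\lambda$ of $$\Sigma_1=\{q^{3/2}e^{i\theta}+qe^{-2i\theta}+q^{1/2}e^{i\theta}:\theta\in\mathbb R\},$$ the pair $(\lambda,\overline\lambda)$ belongs to the automorphic spectrum of $A_w^\pm$, is non-trivial, and does not belong to $\mathcal S^3$. 3. $\mathcal S^3=\{(\lambda,\overline\lambda):\lambda\in\Sigma_2\}$, where $\Sigma_2=\{q(s_1+s_2+s_3): |s_1|=|s_2|=|s_3|=1,\ s_1s_2s_3=1\}$. -/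

import Mathlib

open scoped LaurentSeries PowerSeries Polynomial Pointwise ENNReal

namespace PGLBuilding

noncomputable section

section Building

/-! `k` is the finite field with `q` elements.  The field `k((t⁻¹))` is `LaurentSeries k`, whose
variable `X` is `t⁻¹`, and its valuation ring `k[[t⁻¹]]` is `PowerSeries k`. -/

variable (k : Type*) [Field k]

/-- An `𝒪`-lattice of rank 3 in `k((t⁻¹))³`, where `𝒪 = k[[t⁻¹]]`. -/
@[ext]
structure Lattice where
  carrier : Submodule k⟦X⟧ (Fin 3 → k⸨X⸩)
  isLattice : Submodule.IsLattice k⸨X⸩ carrier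

variable {k}

instance instSMulUnits : SMul (k⸨X⸩)ˣ (Lattice k) where
  smul s L := ⟨s • L.carrier, haveI := L.isLattice; Submodule.IsLattice.smul k⸨X⸩ L.carrier s⟩

theorem coe_units_smul (s : (k⸨X⸩)ˣ) (L : Lattice k) : (s • L).carrier = s • L.carrier := rfl

theorem mem_units_smul {s : (k⸨X⸩)ˣ} {L : Lattice k} {v : Fin 3 → k⸨X⸩} :
    v ∈ (s • L).carrier ↔ ∃ w ∈ L.carrier, s • w = v :=
  Submodule.mem_smul_pointwise_iff_exists v s L.carrier

instance instMulActionUnits : MulAction (k⸨X⸩)ˣ (Lattice k) where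
  one_smul L := Lattice.ext (one_smul _ L.carrier)
  mul_smul s s' L := Lattice.ext (mul_smul s s' L.carrier)

/-- The `𝒪`-linear self-map of `k((t⁻¹))³` given by a matrix. -/
def matAct (g : GL (Fin 3) k⸨X⸩) : (Fin 3 → k⸨X⸩) →ₗ[k⟦X⟧] (Fin 3 → k⸨X⸩) :=
  (Matrix.mulVecLin (g : Matrix (Fin 3) (Fin 3) k⸨X⸩)).restrictScalars k⟦X⟧

theorem matAct_apply (g : GL (Fin 3) k⸨X⸩) (v : Fin 3 → k⸨X⸩) :
    matAct g v = (g : Matrix (Fin 3) (Fin 3) k⸨X⸩).mulVec v := rfl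

theorem matAct_one : matAct (1 : GL (Fin 3) k⸨X⸩) = LinearMap.id := by
  apply LinearMap.ext
  intro v
  simp [matAct_apply]

theorem matAct_mul (g h : GL (Fin 3) k⸨X⸩) : matAct (g * h) = matAct g ∘ₗ matAct h := by
  apply LinearMap.ext
  intro v
  simp [matAct_apply, Matrix.mulVec_mulVec]

theorem matAct_scalar (s : (k⸨X⸩)ˣ) (v : Fin 3 → k⸨X⸩) :
    matAct (Matrix.GeneralLinearGroup.scalar (Fin 3) s) v = s • v := by
  rw [matAct_apply, Matrix.GeneralLinearGroup.coe_scalar, Matrix.scalar_apply]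
  ext i
  simp [Matrix.mulVec_diagonal, Units.smul_def]

theorem isLattice_map (g : GL (Fin 3) k⸨X⸩) (L : Submodule k⟦X⟧ (Fin 3 → k⸨X⸩))
    (hL : Submodule.IsLattice k⸨X⸩ L) : Submodule.IsLattice k⸨X⸩ (L.map (matAct g)) where
  fg := hL.fg.map _
  span_eq_top := by
    have h1 : ((L.map (matAct g) : Submodule k⟦X⟧ (Fin 3 → k⸨X⸩)) : Set (Fin 3 → k⸨X⸩)) =
        (Matrix.mulVecLin (g : Matrix (Fin 3) (Fin 3) k⸨X⸩)) '' (L : Set (Fin 3 → k⸨X⸩)) := rfl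
    rw [h1, Submodule.span_image, hL.span_eq_top, Submodule.map_top, LinearMap.range_eq_top]
    intro v
    refine ⟨((g⁻¹ : GL (Fin 3) k⸨X⸩) : Matrix (Fin 3) (Fin 3) k⸨X⸩).mulVec v, ?_⟩
    rw [Matrix.mulVecLin_apply, Matrix.mulVec_mulVec, ← Units.val_mul, mul_inv_cancel,
      Units.val_one, Matrix.one_mulVec]

instance instSMulGL : SMul (GL (Fin 3) k⸨X⸩) (Lattice k) where
  smul g L := ⟨L.carrier.map (matAct g), isLattice_map g L.carrier L.isLattice⟩

theorem coe_GL_smul (g : GL (Fin 3) k⸨X⸩) (L : Lattice k) :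
    (g • L).carrier = L.carrier.map (matAct g) := rfl

/-- The action of matrices on lattices: `g • L = {g v : v ∈ L}`. -/
instance instMulActionGL : MulAction (GL (Fin 3) k⸨X⸩) (Lattice k) where
  one_smul L := Lattice.ext (by rw [coe_GL_smul, matAct_one, Submodule.map_id])
  mul_smul g h L := Lattice.ext (by
    simp only [coe_GL_smul]
    rw [matAct_mul, Submodule.map_comp])

theorem scalar_smul (s : (k⸨X⸩)ˣ) (L : Lattice k) :
    Matrix.GeneralLinearGroup.scalar (Fin 3) s • L = s • L := by
  apply Lattice.ext
  ext v
  rw [coe_GL_smul, mem_units_smul]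
  simp only [Submodule.mem_map, matAct_scalar]

theorem GL_smul_units_smul (g : GL (Fin 3) k⸨X⸩) (s : (k⸨X⸩)ˣ) (L : Lattice k) :
    g • s • L = s • g • L := by
  rw [← scalar_smul, ← scalar_smul, smul_smul, smul_smul,
    Matrix.GeneralLinearGroup.scalar_commute]

variable (k)

/-- The vertices of the building: lattices up to homothety. -/
def Vertex : Type _ := MulAction.orbitRel.Quotient (k⸨X⸩)ˣ (Lattice k)

/-- `PGL(3, k((t⁻¹)))`. -/
abbrev PGL3 : Type _ := GL (Fin 3) k⸨X⸩ ⧸ Subgroup.center (GL (Fin 3) k⸨X⸩)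

variable {k}

/-- The homothety class `[L]` of a lattice. -/
def Lattice.toVertex (L : Lattice k) : Vertex k :=
  Quotient.mk (MulAction.orbitRel (k⸨X⸩)ˣ (Lattice k)) L

theorem toVertex_eq_iff {L M : Lattice k} :
    L.toVertex = M.toVertex ↔ ∃ s : (k⸨X⸩)ˣ, s • M = L :=
  Quotient.eq (r := MulAction.orbitRel (k⸨X⸩)ˣ (Lattice k))

theorem toVertex_surjective : Function.Surjective (Lattice.toVertex (k := k)) :=
  Quotient.mk_surjective

instance instMulActionVertexGL : MulAction (GL (Fin 3) k⸨X⸩) (Vertex k) where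
  smul g := Quotient.lift (fun L : Lattice k => (g • L).toVertex) (by
    rintro L M ⟨s, rfl⟩
    exact toVertex_eq_iff.2 ⟨s, (GL_smul_units_smul g s M).symm⟩)
  one_smul v := by
    obtain ⟨L, rfl⟩ := toVertex_surjective v
    exact congrArg Lattice.toVertex (one_smul _ L)
  mul_smul g h v := by
    obtain ⟨L, rfl⟩ := toVertex_surjective v
    exact congrArg Lattice.toVertex (mul_smul g h L)

theorem GL_smul_toVertex (g : GL (Fin 3) k⸨X⸩) (L : Lattice k) :
    g • L.toVertex = (g • L).toVertex := rfl

theorem center_le_ker : Subgroup.center (GL (Fin 3) k⸨X⸩) ≤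
    (MulAction.toPermHom (GL (Fin 3) k⸨X⸩) (Vertex k)).ker := by
  intro g hg
  rw [Matrix.GeneralLinearGroup.center_eq_range_scalar] at hg
  obtain ⟨s, rfl⟩ := hg
  rw [MonoidHom.mem_ker]
  ext v
  obtain ⟨L, rfl⟩ := toVertex_surjective v
  rw [MulAction.toPermHom_apply, MulAction.toPerm_apply, GL_smul_toVertex, scalar_smul]
  exact toVertex_eq_iff.2 ⟨s, rfl⟩

/-- The action of `PGL(3, k((t⁻¹)))` on the vertices of the building: `g • [L] = [g L]`. -/
instance instMulActionVertex : MulAction (PGL3 k) (Vertex k) :=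
  MulAction.compHom (Vertex k)
    (QuotientGroup.lift _ (MulAction.toPermHom (GL (Fin 3) k⸨X⸩) (Vertex k)) center_le_ker)

theorem mk_smul_toVertex (g : GL (Fin 3) k⸨X⸩) (L : Lattice k) :
    (QuotientGroup.mk g : PGL3 k) • L.toVertex = (g • L).toVertex := rfl

variable (k)

/-- The uniformizer `t⁻¹` of `k((t⁻¹))`, as a unit of that field. -/
def unif : (k⸨X⸩)ˣ :=
  Units.mk0 (HahnSeries.single (1 : ℤ) (1 : k)) (by simp)

variable {k}

/-- Two vertices are joined by an edge if they are the classes of lattices `L`, `M` with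
`t⁻¹ L ⊊ M ⊊ L`. -/
def Adj (x y : Vertex k) : Prop :=
  ∃ L M : Lattice k, L.toVertex = x ∧ M.toVertex = y ∧ (unif k • L).carrier < M.carrier ∧ M.carrier < L.carrier

theorem adj_smul (g : PGL3 k) {x y : Vertex k} (h : Adj x y) : Adj (g • x) (g • y) := by
  obtain ⟨g, rfl⟩ := QuotientGroup.mk_surjective g
  obtain ⟨L, M, rfl, rfl, h1, h2⟩ := h
  have hinj : Function.Injective (matAct g) := by
    intro v w hvw
    have := congrArg (matAct g⁻¹) hvw
    simpa only [← LinearMap.comp_apply, ← matAct_mul, inv_mul_cancel, matAct_one,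
      LinearMap.id_apply] using this
  refine ⟨g • L, g • M, (mk_smul_toVertex g L).symm, (mk_smul_toVertex g M).symm, ?_, ?_⟩
  · rw [← GL_smul_units_smul, coe_GL_smul, coe_GL_smul]
    exact Submodule.map_strictMono_of_injective hinj h1
  · rw [coe_GL_smul, coe_GL_smul]
    exact Submodule.map_strictMono_of_injective hinj h2

variable (k)

/-- The standard lattice `𝒪³`. -/
def stdLattice : Submodule k⟦X⟧ (Fin 3 → k⸨X⸩) :=
  LinearMap.range (LinearMap.compLeft (Algebra.linearMap k⟦X⟧ k⸨X⸩) (Fin 3))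

variable {k}

/-- `log_q [𝒪³ : L]`, for a lattice `L ⊆ 𝒪³`. -/
def logIndex (L : Lattice k) : ℕ :=
  Nat.log (Nat.card k) (L.carrier.toAddSubgroup.relIndex (stdLattice k).toAddSubgroup)

theorem mem_stdLattice {v : Fin 3 → k⸨X⸩} :
    v ∈ stdLattice k ↔ ∀ i, ∃ a : k⟦X⟧, algebraMap k⟦X⟧ k⸨X⸩ a = v i := by
  constructor
  · rintro ⟨a, rfl⟩ i
    exact ⟨a i, rfl⟩
  · intro h
    choose a ha using h
    exact ⟨a, funext ha⟩

/-- Every homothety class contains a lattice inside `𝒪³`. -/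
theorem exists_le_stdLattice (x : Vertex k) :
    ∃ L : Lattice k, L.toVertex = x ∧ L.carrier ≤ stdLattice k := by
  obtain ⟨L, rfl⟩ := toVertex_surjective x
  obtain ⟨S, hS⟩ := L.isLattice.fg
  obtain ⟨b, hb⟩ := IsLocalization.exist_integer_multiples (nonZeroDivisors k⟦X⟧)
    (S ×ˢ (Finset.univ : Finset (Fin 3))) (fun p => p.1 p.2)
  have hb0 : algebraMap k⟦X⟧ k⸨X⸩ b ≠ 0 :=
    IsFractionRing.to_map_ne_zero_of_mem_nonZeroDivisors b.2
  refine ⟨Units.mk0 _ hb0 • L, toVertex_eq_iff.2 ⟨_, rfl⟩, ?_⟩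
  intro u hu
  obtain ⟨w, hw, rfl⟩ := mem_units_smul.1 hu
  rw [← hS] at hw
  rw [Units.smul_def, Units.val_mk0, algebraMap_smul]
  have hle : Submodule.span k⟦X⟧ (S : Set (Fin 3 → k⸨X⸩)) ≤
      (stdLattice k).comap (LinearMap.lsmul k⟦X⟧ (Fin 3 → k⸨X⸩) b) := by
    rw [Submodule.span_le]
    intro v hv
    refine mem_stdLattice.2 fun i => ?_
    obtain ⟨a, ha⟩ := hb (v, i) (by simpa using hv)
    exact ⟨a, ha⟩
  exact hle hw

theorem unif_eq_algebraMap : ((unif k : (k⸨X⸩)ˣ) : k⸨X⸩) = algebraMap k⟦X⟧ k⸨X⸩ PowerSeries.X := by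
  simp [unif, LaurentSeries.coe_algebraMap, HahnSeries.ofPowerSeries_X]

theorem mem_unif_smul {L : Lattice k} {v : Fin 3 → k⸨X⸩} :
    v ∈ (unif k • L).carrier ↔ ∃ w ∈ L.carrier, (PowerSeries.X : k⟦X⟧) • w = v := by
  rw [mem_units_smul]
  refine exists_congr fun w => and_congr_right fun _ => ?_
  rw [Units.smul_def, unif_eq_algebraMap, algebraMap_smul]

theorem unif_smul_le (L : Lattice k) : (unif k • L).carrier ≤ L.carrier := by
  intro v hv
  obtain ⟨w, hw, rfl⟩ := mem_unif_smul.1 hv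
  exact L.carrier.smul_mem _ hw

/-- `[L : t⁻¹ L] = q³`. -/
theorem relIndex_unif_smul (L : Lattice k) :
    (unif k • L).carrier.toAddSubgroup.relIndex L.carrier.toAddSubgroup = Nat.card k ^ 3 := by
  have := L.isLattice
  have : Module.Free k⟦X⟧ L.carrier := Submodule.IsLattice.free k⸨X⸩ L.carrier
  have hr : Module.finrank k⟦X⟧ L.carrier = 3 := by
    rw [Submodule.IsLattice.finrank_of_pi k⸨X⸩ L.carrier, Fintype.card_fin]
  let b := Module.finBasisOfFinrankEq k⟦X⟧ L.carrier hr
  let φ : L.carrier →+ (Fin 3 → k) :=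
    (AddMonoidHom.compLeft (PowerSeries.constantCoeff (R := k)).toAddMonoidHom (Fin 3)).comp
      (b.equivFun.toLinearMap.toAddMonoidHom)
  have hφ : ∀ v i, φ v i = PowerSeries.constantCoeff (b.equivFun v i) := fun v i => rfl
  have hsurj : Function.Surjective φ := by
    intro c
    refine ⟨b.equivFun.symm fun i => PowerSeries.C (c i), ?_⟩
    ext i
    rw [hφ, LinearEquiv.apply_symm_apply]
    simp
  have hker : φ.ker = (unif k • L).carrier.toAddSubgroup.addSubgroupOf L.carrier.toAddSubgroup := by
    ext v
    rw [AddMonoidHom.mem_ker, AddSubgroup.mem_addSubgroupOf]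
    change _ ↔ (v : Fin 3 → k⸨X⸩) ∈ (unif k • L).carrier
    rw [mem_unif_smul]
    constructor
    · intro h
      have h' : ∀ i, ∃ a, b.equivFun v i = PowerSeries.X * a := fun i =>
        PowerSeries.X_dvd_iff.2 (by rw [← hφ, h]; rfl)
      choose a ha using h'
      refine ⟨(b.equivFun.symm a : L.carrier), (b.equivFun.symm a).2, ?_⟩
      rw [← Submodule.coe_smul]
      congr 1
      apply b.equivFun.injective
      rw [map_smul, LinearEquiv.apply_symm_apply]
      ext1 i
      rw [ha i]
      rfl
    · rintro ⟨w, hw, hwv⟩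
      have : v = (PowerSeries.X : k⟦X⟧) • (⟨w, hw⟩ : L.carrier) := Subtype.ext hwv.symm
      ext i
      rw [hφ, this, map_smul]
      simp
  have h1 := AddSubgroup.index_ker φ
  rw [hker, AddMonoidHom.range_eq_top.2 hsurj] at h1
  rw [AddSubgroup.relIndex, h1]
  simp [Nat.card_fun]

theorem logIndex_unif_smul [Finite k] (L : Lattice k) (hL : L.carrier ≤ stdLattice k) :
    ((logIndex (unif k • L) : ℕ) : ZMod 3) = logIndex L := by
  have h1 : (unif k • L).carrier.toAddSubgroup ≤ L.carrier.toAddSubgroup := unif_smul_le L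
  have h2 : L.carrier.toAddSubgroup ≤ (stdLattice k).toAddSubgroup := hL
  have h3 := AddSubgroup.relIndex_mul_relIndex _ _ _ h1 h2
  rw [relIndex_unif_smul] at h3
  unfold logIndex
  rw [← h3]
  have hq : 1 < Nat.card k := Finite.one_lt_card
  rcases Nat.eq_zero_or_pos (L.carrier.toAddSubgroup.relIndex (stdLattice k).toAddSubgroup) with h0 | h0
  · rw [h0, mul_zero]
  · have h3' : ∀ n, 0 < n →
        Nat.log (Nat.card k) (Nat.card k ^ 3 * n) = Nat.log (Nat.card k) n + 3 := by
      intro n hn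
      have e : Nat.card k ^ 3 * n = n * Nat.card k * Nat.card k * Nat.card k := by ring
      rw [e, Nat.log_mul_base hq (by positivity), Nat.log_mul_base hq (by positivity),
        Nat.log_mul_base hq (by positivity)]
    rw [h3' _ h0, Nat.cast_add, show ((3 : ℕ) : ZMod 3) = 0 from rfl, add_zero]

theorem units_smul_eq (u : (k⟦X⟧)ˣ) (L : Lattice k) :
    Units.map (algebraMap k⟦X⟧ k⸨X⸩).toMonoidHom u • L = L := by
  have key : ∀ (u : (k⟦X⟧)ˣ) (v : Fin 3 → k⸨X⸩),
      Units.map (algebraMap k⟦X⟧ k⸨X⸩).toMonoidHom u • v = (u : k⟦X⟧) • v := by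
    intro u v
    rw [Units.smul_def]
    exact algebraMap_smul k⸨X⸩ (u : k⟦X⟧) v
  apply Lattice.ext
  ext v
  rw [mem_units_smul]
  constructor
  · rintro ⟨w, hw, rfl⟩
    rw [key]
    exact L.carrier.smul_mem _ hw
  · intro hv
    refine ⟨((u⁻¹ : (k⟦X⟧)ˣ) : k⟦X⟧) • v, L.carrier.smul_mem _ hv, ?_⟩
    rw [key, smul_smul, Units.mul_inv, one_smul]

theorem logIndex_eq_of_toVertex_eq [Finite k] {L M : Lattice k} (hL : L.carrier ≤ stdLattice k)
    (hM : M.carrier ≤ stdLattice k) (h : L.toVertex = M.toVertex) :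
    ((logIndex L : ℕ) : ZMod 3) = logIndex M := by
  have pow : ∀ (n : ℕ) (N : Lattice k), N.carrier ≤ stdLattice k →
      ((unif k ^ n • N).carrier ≤ stdLattice k ∧
        ((logIndex (unif k ^ n • N) : ℕ) : ZMod 3) = logIndex N) := by
    intro n
    induction n with
    | zero => intro N hN; rw [pow_zero, one_smul]; exact ⟨hN, rfl⟩
    | succ n ih =>
      intro N hN
      obtain ⟨h1, h2⟩ := ih (unif k • N) ((unif_smul_le N).trans hN)
      rw [pow_succ, mul_smul]
      exact ⟨h1, h2.trans (logIndex_unif_smul N hN)⟩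
  have main : ∀ (N : Lattice k) (s : (k⸨X⸩)ˣ), N.carrier ≤ stdLattice k →
      IsLocalization.IsInteger k⟦X⟧ (s : k⸨X⸩) →
      ((logIndex (s • N) : ℕ) : ZMod 3) = logIndex N := by
    rintro N s hN ⟨a, ha⟩
    have ha0 : a ≠ 0 := by
      rintro rfl
      exact s.ne_zero (by rw [← ha, map_zero])
    obtain ⟨n, u, rfl⟩ :=
      IsDiscreteValuationRing.eq_unit_mul_pow_irreducible ha0 PowerSeries.X_irreducible
    have hs : s = Units.map (algebraMap k⟦X⟧ k⸨X⸩).toMonoidHom u * unif k ^ n := by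
      apply Units.ext
      rw [← ha, Units.val_mul, Units.val_pow_eq_pow_val, unif_eq_algebraMap, map_mul, map_pow]
      rfl
    rw [hs, mul_smul, units_smul_eq]
    exact (pow n N hN).2
  obtain ⟨s, rfl⟩ := toVertex_eq_iff.1 h
  rcases ValuationRing.isInteger_or_isInteger k⟦X⟧ (s : k⸨X⸩) with hs | hs
  · exact main M s hM hs
  · have := main (s • M) s⁻¹ hL (by rwa [Units.val_inv_eq_inv_val])
    rw [inv_smul_smul] at this
    exact this.symm

/-- The color `τ([L]) = log_q [𝒪³ : t⁻ⁱ L] mod 3`, for any `i` such that `t⁻ⁱ L ⊆ 𝒪³`. -/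
def color (x : Vertex k) : ZMod 3 :=
  (logIndex (exists_le_stdLattice x).choose : ℕ)

/-- The color does not depend on the chosen representative. -/
theorem color_toVertex [Finite k] (L : Lattice k) (hL : L.carrier ≤ stdLattice k) :
    color L.toVertex = (logIndex L : ℕ) :=
  logIndex_eq_of_toVertex_eq (exists_le_stdLattice L.toVertex).choose_spec.2 hL
    (exists_le_stdLattice L.toVertex).choose_spec.1

end Building

section Spectrum

/-- The norm `(∑ |f v|² w v)^{1/2}` of the weighted space `L²_w(V)`; it is `∞` exactly
when `f` is not in `L²_w(V)`. -/
def wNorm {V : Type*} (w : V → ℝ) (f : V → ℂ) : ℝ≥0∞ :=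
  (∑' v, ENNReal.ofReal (w v) * ‖f v‖ₑ ^ 2) ^ (1 / 2 : ℝ)

/-- The simultaneous approximate spectrum of a pair of operators on `L²_w(V)`: the pairs
`(a, b)` for which there are unit vectors `f n` with `A (f n) - a f n → 0` and
`B (f n) - b f n → 0` in norm. -/
def jointSpectrum {V : Type*} (w : V → ℝ) (A B : (V → ℂ) → (V → ℂ)) : Set (ℂ × ℂ) :=
  {p | ∃ f : ℕ → V → ℂ, (∀ n, wNorm w (f n) = 1) ∧
    Filter.Tendsto (fun n => wNorm w (A (f n) - p.1 • f n)) Filter.atTop (nhds 0) ∧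
    Filter.Tendsto (fun n => wNorm w (B (f n) - p.2 • f n)) Filter.atTop (nhds 0)}

variable {k : Type*} [Field k]

/-- The colored adjacency operator on the building:
`A_j f (x) = ∑ f(y)` over the (finitely many) neighbors `y` of `x` with `τ(y) = τ(x) + j`. -/
def coloredAdj (j : ZMod 3) (f : Vertex k → ℂ) (x : Vertex k) : ℂ :=
  ∑ᶠ y ∈ {y : Vertex k | Adj x y ∧ color y = color x + j}, f y

variable (k) in
/-- The simultaneous spectrum `𝒮³` of `(A_1, A_2)` on `L²` of the building. -/
def buildingSpectrum : Set (ℂ × ℂ) :=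
  jointSpectrum (fun _ : Vertex k => 1) (coloredAdj 1) (coloredAdj 2)

end Spectrum

section Quotient

variable (k : Type*) [Field k]

/-- The embedding of `k[t]` (polynomials in the variable `t`) into `k((t⁻¹))`. -/
def polyEmb : k[X] →+* k⸨X⸩ :=
  (Polynomial.aeval (((unif k)⁻¹ : (k⸨X⸩)ˣ) : k⸨X⸩)).toRingHom

/-- The lattice `Γ = PGL(3, k[t])` inside `PGL(3, k((t⁻¹)))`. -/
def Gam : Subgroup (PGL3 k) :=
  ((QuotientGroup.mk' (Subgroup.center (GL (Fin 3) k⸨X⸩))).comp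
    (Matrix.GeneralLinearGroup.map (n := Fin 3) (polyEmb k))).range

/-- Directed edges of the building. -/
def DirEdge : Type _ := {p : Vertex k × Vertex k // Adj p.1 p.2}

instance instMulActionDirEdge : MulAction (Gam k) (DirEdge k) where
  smul g e := ⟨g • e.1, adj_smul (g : PGL3 k) e.2⟩
  one_smul e := Subtype.ext (one_smul _ e.1)
  mul_smul g h e := Subtype.ext (mul_smul g h e.1)

/-- The vertices of the quotient complex `Γ \ B`. -/
abbrev QVertex : Type _ := MulAction.orbitRel.Quotient (Gam k) (Vertex k)

/-- The directed edges of the quotient complex `Γ \ B`. -/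
abbrev QEdge : Type _ := MulAction.orbitRel.Quotient (Gam k) (DirEdge k)

variable {k}

/-- The image in `Γ \ B` of a vertex of the building. -/
def Vertex.toQ (x : Vertex k) : QVertex k := Quotient.mk _ x

/-- The image in `Γ \ B` of a directed edge of the building. -/
def DirEdge.toQ (e : DirEdge k) : QEdge k := Quotient.mk _ e

/-- The initial vertex of a directed edge of `Γ \ B`. -/
def origin : QEdge k → QVertex k :=
  Quotient.lift (fun e => e.1.1.toQ) (by
    rintro _ e ⟨g, rfl⟩
    exact Quotient.sound ⟨g, rfl⟩)

/-- The terminal vertex of a directed edge of `Γ \ B`. -/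
def terminus : QEdge k → QVertex k :=
  Quotient.lift (fun e => e.1.2.toQ) (by
    rintro _ e ⟨g, rfl⟩
    exact Quotient.sound ⟨g, rfl⟩)

/-- `EdgeColor j e`: the directed edge `e` of `Γ \ B` goes from a vertex of color `c` to a vertex
of color `c + j`. -/
def EdgeColor (j : ZMod 3) (e : QEdge k) : Prop :=
  ∃ p : DirEdge k, p.toQ = e ∧ color p.1.2 = color p.1.1 + j

variable (k) in
/-- The normalizing constant `q³ (q + 1) (q - 1)²` of the weights. -/
def weightConst : ℝ :=
  (Nat.card k : ℝ) ^ 3 * ((Nat.card k : ℝ) + 1) * ((Nat.card k : ℝ) - 1) ^ 2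

/-- The weight `q³ (q + 1) (q - 1)² / |Γ_x|` of the orbit of `x`. It is used for vertices, and for
edges, where the stabilizer of an edge from `x` to `y` is `Γ_x ∩ Γ_y`. -/
def orbitWeight {S : Type*} [MulAction (Gam k) S] :
    MulAction.orbitRel.Quotient (Gam k) S → ℝ :=
  Quotient.lift (fun x => weightConst k / Nat.card (MulAction.stabilizer (Gam k) x)) (by
    intro x y h
    rw [Nat.card_congr (MulAction.stabilizerEquivStabilizerOfOrbitRel h).toEquiv])

/-- The weight function on the vertices of `Γ \ B`. -/
def vertexWeight (v : QVertex k) : ℝ := orbitWeight v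

/-- The weight function on the edges of `Γ \ B`. -/
def edgeWeight (e : QEdge k) : ℝ := orbitWeight e

/-- The weighted adjacency operator on `Γ \ B`:
`A f (u) = ∑ (w(u, v) / w(u)) f(v)` over the (finitely many) edges `(u, v)` with
`τ(v) = τ(u) + j`. It is induced by the colored adjacency operator `A_j` of the building. -/
def weightedAdj (j : ZMod 3) (f : QVertex k → ℂ) (u : QVertex k) : ℂ :=
  ∑ᶠ e ∈ {e : QEdge k | origin e = u ∧ EdgeColor j e},
    ((edgeWeight e / vertexWeight u : ℝ) : ℂ) * f (terminus e)

variable (k) in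
/-- The automorphic spectrum of `(A_w⁺, A_w⁻)` on `L²_w(Γ \ B)`. -/
def automorphicSpectrum : Set (ℂ × ℂ) :=
  jointSpectrum (vertexWeight (k := k)) (weightedAdj 1) (weightedAdj (-1))

/-- A trivial eigenfunction on `Γ \ B`: `f(v) = ξ^τ(v)` for a cube root of unity `ξ`. -/
def IsTrivialFunction (f : QVertex k → ℂ) : Prop :=
  ∃ ξ : ℂ, ξ ^ 3 = 1 ∧ ∀ x : Vertex k, f x.toQ = ξ ^ (color x).val

variable (k) in
/-- The trivial spectrum: the pairs of eigenvalues of the trivial eigenfunctions. -/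
def trivialSpectrum : Set (ℂ × ℂ) :=
  {p | ∃ f : QVertex k → ℂ, IsTrivialFunction f ∧
    weightedAdj 1 f = p.1 • f ∧ weightedAdj (-1) f = p.2 • f}

variable (k) in
/-- `Γ \ B` is Ramanujan: every non-trivial point of the automorphic spectrum lies in the
simultaneous spectrum `𝒮³` of the building. -/
def IsRamanujan : Prop :=
  ∀ p ∈ automorphicSpectrum k, p ∉ trivialSpectrum k → p ∈ buildingSpectrum k

end Quotient

/-- The curve `{q^{3/2} e^{iθ} + q e^{-2iθ} + q^{1/2} e^{iθ} : θ ∈ ℝ}`. -/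
def Sigma1 (q : ℕ) : Set ℂ :=
  {z | ∃ θ : ℝ, z = (((q : ℝ) ^ (3 / 2 : ℝ) : ℝ) : ℂ) * Complex.exp (θ * Complex.I) +
    (q : ℂ) * Complex.exp (-2 * θ * Complex.I) +
    (((q : ℝ) ^ (1 / 2 : ℝ) : ℝ) : ℂ) * Complex.exp (θ * Complex.I)}

/-- The set `{q (s₁ + s₂ + s₃) : |s₁| = |s₂| = |s₃| = 1, s₁ s₂ s₃ = 1}`. -/
def Sigma2 (q : ℕ) : Set ℂ :=
  {z | ∃ s₁ s₂ s₃ : ℂ, ‖s₁‖ = 1 ∧ ‖s₂‖ = 1 ∧ ‖s₃‖ = 1 ∧ s₁ * s₂ * s₃ = 1 ∧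
    z = (q : ℂ) * (s₁ + s₂ + s₃)}

end

end PGLBuilding

/-!
Write `q` for the number of elements of `k` and `x₀` for the vertex of the standard lattice.  The
neighbors of a vertex `g x₀` are `g pl(i) x₀` and `g ln(i) x₀`, where `i` runs through the planes
and through the lines of `k³`; the operators `A₁` and `A₂` sum over the planes and over the lines.

**The spectrum of the building is contained in `Σ₂`.**  Relative to the flag fixed by the upper
triangular matrices, the planes fall into three classes, of `q²`, `q` and `1` elements, and `A₁` is
the sum of the corresponding horospherical operators `S₀`, `S₁`, `S₂`.  The relation defining `S_τ`
has at most `q^(2 - τ)` successors and `q^τ` predecessors at each vertex, so `S_τ` has norm at most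
`q` on `L²` (`wNorm_stepOp_le`).  Moreover `1 - A₁ T + q A₂ T² - q³ T³` is the product of the three
factors `1 - S_τ T` (`hecke_factorization`), hence bounded below for `|T| < 1 / q`.  For a point
`(l₁, l₂)` of the spectrum the polynomial `1 - l₁ T + q l₂ T² - q³ T³` therefore has no zero in that
disc.  Its inverse roots are `q s₁`, `q s₂`, `q s₃` with `|sᵢ| ≤ 1` and `s₁ s₂ s₃ = 1`, so the `sᵢ`
are on the unit circle.

**The spectrum of the building contains `Σ₂`.**  On functions that are constant on the orbits of the
integral unipotent group, `A₁` and `A₂` act in the interior of the dominant cone as weighted sums of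
translations (`exists_of_mem_orb`).  The characters `chi`, normalized by the square root of the size
of the orbits, cut off to large squares in the cone, are approximate eigenfunctions, because the
boundary of a square is small compared with the square.

**The automorphic spectrum contains `Σ₁`.**  The weighted operators on the quotient are induced by
`A₁` and `A₂` (`weightedAdj_toQ`, by counting orbits of stabilizers).  The primitive vectors `v` of
`k[t]³` have a height at each vertex, and for a function `φ` of the height the sum of `φ(height)`
over all primitive vectors is an incomplete Eisenstein series, which is invariant under `Γ`.  A
primitive vector of a lattice lies in `q + 1` of its neighbors given by planes and in one of those
given by lines; therefore `A₁` and `A₂` act on these series through the shift operators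
`φ ↦ (q + 1) φ(m - 1) + q² φ(m + 2)` and `φ ↦ φ(m - 2) + (q² + q) φ(m + 1)`
(`weightedAdj_one_eisQ`, `weightedAdj_neg_one_eisQ`).  The functions `z ^ m` are common
eigenfunctions of the shift operators, and for `|z|² = 1 / q` the eigenvalues are the points of
`Σ₁` and their conjugates.  Every vertex is equivalent under `Γ` to a diagonal one
(`exists_toQ_eq_dv`), where stabilizers and primitive vectors can be counted.  The count bounds the
error produced by cutting off `z ^ m` (`exists_wNorm_shiftOp_le`), whereas the values on the ray of
vertices `(n, 0, 0)` show that the norm of the cut-off series is unbounded (`le_wNorm_cutPow_sq`).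

**The three sets are apart.**  If `z` is in `Σ₁`, then the polynomial with inverse roots `q sᵢ`
attached to `(z, star z)` also has an inverse root of absolute value `q^{3/2}`, so `z` is not in
`Σ₂`; and `|z| < q² + q + 1`, whereas trivial points have first coordinate of absolute value
`q² + q + 1`.
-/

namespace PGLBuilding

noncomputable section

section Basic
variable {k : Type*} [Field k]

/-! ### Integral Laurent series and integral matrices -/

variable (k) in
/-- The valuation ring `k[[t⁻¹]]`, as a subring of `k((t⁻¹))`. -/
def valInt : Subring k⸨X⸩ := (algebraMap k⟦X⟧ k⸨X⸩).range

theorem mem_valInt_iff {a : k⸨X⸩} : a ∈ valInt k ↔ ∀ n < 0, a.coeff n = 0 := by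
  constructor
  · rintro ⟨f, rfl⟩ n hn
    rw [LaurentSeries.coe_algebraMap, PowerSeries.coeff_coe, if_pos hn]
  · intro h
    refine ⟨PowerSeries.mk fun n => a.coeff n, ?_⟩
    ext n
    rw [LaurentSeries.coe_algebraMap, PowerSeries.coeff_coe]
    split_ifs with hn
    · exact (h n hn).symm
    · rw [PowerSeries.coeff_mk]
      congr 1
      omega

theorem coeff_zero_algebraMap (f : k⟦X⟧) :
    (algebraMap k⟦X⟧ k⸨X⸩ f).coeff 0 = PowerSeries.constantCoeff f := by
  rw [LaurentSeries.coe_algebraMap, PowerSeries.coeff_coe]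
  simp

theorem coeff_zero_mul {a b : k⸨X⸩} (ha : a ∈ valInt k) (hb : b ∈ valInt k) :
    (a * b).coeff 0 = a.coeff 0 * b.coeff 0 := by
  obtain ⟨f, rfl⟩ := ha
  obtain ⟨g, rfl⟩ := hb
  rw [← map_mul, coeff_zero_algebraMap, coeff_zero_algebraMap, coeff_zero_algebraMap, map_mul]

theorem unif_zpow_val (n : ℤ) : ((unif k ^ n : (k⸨X⸩)ˣ) : k⸨X⸩) = HahnSeries.single n 1 := by
  rw [Units.val_zpow_eq_zpow_val, RatFunc.single_zpow]; rfl

theorem coeff_unif_zpow_mul (n m : ℤ) (a : k⸨X⸩) :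
    (((unif k ^ n : (k⸨X⸩)ˣ) : k⸨X⸩) * a).coeff m = a.coeff (m - n) := by
  rw [unif_zpow_val, HahnSeries.coeff_single_mul, one_mul]

theorem coeff_unif_mul (m : ℤ) (a : k⸨X⸩) :
    (((unif k : (k⸨X⸩)ˣ) : k⸨X⸩) * a).coeff m = a.coeff (m - 1) := by
  simpa using coeff_unif_zpow_mul 1 m a

theorem unif_zpow_mul_mem_iff {n : ℤ} {a : k⸨X⸩} :
    ((unif k ^ n : (k⸨X⸩)ˣ) : k⸨X⸩) * a ∈ valInt k ↔ ∀ m < -n, a.coeff m = 0 := by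
  rw [mem_valInt_iff]
  simp only [coeff_unif_zpow_mul]
  constructor
  · intro h m hm
    simpa using h (m + n) (by omega)
  · intro h m hm
    exact h _ (by omega)

theorem unif_mem : ((unif k : (k⸨X⸩)ˣ) : k⸨X⸩) ∈ valInt k :=
  ⟨PowerSeries.X, unif_eq_algebraMap.symm⟩

theorem unif_zpow_mem {n : ℤ} (hn : 0 ≤ n) : ((unif k ^ n : (k⸨X⸩)ˣ) : k⸨X⸩) ∈ valInt k := by
  lift n to ℕ using hn
  rw [zpow_natCast, Units.val_pow_eq_pow_val]
  exact pow_mem unif_mem n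

theorem unif_mul_mem_iff {a : k⸨X⸩} :
    (∃ b ∈ valInt k, a = ((unif k : (k⸨X⸩)ˣ) : k⸨X⸩) * b) ↔ a ∈ valInt k ∧ a.coeff 0 = 0 := by
  constructor
  · rintro ⟨b, hb, rfl⟩
    refine ⟨mul_mem unif_mem hb, ?_⟩
    rw [coeff_unif_mul]
    exact mem_valInt_iff.1 hb _ (by norm_num)
  · rintro ⟨ha, h0⟩
    refine ⟨((unif k ^ (-1 : ℤ) : (k⸨X⸩)ˣ) : k⸨X⸩) * a, ?_, ?_⟩
    · rw [unif_zpow_mul_mem_iff]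
      intro m hm
      rcases lt_or_eq_of_le (show m ≤ 0 by omega) with h | h
      · exact mem_valInt_iff.1 ha m h
      · rw [h, h0]
    · rw [← mul_assoc, ← Units.val_mul]
      simp

theorem C_mem (c : k) : (HahnSeries.C c : k⸨X⸩) ∈ valInt k :=
  ⟨PowerSeries.C c, by rw [LaurentSeries.coe_algebraMap, HahnSeries.ofPowerSeries_C]⟩

@[simp] theorem coeff_zero_C (c : k) : (HahnSeries.C c : k⸨X⸩).coeff 0 = c := by
  rw [HahnSeries.C_apply, HahnSeries.coeff_single_same]

theorem order_nonneg_of_mem {a : k⸨X⸩} (ha : a ∈ valInt k) : 0 ≤ a.order := by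
  by_cases h0 : a = 0
  · simp [h0]
  · by_contra h
    exact HahnSeries.coeff_order_eq_zero.not.2 h0 (mem_valInt_iff.1 ha _ (not_le.1 h))

theorem mem_of_order_nonneg {a : k⸨X⸩} (ha : 0 ≤ a.order) : a ∈ valInt k :=
  mem_valInt_iff.2 fun _ hn => HahnSeries.coeff_eq_zero_of_lt_order (hn.trans_le ha)

theorem order_unif_zpow (n : ℤ) : ((unif k ^ n : (k⸨X⸩)ˣ) : k⸨X⸩).order = n := by
  rw [unif_zpow_val, HahnSeries.order_single one_ne_zero]

theorem order_eq_zero_of_coeff {a : k⸨X⸩} (ha : a ∈ valInt k) (h : a.coeff 0 ≠ 0) :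
    a.order = 0 :=
  le_antisymm (HahnSeries.order_le_of_coeff_ne_zero h) (order_nonneg_of_mem ha)

theorem coeff_ne_zero_of_order {a : k⸨X⸩} (ha : a ≠ 0) (h : a.order = 0) : a.coeff 0 ≠ 0 := by
  rw [← h]; exact HahnSeries.coeff_order_eq_zero.not.2 ha

/-- The valuation of the determinant. -/
def vdet (g : GL (Fin 3) k⸨X⸩) : ℤ := (g : Matrix (Fin 3) (Fin 3) k⸨X⸩).det.order

theorem det_ne_zero (g : GL (Fin 3) k⸨X⸩) : (g : Matrix (Fin 3) (Fin 3) k⸨X⸩).det ≠ 0 :=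
  (Matrix.GeneralLinearGroup.det g).ne_zero

@[simp] theorem vdet_mul (g h : GL (Fin 3) k⸨X⸩) : vdet (g * h) = vdet g + vdet h := by
  rw [vdet, Units.val_mul, Matrix.det_mul, HahnSeries.order_mul (det_ne_zero g) (det_ne_zero h)]
  rfl

@[simp] theorem vdet_one : vdet (1 : GL (Fin 3) k⸨X⸩) = 0 := by
  simp [vdet]

@[simp] theorem vdet_inv (g : GL (Fin 3) k⸨X⸩) : vdet g⁻¹ = - vdet g := by
  have := vdet_mul g g⁻¹
  rw [mul_inv_cancel, vdet_one] at this
  omega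

variable (k) in
/-- The scalar matrix `t⁻ⁿ`. -/
def scal (n : ℤ) : GL (Fin 3) k⸨X⸩ := Matrix.GeneralLinearGroup.scalar (Fin 3) (unif k ^ n)

theorem scal_coe (n : ℤ) : (scal k n : Matrix (Fin 3) (Fin 3) k⸨X⸩) =
    Matrix.scalar (Fin 3) ((unif k ^ n : (k⸨X⸩)ˣ) : k⸨X⸩) := rfl

theorem scal_comm (n : ℤ) (g : GL (Fin 3) k⸨X⸩) : scal k n * g = g * scal k n :=
  Matrix.GeneralLinearGroup.scalar_commute _ _

theorem scal_add (m n : ℤ) : scal k (m + n) = scal k m * scal k n := by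
  rw [scal, zpow_add, map_mul]; rfl

theorem scal_zero : scal k 0 = 1 := by simp [scal]

@[simp] theorem vdet_scal (n : ℤ) : vdet (scal k n) = 3 * n := by
  rw [vdet, scal_coe, Matrix.scalar_apply, Matrix.det_diagonal, Finset.prod_const,
    ← Units.val_pow_eq_pow_val, ← zpow_natCast, ← zpow_mul, order_unif_zpow]
  simp [mul_comm]

variable (k) in
/-- The maximal compact subgroup `GL(3, k[[t⁻¹]])`. -/
def intGL : Subgroup (GL (Fin 3) k⸨X⸩) :=
  (Matrix.GeneralLinearGroup.map (n := Fin 3) (algebraMap k⟦X⟧ k⸨X⸩)).range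

theorem det_mem {A : Matrix (Fin 3) (Fin 3) k⸨X⸩} (h : ∀ i j, A i j ∈ valInt k) :
    A.det ∈ valInt k := by
  rw [Matrix.det_fin_three]
  exact sub_mem (add_mem (add_mem (sub_mem (sub_mem
    (mul_mem (mul_mem (h _ _) (h _ _)) (h _ _)) (mul_mem (mul_mem (h _ _) (h _ _)) (h _ _)))
    (mul_mem (mul_mem (h _ _) (h _ _)) (h _ _))) (mul_mem (mul_mem (h _ _) (h _ _)) (h _ _)))
    (mul_mem (mul_mem (h _ _) (h _ _)) (h _ _))) (mul_mem (mul_mem (h _ _) (h _ _)) (h _ _))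

theorem mem_intGL_iff {g : GL (Fin 3) k⸨X⸩} :
    g ∈ intGL k ↔ (∀ i j, (g : Matrix (Fin 3) (Fin 3) k⸨X⸩) i j ∈ valInt k) ∧ vdet g = 0 := by
  constructor
  · rintro ⟨κ, rfl⟩
    have h : ∀ κ : GL (Fin 3) k⟦X⟧, ∀ i j,
        ((Matrix.GeneralLinearGroup.map (algebraMap k⟦X⟧ k⸨X⸩) κ : GL (Fin 3) k⸨X⸩) :
          Matrix (Fin 3) (Fin 3) k⸨X⸩) i j ∈ valInt k := fun κ i j => ⟨_, rfl⟩
    refine ⟨h κ, le_antisymm ?_ (order_nonneg_of_mem (det_mem (h κ)))⟩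
    have h2 := order_nonneg_of_mem (det_mem (h κ⁻¹))
    rw [map_inv] at h2
    have h3 := vdet_inv (Matrix.GeneralLinearGroup.map (algebraMap k⟦X⟧ k⸨X⸩) κ)
    rw [vdet] at h3
    omega
  · rintro ⟨h, h0⟩
    choose A hA using h
    have hA' : (Matrix.of A).map (algebraMap k⟦X⟧ k⸨X⸩) = (g : Matrix (Fin 3) (Fin 3) k⸨X⸩) := by
      ext1 i j; exact hA i j
    have hdet : algebraMap k⟦X⟧ k⸨X⸩ (Matrix.of A).det = (g : Matrix (Fin 3) (Fin 3) k⸨X⸩).det := by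
      rw [← hA', RingHom.map_det]; rfl
    have hu : IsUnit (Matrix.of A).det := by
      rw [PowerSeries.isUnit_iff_constantCoeff, isUnit_iff_ne_zero, ← coeff_zero_algebraMap, hdet]
      exact coeff_ne_zero_of_order (det_ne_zero g) h0
    refine ⟨Matrix.GeneralLinearGroup.mk'' (Matrix.of A) hu, ?_⟩
    exact Units.ext hA'

theorem isLattice_std : Submodule.IsLattice k⸨X⸩ (stdLattice k) where
  fg := by
    rw [stdLattice, LinearMap.range_eq_map]
    exact Module.Finite.fg_top.map _
  span_eq_top := by
    rw [eq_top_iff]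
    intro v _
    have : v = ∑ i, v i • (Pi.single i 1 : Fin 3 → k⸨X⸩) := by
      ext j; simp [Pi.single_apply]
    rw [this]
    refine Submodule.sum_mem _ fun i _ => Submodule.smul_mem _ _ (Submodule.subset_span ?_)
    refine mem_stdLattice.2 fun j => ?_
    by_cases h : j = i
    · subst h; exact ⟨1, by simp⟩
    · exact ⟨0, by simp [h]⟩

variable (k) in
/-- The standard lattice `𝒪³`. -/
def stdL : Lattice k := ⟨stdLattice k, isLattice_std⟩

variable (k) in
/-- The vertex of the standard lattice. -/
def x₀ : Vertex k := (stdL k).toVertex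

theorem mem_stdL {v : Fin 3 → k⸨X⸩} : v ∈ (stdL k).carrier ↔ ∀ i, v i ∈ valInt k :=
  mem_stdLattice

theorem mem_smul_iff {g : GL (Fin 3) k⸨X⸩} {L : Lattice k} {v : Fin 3 → k⸨X⸩} :
    v ∈ (g • L).carrier ↔
      (((g⁻¹ : GL (Fin 3) k⸨X⸩)) : Matrix (Fin 3) (Fin 3) k⸨X⸩).mulVec v ∈ L.carrier := by
  rw [coe_GL_smul, Submodule.mem_map]
  simp only [matAct_apply]
  constructor
  · rintro ⟨w, hw, rfl⟩
    rwa [Matrix.mulVec_mulVec, ← Units.val_mul, inv_mul_cancel, Units.val_one, Matrix.one_mulVec]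
  · intro h
    refine ⟨_, h, ?_⟩
    rw [Matrix.mulVec_mulVec, ← Units.val_mul, mul_inv_cancel, Units.val_one, Matrix.one_mulVec]

theorem mulVec_mem_std {A : Matrix (Fin 3) (Fin 3) k⸨X⸩} (hA : ∀ i j, A i j ∈ valInt k)
    {v : Fin 3 → k⸨X⸩} (hv : ∀ i, v i ∈ valInt k) (i : Fin 3) : A.mulVec v i ∈ valInt k := by
  rw [Matrix.mulVec, dotProduct]
  exact sum_mem fun j _ => mul_mem (hA i j) (hv j)

theorem smul_stdL_eq_iff {g : GL (Fin 3) k⸨X⸩} : g • stdL k = stdL k ↔ g ∈ intGL k := by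
  have key : ∀ g : GL (Fin 3) k⸨X⸩, g ∈ intGL k → (g • stdL k).carrier ≤ (stdL k).carrier := by
    intro g hg v hv
    rw [coe_GL_smul] at hv
    obtain ⟨w, hw, rfl⟩ := hv
    exact mem_stdL.2 (mulVec_mem_std (mem_intGL_iff.1 hg).1 (mem_stdL.1 hw))
  have key2 : ∀ g : GL (Fin 3) k⸨X⸩, g • stdL k = stdL k →
      ∀ i j, (g : Matrix (Fin 3) (Fin 3) k⸨X⸩) i j ∈ valInt k := by
    intro g hg i j
    have h1 : matAct g (Pi.single j 1) ∈ (g • stdL k).carrier := by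
      rw [coe_GL_smul]
      refine Submodule.mem_map_of_mem (mem_stdL.2 fun l => ?_)
      by_cases h : l = j
      · subst h; rw [Pi.single_eq_same]; exact one_mem _
      · rw [Pi.single_eq_of_ne h]; exact zero_mem _
    rw [hg, mem_stdL] at h1
    have := h1 i
    rwa [matAct_apply, Matrix.mulVec_single_one] at this
  constructor
  · intro hg
    have hg' : g⁻¹ • stdL k = stdL k := by rw [inv_smul_eq_iff, hg]
    refine mem_intGL_iff.2 ⟨key2 g hg, le_antisymm ?_ (order_nonneg_of_mem (det_mem (key2 g hg)))⟩
    have h2 := order_nonneg_of_mem (det_mem (key2 _ hg'))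
    have h3 := vdet_inv g
    rw [vdet] at h3
    omega
  · intro hg
    apply Lattice.ext
    refine le_antisymm (key g hg) ?_
    intro v hv
    rw [mem_smul_iff]
    have := key g⁻¹ (inv_mem hg)
    exact this (by rw [mem_smul_iff, inv_inv, Matrix.mulVec_mulVec, ← Units.val_mul, mul_inv_cancel,
      Units.val_one, Matrix.one_mulVec]; exact hv)

theorem smul_stdL_eq_smul_iff {g h : GL (Fin 3) k⸨X⸩} :
    g • stdL k = h • stdL k ↔ h⁻¹ * g ∈ intGL k := by
  rw [← smul_stdL_eq_iff, mul_smul, inv_smul_eq_iff]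

/-- Lattices are free of rank 3 over the valuation ring: the columns of `g` form a basis of `L`. -/
theorem exists_smul_stdL (L : Lattice k) : ∃ g : GL (Fin 3) k⸨X⸩, g • stdL k = L := by
  have := L.isLattice
  have : Module.Free k⟦X⟧ L.carrier := Submodule.IsLattice.free k⸨X⸩ L.carrier
  have hr : Module.finrank k⟦X⟧ L.carrier = 3 := by
    rw [Submodule.IsLattice.finrank_of_pi k⸨X⸩ L.carrier, Fintype.card_fin]
  obtain ⟨b⟩ : Nonempty (Module.Basis (Fin 3) k⟦X⟧ L.carrier) :=
    ⟨Module.finBasisOfFinrankEq k⟦X⟧ L.carrier hr⟩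
  obtain ⟨A, hAb⟩ : ∃ A : Matrix (Fin 3) (Fin 3) k⸨X⸩, ∀ i j, A i j = (b j : Fin 3 → k⸨X⸩) i :=
    ⟨Matrix.of fun i j => (b j : Fin 3 → k⸨X⸩) i, fun _ _ => rfl⟩
  have hA : ∀ c : Fin 3 → k⟦X⟧, A.mulVec (fun i => algebraMap k⟦X⟧ k⸨X⸩ (c i)) =
      ((b.equivFun.symm c : L.carrier) : Fin 3 → k⸨X⸩) := by
    intro c
    rw [Module.Basis.equivFun_symm_apply]
    ext i
    simp [hAb, Matrix.mulVec, dotProduct, Fin.sum_univ_three, Algebra.smul_def, mul_comm]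
  have hL : ∀ v ∈ L.carrier, ∃ c : Fin 3 → k⟦X⟧,
      A.mulVec (fun i => algebraMap k⟦X⟧ k⸨X⸩ (c i)) = v := by
    intro v hv
    refine ⟨b.equivFun ⟨v, hv⟩, ?_⟩
    rw [hA, LinearEquiv.symm_apply_apply]
  have hsurj : Function.Surjective A.mulVec := by
    have h1 : LinearMap.range (Matrix.mulVecLin A) = ⊤ := by
      rw [eq_top_iff, ← L.isLattice.span_eq_top, Submodule.span_le]
      intro v hv
      obtain ⟨c, hc⟩ := hL v hv
      rw [SetLike.mem_coe, LinearMap.mem_range]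
      refine ⟨fun i => algebraMap k⟦X⟧ k⸨X⸩ (c i), ?_⟩
      rw [Matrix.mulVecLin_apply, hc]
    intro v
    obtain ⟨w, hw⟩ := LinearMap.range_eq_top.1 h1 v
    refine ⟨w, ?_⟩
    rw [← hw, Matrix.mulVecLin_apply]
  obtain ⟨u, rfl⟩ : IsUnit A := Matrix.mulVec_surjective_iff_isUnit.1 hsurj
  have hmem : ∀ v, v ∈ (u • stdL k).carrier ↔
      ∃ w : Fin 3 → k⸨X⸩, (∀ i, w i ∈ valInt k) ∧ (u : Matrix (Fin 3) (Fin 3) k⸨X⸩).mulVec w = v := by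
    intro v
    rw [coe_GL_smul, Submodule.mem_map]
    exact exists_congr fun w => and_congr_left' mem_stdL
  refine ⟨u, Lattice.ext (Submodule.ext fun v => (hmem v).trans ⟨?_, ?_⟩)⟩
  · rintro ⟨w, hw, rfl⟩
    choose c hc using hw
    obtain rfl : (fun i => algebraMap k⟦X⟧ k⸨X⸩ (c i)) = w := funext hc
    rw [hA]
    exact Subtype.coe_prop _
  · intro hv
    obtain ⟨c, hc⟩ := hL v hv
    exact ⟨_, fun i => ⟨c i, rfl⟩, hc⟩

theorem exists_smul_x₀ (x : Vertex k) : ∃ g : GL (Fin 3) k⸨X⸩, x = g • x₀ k := by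
  obtain ⟨L, rfl⟩ := toVertex_surjective x
  obtain ⟨g, rfl⟩ := exists_smul_stdL L
  exact ⟨g, rfl⟩

theorem scal_smul_stdL (n : ℤ) (L : Lattice k) : scal k n • L = (unif k ^ n) • L :=
  scalar_smul _ _

theorem smul_x₀_of_mem {g : GL (Fin 3) k⸨X⸩} (hg : g ∈ intGL k) : g • x₀ k = x₀ k := by
  rw [x₀, GL_smul_toVertex, smul_stdL_eq_iff.2 hg]

theorem scal_smul_vertex (n : ℤ) (x : Vertex k) : scal k n • x = x := by
  obtain ⟨L, rfl⟩ := toVertex_surjective x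
  rw [GL_smul_toVertex, scal_smul_stdL]
  exact toVertex_eq_iff.2 ⟨_, rfl⟩

theorem exists_unif_zpow_mul (s : (k⸨X⸩)ˣ) : ∃ (n : ℤ) (u : (k⟦X⟧)ˣ),
    s = unif k ^ n * Units.map (algebraMap k⟦X⟧ k⸨X⸩).toMonoidHom u := by
  set b : k⸨X⸩ := ((unif k ^ (-(s : k⸨X⸩).order) : (k⸨X⸩)ˣ) : k⸨X⸩) * s with hb
  have hb0 : b ≠ 0 := mul_ne_zero (Units.ne_zero _) s.ne_zero
  have hbo : b.order = 0 := by
    rw [hb, HahnSeries.order_mul (Units.ne_zero _) s.ne_zero, order_unif_zpow]; omega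
  obtain ⟨f, hf⟩ := mem_of_order_nonneg hbo.ge
  have hu : IsUnit f := by
    rw [PowerSeries.isUnit_iff_constantCoeff, isUnit_iff_ne_zero, ← coeff_zero_algebraMap, hf]
    exact coeff_ne_zero_of_order hb0 hbo
  refine ⟨(s : k⸨X⸩).order, hu.unit, ?_⟩
  apply Units.ext
  rw [Units.val_mul, Units.coe_map]
  change _ = _ * algebraMap k⟦X⟧ k⸨X⸩ f
  rw [hf, hb, ← mul_assoc, ← Units.val_mul, ← zpow_add]
  simp

/-- The stabilizer of `x₀` is the scalar matrices times `GL(3, k[[t⁻¹]])`. -/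
theorem smul_x₀_eq_iff {g h : GL (Fin 3) k⸨X⸩} :
    g • x₀ k = h • x₀ k ↔ ∃ (n : ℤ) (κ : GL (Fin 3) k⸨X⸩), κ ∈ intGL k ∧ g = h * scal k n * κ := by
  constructor
  · intro hgh
    rw [x₀, GL_smul_toVertex, GL_smul_toVertex, toVertex_eq_iff] at hgh
    obtain ⟨s, hs⟩ := hgh
    obtain ⟨n, u, rfl⟩ := exists_unif_zpow_mul s
    rw [mul_smul, units_smul_eq, ← scal_smul_stdL, smul_smul, eq_comm, smul_stdL_eq_smul_iff] at hs
    refine ⟨n, _, hs, ?_⟩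
    rw [← scal_comm, mul_inv_cancel_left]
  · rintro ⟨n, κ, hκ, rfl⟩
    rw [mul_smul, smul_x₀_of_mem hκ, mul_smul, scal_smul_vertex]

/-- Two matrices with the same valuation of the determinant give the same vertex exactly when
they give the same lattice. -/
theorem smul_x₀_eq_iff_of_vdet {g h : GL (Fin 3) k⸨X⸩} (hv : vdet g = vdet h) :
    g • x₀ k = h • x₀ k ↔ g • stdL k = h • stdL k := by
  constructor
  · rw [smul_x₀_eq_iff, smul_stdL_eq_smul_iff]
    rintro ⟨n, κ, hκ, rfl⟩
    have hn : n = 0 := by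
      rw [vdet_mul, vdet_mul, vdet_scal, (mem_intGL_iff.1 hκ).2] at hv
      omega
    subst hn
    rwa [scal_zero, mul_one, inv_mul_cancel_left]
  · intro h1
    rw [x₀, GL_smul_toVertex, GL_smul_toVertex, h1]

end Basic

section Color
variable {k : Type*} [Field k]

/-! ### The color as the valuation of the determinant -/

variable (k) in
/-- The diagonal matrix with entries `t ^ (-a i)`. -/
def dia (a : Fin 3 → ℤ) : GL (Fin 3) k⸨X⸩ :=
  Matrix.GeneralLinearGroup.mkOfDetNeZero
    (Matrix.diagonal fun i => ((unif k ^ a i : (k⸨X⸩)ˣ) : k⸨X⸩)) (by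
      rw [Matrix.det_diagonal]
      exact Finset.prod_ne_zero_iff.2 fun i _ => Units.ne_zero _)

theorem dia_coe (a : Fin 3 → ℤ) : (dia k a : Matrix (Fin 3) (Fin 3) k⸨X⸩) =
    Matrix.diagonal fun i => ((unif k ^ a i : (k⸨X⸩)ˣ) : k⸨X⸩) := rfl

theorem dia_add (a b : Fin 3 → ℤ) : dia k (a + b) = dia k a * dia k b := by
  apply Units.ext
  rw [Units.val_mul, dia_coe, dia_coe, dia_coe, Matrix.diagonal_mul_diagonal]
  congr 1
  ext1 i
  rw [Pi.add_apply, zpow_add, Units.val_mul]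

theorem dia_zero : (dia k 0) = 1 := by
  apply Units.ext
  rw [dia_coe]
  simp

theorem dia_neg (a : Fin 3 → ℤ) : (dia k (-a)) = (dia k a)⁻¹ := by
  rw [eq_inv_iff_mul_eq_one, ← dia_add, neg_add_cancel, dia_zero]

@[simp] theorem vdet_dia (a : Fin 3 → ℤ) : vdet (dia k a) = ∑ i, a i := by
  rw [vdet, dia_coe, Matrix.det_diagonal, Fin.prod_univ_three, ← Units.val_mul, ← Units.val_mul,
    ← zpow_add, ← zpow_add, order_unif_zpow, Fin.sum_univ_three]

theorem dia_const (n : ℤ) : (dia k (fun _ => n)) = scal k n := by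
  apply Units.ext
  rw [dia_coe, scal_coe, Matrix.scalar_apply]

theorem mul_dia_apply (A : Matrix (Fin 3) (Fin 3) k⸨X⸩) (a : Fin 3 → ℤ) (i j : Fin 3) :
    (A * (dia k a).1) i j = A i j * ((unif k ^ a j : (k⸨X⸩)ˣ) : k⸨X⸩) := by
  rw [dia_coe, Matrix.mul_diagonal]

theorem dia_mul_apply (A : Matrix (Fin 3) (Fin 3) k⸨X⸩) (a : Fin 3 → ℤ) (i j : Fin 3) :
    ((dia k a).1 * A) i j = ((unif k ^ a i : (k⸨X⸩)ˣ) : k⸨X⸩) * A i j := by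
  rw [dia_coe, Matrix.diagonal_mul]

theorem mem_dia_smul {a : Fin 3 → ℤ} {v : Fin 3 → k⸨X⸩} :
    v ∈ (dia k a • stdL k).carrier ↔
      ∀ i, ((unif k ^ (-a i) : (k⸨X⸩)ˣ) : k⸨X⸩) * v i ∈ valInt k := by
  rw [mem_smul_iff, ← dia_neg, mem_stdL]
  refine forall_congr' fun i => ?_
  rw [dia_coe, Matrix.mulVec_diagonal, Pi.neg_apply]

theorem det_coeff_zero {A : Matrix (Fin 3) (Fin 3) k⸨X⸩} (h : ∀ i j, A i j ∈ valInt k) :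
    A.det.coeff 0 = (Matrix.of fun i j => (A i j).coeff 0).det := by
  choose B hB using h
  obtain rfl : (Matrix.of B).map (algebraMap k⟦X⟧ k⸨X⸩) = A := by
    ext1 i j; exact hB i j
  have h1 : ((Matrix.of B).map (algebraMap k⟦X⟧ k⸨X⸩)).det =
      algebraMap k⟦X⟧ k⸨X⸩ (Matrix.of B).det := (RingHom.map_det _ _).symm
  rw [h1, coeff_zero_algebraMap, RingHom.map_det]
  congr 1
  ext i j
  exact (coeff_zero_algebraMap _).symm

/-- A matrix over the valuation ring whose determinant is not a unit has a nonzero vector in the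
kernel of its reduction. -/
theorem exists_mulVec_mem_unif {A : Matrix (Fin 3) (Fin 3) k⸨X⸩} (h : ∀ i j, A i j ∈ valInt k)
    (h0 : A.det.order ≠ 0) : ∃ c : Fin 3 → k, c ≠ 0 ∧
      ∀ i, ∃ b ∈ valInt k, ∑ j, A i j * HahnSeries.C (c j) = ((unif k : (k⸨X⸩)ˣ) : k⸨X⸩) * b := by
  have h1 : (Matrix.of fun i j => (A i j).coeff 0).det = 0 := by
    rw [← det_coeff_zero h]
    by_contra h2
    exact h0 (order_eq_zero_of_coeff (det_mem h) h2)
  obtain ⟨c, hc, hAc⟩ := Matrix.exists_mulVec_eq_zero_iff.2 h1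
  refine ⟨c, hc, fun i => unif_mul_mem_iff.2 ⟨sum_mem fun j _ => mul_mem (h i j) (C_mem _), ?_⟩⟩
  have := congrFun hAc i
  rw [Matrix.mulVec, dotProduct] at this
  rw [HahnSeries.coeff_sum]
  simp only [coeff_zero_mul (h i _) (C_mem _), coeff_zero_C]
  exact this

/-- The identity matrix with column `j` replaced by the vector `c`. -/
def colGL (j : Fin 3) (c : Fin 3 → k⸨X⸩) (hc : c j ≠ 0) : GL (Fin 3) k⸨X⸩ :=
  Matrix.GeneralLinearGroup.mkOfDetNeZero (Matrix.updateCol 1 j c) (by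
    rwa [← Matrix.cramer_apply, Matrix.cramer_one])

theorem colGL_coe (j : Fin 3) (c : Fin 3 → k⸨X⸩) (hc : c j ≠ 0) :
    (colGL j c hc : Matrix (Fin 3) (Fin 3) k⸨X⸩) = Matrix.updateCol 1 j c := rfl

theorem mul_colGL_apply (A : Matrix (Fin 3) (Fin 3) k⸨X⸩) (j : Fin 3) (c : Fin 3 → k⸨X⸩)
    (hc : c j ≠ 0) (i l : Fin 3) :
    (A * (colGL j c hc).1) i l = if l = j then ∑ m, A i m * c m else A i l := by
  rw [colGL_coe, Matrix.mul_apply]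
  split_ifs with h
  · subst h; simp
  · simp [Matrix.updateCol_ne h, Matrix.one_apply]

theorem colGL_mem {j : Fin 3} {c : Fin 3 → k} (hc : c j ≠ 0) :
    colGL j (fun i => HahnSeries.C (c i)) (by simpa using hc) ∈ intGL k := by
  refine mem_intGL_iff.2 ⟨fun i l => ?_, ?_⟩
  · rw [colGL_coe]
    by_cases h : l = j
    · subst h; rw [Matrix.updateCol_self]; exact C_mem _
    · rw [Matrix.updateCol_ne h, Matrix.one_apply]
      split_ifs
      · exact one_mem _
      · exact zero_mem _
  · rw [vdet, colGL_coe, ← Matrix.cramer_apply, Matrix.cramer_one]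
    exact order_eq_zero_of_coeff (C_mem _) (by simpa using hc)

/-- An integral matrix that is not invertible over the valuation ring is a product of an integral
matrix, the matrix `diag(1, …, t⁻¹, …, 1)` and an invertible integral matrix. -/
theorem exists_eq_mul_dia {g : GL (Fin 3) k⸨X⸩}
    (h : ∀ i j, (g : Matrix (Fin 3) (Fin 3) k⸨X⸩) i j ∈ valInt k) (h0 : vdet g ≠ 0) :
    ∃ (j : Fin 3) (g' κ : GL (Fin 3) k⸨X⸩), κ ∈ intGL k ∧
      (∀ i j, (g' : Matrix (Fin 3) (Fin 3) k⸨X⸩) i j ∈ valInt k) ∧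
      g = g' * dia k (Pi.single j 1) * κ := by
  obtain ⟨c, hc, hb⟩ := exists_mulVec_mem_unif h h0
  obtain ⟨j, hj⟩ := Function.ne_iff.1 hc
  rw [Pi.zero_apply] at hj
  have hE := colGL_mem hj
  set E := colGL j (fun i => HahnSeries.C (c i)) (by simpa using hj) with hEdef
  refine ⟨j, g * E * (dia k (Pi.single j 1))⁻¹, E⁻¹, inv_mem hE, fun i l => ?_, by group⟩
  rw [← dia_neg, Units.val_mul, mul_dia_apply, Units.val_mul, hEdef, mul_colGL_apply]
  split_ifs with hl
  · subst hl
    obtain ⟨b, hb1, hb2⟩ := hb i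
    rw [hb2, Pi.neg_apply, Pi.single_eq_same, mul_right_comm, ← Units.val_mul]
    simpa using hb1
  · rw [Pi.neg_apply, Pi.single_eq_of_ne hl]
    simpa using h i l

theorem relIndex_dia_single (j : Fin 3) :
    ((dia k (Pi.single j 1)) • stdL k).carrier.toAddSubgroup.relIndex
      (stdL k).carrier.toAddSubgroup = Nat.card k := by
  let φ : (stdL k).carrier →+ k :=
    { toFun := fun v => (v.1 j).coeff 0
      map_zero' := rfl
      map_add' := fun v w => rfl }
  have hsurj : Function.Surjective φ := by
    intro c
    exact ⟨⟨fun _ => HahnSeries.C c, mem_stdL.2 fun _ => C_mem c⟩, coeff_zero_C c⟩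
  have hker : φ.ker = ((dia k (Pi.single j 1)) • stdL k).carrier.toAddSubgroup.addSubgroupOf
      (stdL k).carrier.toAddSubgroup := by
    ext ⟨v, hv⟩
    rw [AddMonoidHom.mem_ker, AddSubgroup.mem_addSubgroupOf]
    change (v j).coeff 0 = 0 ↔ v ∈ ((dia k (Pi.single j 1)) • stdL k).carrier
    have hv' := mem_stdL.1 hv
    rw [mem_dia_smul]
    constructor
    · intro h i
      by_cases hi : i = j
      · subst hi
        obtain ⟨b, hb, hvb⟩ := unif_mul_mem_iff.2 ⟨hv' i, h⟩
        rw [hvb, Pi.single_eq_same, ← mul_assoc, ← Units.val_mul]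
        simpa using hb
      · rw [Pi.single_eq_of_ne hi]
        simpa using hv' i
    · intro h
      have := h j
      rw [Pi.single_eq_same, unif_zpow_mul_mem_iff] at this
      exact this 0 (by norm_num)
  have h1 := AddSubgroup.index_ker φ
  rw [hker, AddMonoidHom.range_eq_top.2 hsurj] at h1
  rw [AddSubgroup.relIndex, h1]
  simp

theorem matAct_injective (g : GL (Fin 3) k⸨X⸩) : Function.Injective (matAct g) := by
  intro v w hvw
  have := congrArg (matAct g⁻¹) hvw
  simpa only [← LinearMap.comp_apply, ← matAct_mul, inv_mul_cancel, matAct_one,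
    LinearMap.id_apply] using this

theorem relIndex_smul (g : GL (Fin 3) k⸨X⸩) (L M : Lattice k) :
    (g • L).carrier.toAddSubgroup.relIndex (g • M).carrier.toAddSubgroup =
      L.carrier.toAddSubgroup.relIndex M.carrier.toAddSubgroup := by
  have h : ∀ L : Lattice k, (g • L).carrier.toAddSubgroup =
      L.carrier.toAddSubgroup.map (matAct g).toAddMonoidHom := fun L => rfl
  rw [h, h]
  exact AddSubgroup.relIndex_map_map_of_injective _ _ (matAct_injective g)

theorem smul_mono (g : GL (Fin 3) k⸨X⸩) {L M : Lattice k} (h : L.carrier ≤ M.carrier) :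
    (g • L).carrier ≤ (g • M).carrier := Submodule.map_mono h

theorem smul_stdL_le {g : GL (Fin 3) k⸨X⸩}
    (h : ∀ i j, (g : Matrix (Fin 3) (Fin 3) k⸨X⸩) i j ∈ valInt k) :
    (g • stdL k).carrier ≤ (stdL k).carrier := by
  rintro v ⟨w, hw, rfl⟩
  exact mem_stdL.2 (mulVec_mem_std h (mem_stdL.1 hw))

theorem dia_single_smul_le (j : Fin 3) :
    ((dia k (Pi.single j 1)) • stdL k).carrier ≤ (stdL k).carrier := by
  refine smul_stdL_le fun i l => ?_
  rw [dia_coe, Matrix.diagonal_apply]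
  split_ifs
  · refine unif_zpow_mem ?_
    rw [Pi.single_apply]
    split_ifs <;> norm_num
  · exact zero_mem _

/-- By induction on the valuation of the determinant, splitting off one elementary divisor at a
time. -/
theorem logIndex_smul_stdL [Finite k] (n : ℕ) : ∀ g : GL (Fin 3) k⸨X⸩,
    (∀ i j, (g : Matrix (Fin 3) (Fin 3) k⸨X⸩) i j ∈ valInt k) → vdet g = n →
    (g • stdL k).carrier.toAddSubgroup.relIndex (stdL k).carrier.toAddSubgroup =
      Nat.card k ^ n := by
  induction n with
  | zero =>
    intro g h h0
    rw [smul_stdL_eq_iff.2 (mem_intGL_iff.2 ⟨h, h0⟩), AddSubgroup.relIndex_self, pow_zero]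
  | succ n ih =>
    intro g h h0
    obtain ⟨j, g', κ, hκ, hg', rfl⟩ := exists_eq_mul_dia h (by omega)
    have h1 : vdet g' = n := by
      rw [vdet_mul, vdet_mul, vdet_dia, (mem_intGL_iff.1 hκ).2] at h0
      simp at h0
      omega
    rw [mul_smul, smul_stdL_eq_iff.2 hκ, mul_smul]
    have h2 : (g' • (dia k (Pi.single j 1)) • stdL k).carrier.toAddSubgroup ≤
      (g' • stdL k).carrier.toAddSubgroup := smul_mono g' (dia_single_smul_le j)
    have h3 : (g' • stdL k).carrier.toAddSubgroup ≤ (stdL k).carrier.toAddSubgroup :=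
      smul_stdL_le hg'
    rw [← AddSubgroup.relIndex_mul_relIndex _ _ _ h2 h3, relIndex_smul, relIndex_dia_single,
      ih g' hg' h1, pow_succ, mul_comm]

theorem exists_scal_mul_integral (g : GL (Fin 3) k⸨X⸩) : ∃ n : ℤ, ∀ i j,
    ((scal k n * g : GL (Fin 3) k⸨X⸩) : Matrix (Fin 3) (Fin 3) k⸨X⸩) i j ∈ valInt k := by
  refine ⟨∑ i, ∑ j, |((g : Matrix (Fin 3) (Fin 3) k⸨X⸩) i j).order|, fun i j => ?_⟩
  rw [← dia_const, Units.val_mul, dia_mul_apply, unif_zpow_mul_mem_iff]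
  intro m hm
  apply HahnSeries.coeff_eq_zero_of_lt_order
  have h1 : |((g : Matrix (Fin 3) (Fin 3) k⸨X⸩) i j).order| ≤
      ∑ i, ∑ j, |((g : Matrix (Fin 3) (Fin 3) k⸨X⸩) i j).order| :=
    (Finset.single_le_sum (f := fun j => |((g : Matrix (Fin 3) (Fin 3) k⸨X⸩) i j).order|)
      (fun _ _ => abs_nonneg _) (Finset.mem_univ j)).trans
    (Finset.single_le_sum (f := fun i => ∑ j, |((g : Matrix (Fin 3) (Fin 3) k⸨X⸩) i j).order|)
      (fun _ _ => Finset.sum_nonneg fun _ _ => abs_nonneg _) (Finset.mem_univ i))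
  have h2 := neg_abs_le ((g : Matrix (Fin 3) (Fin 3) k⸨X⸩) i j).order
  omega

/-- The color is the valuation of the determinant modulo 3. -/
theorem color_smul_x₀ [Finite k] (g : GL (Fin 3) k⸨X⸩) : color (g • x₀ k) = (vdet g : ZMod 3) := by
  obtain ⟨n, hn⟩ := exists_scal_mul_integral g
  have h1 : g • x₀ k = ((scal k n * g) • stdL k).toVertex := by
    rw [← scal_smul_vertex n (g • x₀ k), smul_smul, x₀, GL_smul_toVertex]
  have h2 : 0 ≤ vdet (scal k n * g) := order_nonneg_of_mem (det_mem hn)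
  obtain ⟨m, hm⟩ := Int.eq_ofNat_of_zero_le h2
  have h3 := logIndex_smul_stdL m _ hn hm
  rw [h1, color_toVertex _ (smul_stdL_le hn), logIndex]
  change ((Nat.log (Nat.card k) (((scal k n * g) • stdL k).carrier.toAddSubgroup.relIndex
    (stdL k).carrier.toAddSubgroup) : ℕ) : ZMod 3) = _
  rw [h3, Nat.log_pow Finite.one_lt_card]
  rw [vdet_mul, vdet_scal] at hm
  have h4 : ((3 * n + vdet g : ℤ) : ZMod 3) = ((m : ℤ) : ZMod 3) := by rw [hm]
  rw [Int.cast_add, Int.cast_mul, show ((3 : ℤ) : ZMod 3) = 0 from rfl, zero_mul, zero_add] at h4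
  rw [h4, Int.cast_natCast]

theorem color_smul [Finite k] (g : GL (Fin 3) k⸨X⸩) (x : Vertex k) :
    color (g • x) = color x + (vdet g : ZMod 3) := by
  obtain ⟨h, rfl⟩ := exists_smul_x₀ x
  rw [smul_smul, color_smul_x₀, color_smul_x₀, vdet_mul, Int.cast_add, add_comm]

end Color

section Neighbors
variable {k : Type*} [Field k]

/-! ### Upper triangular matrices and the neighbors of a vertex -/

/-- The upper triangular matrix with rows `(α, x, z)`, `(0, β, y)`, `(0, 0, γ)`. -/
def ut (α β γ : (k⸨X⸩)ˣ) (x y z : k⸨X⸩) : GL (Fin 3) k⸨X⸩ :=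
  Matrix.GeneralLinearGroup.mkOfDetNeZero !![(α : k⸨X⸩), x, z; 0, β, y; 0, 0, γ] (by
    rw [Matrix.det_fin_three]
    simp)

theorem ut_coe (α β γ : (k⸨X⸩)ˣ) (x y z : k⸨X⸩) :
    (ut α β γ x y z : Matrix (Fin 3) (Fin 3) k⸨X⸩) = !![(α : k⸨X⸩), x, z; 0, β, y; 0, 0, γ] := rfl

theorem ut_mul (α β γ : (k⸨X⸩)ˣ) (x y z : k⸨X⸩) (α' β' γ' : (k⸨X⸩)ˣ) (x' y' z' : k⸨X⸩) :
    ut α β γ x y z * ut α' β' γ' x' y' z' =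
      ut (α * α') (β * β') (γ * γ') (α * x' + x * β') (β * y' + y * γ')
        (α * z' + x * y' + z * γ') := by
  apply Units.ext
  rw [Units.val_mul, ut_coe, ut_coe, ut_coe]
  ext1 i j
  fin_cases i <;> fin_cases j <;> simp [Matrix.mul_apply, Fin.sum_univ_three]

theorem ut_one : ut 1 1 1 0 0 0 = (1 : GL (Fin 3) k⸨X⸩) := by
  apply Units.ext
  rw [ut_coe]
  ext1 i j
  fin_cases i <;> fin_cases j <;> simp

theorem ut_inv (α β γ : (k⸨X⸩)ˣ) (x y z : k⸨X⸩) :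
    (ut α β γ x y z)⁻¹ = ut α⁻¹ β⁻¹ γ⁻¹ (-(x * (β⁻¹ : (k⸨X⸩)ˣ)) * (α⁻¹ : (k⸨X⸩)ˣ))
      (-(y * (γ⁻¹ : (k⸨X⸩)ˣ)) * (β⁻¹ : (k⸨X⸩)ˣ))
      ((x * y * (β⁻¹ : (k⸨X⸩)ˣ) - z) * (γ⁻¹ : (k⸨X⸩)ˣ) * (α⁻¹ : (k⸨X⸩)ˣ)) := by
  rw [eq_comm, eq_inv_iff_mul_eq_one, ut_mul, ← ut_one]
  simp only [inv_mul_cancel, Units.val_inv_eq_inv_val]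
  congr 1 <;> (field_simp; try ring)

theorem vdet_ut (α β γ : (k⸨X⸩)ˣ) (x y z : k⸨X⸩) :
    vdet (ut α β γ x y z) = (α : k⸨X⸩).order + (β : k⸨X⸩).order + (γ : k⸨X⸩).order := by
  have : (ut α β γ x y z : Matrix (Fin 3) (Fin 3) k⸨X⸩).det = α * β * γ := by
    rw [ut_coe, Matrix.det_fin_three]
    simp
  rw [vdet, this, HahnSeries.order_mul (mul_ne_zero α.ne_zero β.ne_zero) γ.ne_zero,
    HahnSeries.order_mul α.ne_zero β.ne_zero]

theorem dia_eq_ut (a b c : ℤ) :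
    dia k ![a, b, c] = ut (unif k ^ a) (unif k ^ b) (unif k ^ c) 0 0 0 := by
  apply Units.ext
  rw [ut_coe, dia_coe]
  ext1 i j
  fin_cases i <;> fin_cases j <;> simp

theorem mem_ut_smul {α β γ : (k⸨X⸩)ˣ} {x y z : k⸨X⸩} {v : Fin 3 → k⸨X⸩} :
    v ∈ (ut α β γ x y z • stdL k).carrier ↔ ∃ w₀ ∈ valInt k, ∃ w₁ ∈ valInt k, ∃ w₂ ∈ valInt k,
      v 0 = α * w₀ + x * w₁ + z * w₂ ∧ v 1 = β * w₁ + y * w₂ ∧ v 2 = γ * w₂ := by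
  rw [coe_GL_smul, Submodule.mem_map]
  have h : ∀ w, matAct (ut α β γ x y z) w =
      ![α * w 0 + x * w 1 + z * w 2, β * w 1 + y * w 2, γ * w 2] := by
    intro w
    rw [matAct_apply, ut_coe]
    ext1 i
    fin_cases i <;> simp [Matrix.mulVec, dotProduct, Fin.sum_univ_three]
  constructor
  · rintro ⟨w, hw, rfl⟩
    have hw' := mem_stdL.1 hw
    rw [h]
    exact ⟨w 0, hw' 0, w 1, hw' 1, w 2, hw' 2, rfl, rfl, rfl⟩
  · rintro ⟨w₀, h₀, w₁, h₁, w₂, h₂, e₀, e₁, e₂⟩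
    refine ⟨![w₀, w₁, w₂], mem_stdL.2 fun i => ?_, ?_⟩
    · fin_cases i
      exacts [h₀, h₁, h₂]
    · rw [h]
      ext1 i
      fin_cases i
      exacts [e₀.symm, e₁.symm, e₂.symm]

/-- Reduction modulo the maximal ideal. -/
def red (v : Fin 3 → k⸨X⸩) : Fin 3 → k := fun i => (v i).coeff 0

/-- The constant lift of a vector over the residue field. -/
def cst (w : Fin 3 → k) : Fin 3 → k⸨X⸩ := fun i => HahnSeries.C (w i)

@[simp] theorem red_cst (w : Fin 3 → k) : red (cst w) = w := funext fun _ => coeff_zero_C _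

theorem cst_mem (w : Fin 3 → k) (i : Fin 3) : cst w i ∈ valInt k := C_mem _

theorem mem_unif_smul_stdL {v : Fin 3 → k⸨X⸩} :
    v ∈ (unif k • stdL k).carrier ↔ (∀ i, v i ∈ valInt k) ∧ red v = 0 := by
  have h : unif k • stdL k = dia k (fun _ => 1) • stdL k := by
    rw [dia_const, scal_smul_stdL, zpow_one]
  rw [h, mem_dia_smul, funext_iff, ← forall_and]
  refine forall_congr' fun i => ?_
  rw [red, Pi.zero_apply, ← unif_mul_mem_iff]
  constructor
  · intro hi
    refine ⟨_, hi, ?_⟩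
    rw [← mul_assoc, ← Units.val_mul]
    simp
  · rintro ⟨b, hb, hv⟩
    rw [hv, ← mul_assoc, ← Units.val_mul]
    simpa using hb

variable (k) in
/-- The index set of the lines, and of the planes, of `k³`: it has `q² + q + 1` elements, grouped
by their position relative to the standard flag. -/
abbrev PIdx : Type _ := (k × k) ⊕ k ⊕ Unit

/-- The linear form defining the plane of index `i`. -/
def plForm : PIdx k → (Fin 3 → k) → k
  | .inl (a, b), w => w 0 + a * w 1 + b * w 2
  | .inr (.inl c), w => w 1 + c * w 2
  | .inr (.inr _), w => w 2

/-- The vectors of the line of index `i`. -/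
def lnMem : PIdx k → (Fin 3 → k) → Prop
  | .inl (b, c), w => w 0 = b * w 2 ∧ w 1 = c * w 2
  | .inr (.inl a), w => w 0 = a * w 1 ∧ w 2 = 0
  | .inr (.inr _), w => w 1 = 0 ∧ w 2 = 0

/-- The matrix carrying `𝒪³` to the preimage in `𝒪³` of the plane of index `i`. -/
def pl : PIdx k → GL (Fin 3) k⸨X⸩
  | .inl (a, b) => ut (unif k) 1 1 (HahnSeries.C (-a)) 0 (HahnSeries.C (-b))
  | .inr (.inl c) => ut 1 (unif k) 1 0 (HahnSeries.C (-c)) 0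
  | .inr (.inr _) => ut 1 1 (unif k) 0 0 0

/-- The matrix carrying `𝒪³` to the preimage in `𝒪³` of the line of index `i`. -/
def ln : PIdx k → GL (Fin 3) k⸨X⸩
  | .inl (b, c) => ut (unif k) (unif k) 1 0 (HahnSeries.C c) (HahnSeries.C b)
  | .inr (.inl a) => ut (unif k) 1 (unif k) (HahnSeries.C a) 0 0
  | .inr (.inr _) => ut 1 (unif k) (unif k) 0 0 0

theorem order_unif : ((unif k : (k⸨X⸩)ˣ) : k⸨X⸩).order = 1 := by
  simpa using order_unif_zpow (k := k) 1

theorem vdet_pl (i : PIdx k) : vdet (pl i) = 1 := by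
  rcases i with ⟨a, b⟩ | c | _ <;> rw [pl, vdet_ut, order_unif, Units.val_one,
    HahnSeries.order_one] <;> rfl

theorem vdet_ln (i : PIdx k) : vdet (ln i) = 2 := by
  rcases i with ⟨a, b⟩ | c | _ <;> rw [ln, vdet_ut, order_unif, Units.val_one,
    HahnSeries.order_one] <;> rfl

theorem coeff_zero_C_mul (c : k) (a : k⸨X⸩) : (HahnSeries.C c * a).coeff 0 = c * a.coeff 0 := by
  rw [HahnSeries.C_apply, HahnSeries.coeff_single_zero_mul]

theorem coeff_zero_unif_mul {a : k⸨X⸩} (ha : a ∈ valInt k) :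
    (((unif k : (k⸨X⸩)ˣ) : k⸨X⸩) * a).coeff 0 = 0 :=
  (unif_mul_mem_iff.1 ⟨a, ha, rfl⟩).2

/-- The lattice `pl i • 𝒪³` is the preimage in `𝒪³` of a plane of `k³`. -/
theorem mem_pl {i : PIdx k} {v : Fin 3 → k⸨X⸩} :
    v ∈ (pl i • stdL k).carrier ↔ (∀ j, v j ∈ valInt k) ∧ plForm i (red v) = 0 := by
  rcases i with ⟨a, b⟩ | c | _
  · rw [pl, mem_ut_smul]
    constructor
    · rintro ⟨w₀, h₀, w₁, h₁, w₂, h₂, e₀, e₁, e₂⟩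
      simp only [Units.val_one, one_mul, zero_mul, add_zero] at e₁ e₂
      refine ⟨fun j => ?_, ?_⟩
      · fin_cases j
        · exact e₀ ▸ add_mem (add_mem (mul_mem unif_mem h₀) (mul_mem (C_mem _) h₁))
            (mul_mem (C_mem _) h₂)
        · exact e₁ ▸ h₁
        · exact e₂ ▸ h₂
      · simp only [plForm, red]
        rw [e₀, e₁, e₂, HahnSeries.coeff_add, HahnSeries.coeff_add, coeff_zero_unif_mul h₀,
          coeff_zero_C_mul, coeff_zero_C_mul]
        ring
    · rintro ⟨h, hf⟩
      obtain ⟨b₀, hb, hb'⟩ := (unif_mul_mem_iff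
        (a := v 0 + HahnSeries.C a * v 1 + HahnSeries.C b * v 2)).2
        ⟨add_mem (add_mem (h 0) (mul_mem (C_mem _) (h 1))) (mul_mem (C_mem _) (h 2)), by
          rw [HahnSeries.coeff_add, HahnSeries.coeff_add, coeff_zero_C_mul, coeff_zero_C_mul]
          exact hf⟩
      refine ⟨b₀, hb, v 1, h 1, v 2, h 2, ?_, by simp, by simp⟩
      rw [← hb', map_neg, map_neg]
      ring
  · rw [pl, mem_ut_smul]
    constructor
    · rintro ⟨w₀, h₀, w₁, h₁, w₂, h₂, e₀, e₁, e₂⟩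
      simp only [Units.val_one, one_mul, zero_mul, add_zero] at e₀ e₂
      refine ⟨fun j => ?_, ?_⟩
      · fin_cases j
        · exact e₀ ▸ h₀
        · exact e₁ ▸ add_mem (mul_mem unif_mem h₁) (mul_mem (C_mem _) h₂)
        · exact e₂ ▸ h₂
      · simp only [plForm, red]
        rw [e₁, e₂, HahnSeries.coeff_add, coeff_zero_unif_mul h₁, coeff_zero_C_mul]
        ring
    · rintro ⟨h, hf⟩
      obtain ⟨b₀, hb, hb'⟩ := (unif_mul_mem_iff (a := v 1 + HahnSeries.C c * v 2)).2
        ⟨add_mem (h 1) (mul_mem (C_mem _) (h 2)), by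
          rw [HahnSeries.coeff_add, coeff_zero_C_mul]
          exact hf⟩
      refine ⟨v 0, h 0, b₀, hb, v 2, h 2, by simp, ?_, by simp⟩
      rw [← hb', map_neg]
      ring
  · rw [pl, mem_ut_smul]
    constructor
    · rintro ⟨w₀, h₀, w₁, h₁, w₂, h₂, e₀, e₁, e₂⟩
      simp only [Units.val_one, one_mul, zero_mul, add_zero] at e₀ e₁
      refine ⟨fun j => ?_, ?_⟩
      · fin_cases j
        · exact e₀ ▸ h₀
        · exact e₁ ▸ h₁
        · exact e₂ ▸ mul_mem unif_mem h₂
      · simp only [plForm, red]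
        rw [e₂, coeff_zero_unif_mul h₂]
    · rintro ⟨h, hf⟩
      obtain ⟨b₀, hb, hb'⟩ := (unif_mul_mem_iff (a := v 2)).2 ⟨h 2, hf⟩
      exact ⟨v 0, h 0, v 1, h 1, b₀, hb, by simp, by simp, hb'⟩

/-- The lattice `ln i • 𝒪³` is the preimage in `𝒪³` of a line of `k³`. -/
theorem mem_ln {i : PIdx k} {v : Fin 3 → k⸨X⸩} :
    v ∈ (ln i • stdL k).carrier ↔ (∀ j, v j ∈ valInt k) ∧ lnMem i (red v) := by
  rcases i with ⟨b, c⟩ | a | _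
  · rw [ln, mem_ut_smul]
    constructor
    · rintro ⟨w₀, h₀, w₁, h₁, w₂, h₂, e₀, e₁, e₂⟩
      simp only [Units.val_one, one_mul, zero_mul, add_zero] at e₀ e₁ e₂
      refine ⟨fun j => ?_, ?_⟩
      · fin_cases j
        · exact e₀ ▸ add_mem (mul_mem unif_mem h₀) (mul_mem (C_mem _) h₂)
        · exact e₁ ▸ add_mem (mul_mem unif_mem h₁) (mul_mem (C_mem _) h₂)
        · exact e₂ ▸ h₂
      · simp only [lnMem, red]
        rw [e₀, e₁, e₂, HahnSeries.coeff_add, HahnSeries.coeff_add, coeff_zero_unif_mul h₀,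
          coeff_zero_unif_mul h₁, coeff_zero_C_mul, coeff_zero_C_mul, zero_add, zero_add]
        exact ⟨rfl, rfl⟩
    · rintro ⟨h, hf, hf'⟩
      obtain ⟨b₀, hb, hb'⟩ := (unif_mul_mem_iff (a := v 0 - HahnSeries.C b * v 2)).2
        ⟨sub_mem (h 0) (mul_mem (C_mem _) (h 2)), by
          rw [HahnSeries.coeff_sub, coeff_zero_C_mul]
          exact sub_eq_zero.2 hf⟩
      obtain ⟨b₁, hb₁, hb₁'⟩ := (unif_mul_mem_iff (a := v 1 - HahnSeries.C c * v 2)).2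
        ⟨sub_mem (h 1) (mul_mem (C_mem _) (h 2)), by
          rw [HahnSeries.coeff_sub, coeff_zero_C_mul]
          exact sub_eq_zero.2 hf'⟩
      refine ⟨b₀, hb, b₁, hb₁, v 2, h 2, ?_, ?_, by simp⟩
      · rw [← hb']; ring
      · rw [← hb₁']; ring
  · rw [ln, mem_ut_smul]
    constructor
    · rintro ⟨w₀, h₀, w₁, h₁, w₂, h₂, e₀, e₁, e₂⟩
      simp only [Units.val_one, one_mul, zero_mul, add_zero] at e₀ e₁ e₂
      refine ⟨fun j => ?_, ?_⟩
      · fin_cases j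
        · exact e₀ ▸ add_mem (mul_mem unif_mem h₀) (mul_mem (C_mem _) h₁)
        · exact e₁ ▸ h₁
        · exact e₂ ▸ mul_mem unif_mem h₂
      · simp only [lnMem, red]
        rw [e₀, e₁, e₂, HahnSeries.coeff_add, coeff_zero_unif_mul h₀,
          coeff_zero_unif_mul h₂, coeff_zero_C_mul, zero_add]
        exact ⟨rfl, rfl⟩
    · rintro ⟨h, hf, hf'⟩
      obtain ⟨b₀, hb, hb'⟩ := (unif_mul_mem_iff (a := v 0 - HahnSeries.C a * v 1)).2
        ⟨sub_mem (h 0) (mul_mem (C_mem _) (h 1)), by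
          rw [HahnSeries.coeff_sub, coeff_zero_C_mul]
          exact sub_eq_zero.2 hf⟩
      obtain ⟨b₁, hb₁, hb₁'⟩ := (unif_mul_mem_iff (a := v 2)).2 ⟨h 2, hf'⟩
      refine ⟨b₀, hb, v 1, h 1, b₁, hb₁, ?_, by simp, hb₁'⟩
      rw [← hb']; ring
  · rw [ln, mem_ut_smul]
    constructor
    · rintro ⟨w₀, h₀, w₁, h₁, w₂, h₂, e₀, e₁, e₂⟩
      simp only [Units.val_one, one_mul, zero_mul, add_zero] at e₀ e₁ e₂
      refine ⟨fun j => ?_, ?_⟩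
      · fin_cases j
        · exact e₀ ▸ h₀
        · exact e₁ ▸ mul_mem unif_mem h₁
        · exact e₂ ▸ mul_mem unif_mem h₂
      · simp only [lnMem, red]
        rw [e₁, e₂, coeff_zero_unif_mul h₁, coeff_zero_unif_mul h₂]
        exact ⟨rfl, rfl⟩
    · rintro ⟨h, hf, hf'⟩
      obtain ⟨b₀, hb, hb'⟩ := (unif_mul_mem_iff (a := v 1)).2 ⟨h 1, hf⟩
      obtain ⟨b₁, hb₁, hb₁'⟩ := (unif_mul_mem_iff (a := v 2)).2 ⟨h 2, hf'⟩
      exact ⟨v 0, h 0, b₀, hb, b₁, hb₁, by simp, by simpa using hb', hb₁'⟩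

end Neighbors

section Neighbors
variable {k : Type*} [Field k]

/-! ### Planes, lines and adjacency -/

/-- A nonzero vector of `k³` spans exactly one line. -/
theorem exists_lnMem {v : Fin 3 → k} (hv : v ≠ 0) :
    ∃! i, lnMem i v := by
  by_cases h2 : v 2 = 0
  · by_cases h1 : v 1 = 0
    · refine ⟨.inr (.inr ()), ⟨h1, h2⟩, ?_⟩
      rintro (⟨b, c⟩ | a | _) ⟨e, e'⟩
      · refine absurd (funext fun i => ?_) hv
        fin_cases i
        exacts [by simpa [h2] using e, h1, h2]
      · refine absurd (funext fun i => ?_) hv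
        fin_cases i
        exacts [by simpa [h1] using e, h1, h2]
      · rfl
    · refine ⟨.inr (.inl (v 0 / v 1)), ⟨by field_simp, h2⟩, ?_⟩
      rintro (⟨b, c⟩ | a | _) ⟨e, e'⟩
      · exact absurd (by simpa [h2] using e') h1
      · rw [e]; field_simp
      · exact absurd e h1
  · refine ⟨.inl (v 0 / v 2, v 1 / v 2), ⟨by field_simp, by field_simp⟩, ?_⟩
    rintro (⟨b, c⟩ | a | _) ⟨e, e'⟩
    · rw [e, e']; field_simp
    · exact absurd e' h2
    · exact absurd e' h2

theorem lnMem_iff {i : PIdx k} {v w : Fin 3 → k} (hv : v ≠ 0) (hi : lnMem i v) :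
    lnMem i w ↔ ∃ c : k, c • v = w := by
  constructor
  · intro hw
    rcases i with ⟨b, c⟩ | a | _
    · have h2 : v 2 ≠ 0 := by
        intro h
        refine hv (funext fun i => ?_)
        fin_cases i
        exacts [by simpa [h] using hi.1, by simpa [h] using hi.2, h]
      refine ⟨w 2 / v 2, funext fun i => ?_⟩
      fin_cases i
      · simp only [Fin.zero_eta, Pi.smul_apply, smul_eq_mul]; rw [hi.1, hw.1]; field_simp
      · simp only [Fin.mk_one, Pi.smul_apply, smul_eq_mul]; rw [hi.2, hw.2]; field_simp
      · simp only [Fin.reduceFinMk, Pi.smul_apply, smul_eq_mul]; field_simp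
    · have h1 : v 1 ≠ 0 := by
        intro h
        refine hv (funext fun i => ?_)
        fin_cases i
        exacts [by simpa [h] using hi.1, h, hi.2]
      refine ⟨w 1 / v 1, funext fun i => ?_⟩
      fin_cases i
      · simp only [Fin.zero_eta, Pi.smul_apply, smul_eq_mul]; rw [hi.1, hw.1]; field_simp
      · simp only [Fin.mk_one, Pi.smul_apply, smul_eq_mul]; field_simp
      · simp only [Fin.reduceFinMk, Pi.smul_apply, smul_eq_mul]; rw [hi.2, hw.2, mul_zero]
    · have h0 : v 0 ≠ 0 := by
        intro h
        refine hv (funext fun i => ?_)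
        fin_cases i
        exacts [h, hi.1, hi.2]
      refine ⟨w 0 / v 0, funext fun i => ?_⟩
      fin_cases i
      · simp only [Fin.zero_eta, Pi.smul_apply, smul_eq_mul]; field_simp
      · simp only [Fin.mk_one, Pi.smul_apply, smul_eq_mul]; rw [hi.1, hw.1, mul_zero]
      · simp only [Fin.reduceFinMk, Pi.smul_apply, smul_eq_mul]; rw [hi.2, hw.2, mul_zero]
  · rintro ⟨c, rfl⟩
    rcases i with ⟨b, d⟩ | a | _
    · exact ⟨by simp [hi.1]; ring, by simp [hi.2]; ring⟩
    · exact ⟨by simp [hi.1]; ring, by simp [hi.2]⟩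
    · exact ⟨by simp [hi.1], by simp [hi.2]⟩

/-- Every nonzero linear form is proportional to one of the normalized forms. -/
theorem exists_plForm {f : (Fin 3 → k) →ₗ[k] k} (hf : f ≠ 0) :
    ∃ i, ∀ w, f w = 0 ↔ plForm i w = 0 := by
  obtain ⟨c, hc⟩ : ∃ c : Fin 3 → k, ∀ w, f w = c 0 * w 0 + c 1 * w 1 + c 2 * w 2 := by
    refine ⟨fun i => f (Pi.single i 1), fun w => ?_⟩
    have : w = ∑ i, w i • (Pi.single i 1 : Fin 3 → k) := by
      ext j; simp [Pi.single_apply]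
    conv_lhs => rw [this]
    rw [map_sum, Fin.sum_univ_three]
    simp only [map_smul, smul_eq_mul]
    ring
  simp only [hc]
  by_cases h0 : c 0 = 0
  · by_cases h1 : c 1 = 0
    · by_cases h2 : c 2 = 0
      · refine absurd (LinearMap.ext fun w => ?_) hf
        rw [hc, h0, h1, h2]; simp
      · exact ⟨.inr (.inr ()), fun w => by simp [plForm, h0, h1, h2]⟩
    · refine ⟨.inr (.inl (c 2 / c 1)), fun w => ?_⟩
      have : c 0 * w 0 + c 1 * w 1 + c 2 * w 2 = c 1 * (w 1 + c 2 / c 1 * w 2) := by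
        rw [h0]; field_simp; ring
      rw [this, plForm, mul_eq_zero, or_iff_right h1]
  · refine ⟨.inl (c 1 / c 0, c 2 / c 0), fun w => ?_⟩
    have : c 0 * w 0 + c 1 * w 1 + c 2 * w 2 = c 0 * (w 0 + c 1 / c 0 * w 1 + c 2 / c 0 * w 2) := by
      field_simp
    rw [this, plForm, mul_eq_zero, or_iff_right h0]

/-- A proper nonzero subspace of `k³` is a plane or a line. -/
theorem subspace_cases {W : Submodule k (Fin 3 → k)} (h1 : W ≠ ⊥) (h2 : W ≠ ⊤) :
    (∃ i, ∀ w, w ∈ W ↔ plForm i w = 0) ∨ ∃ i, ∀ w, w ∈ W ↔ lnMem i w := by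
  obtain ⟨f, hf, hW⟩ := Submodule.exists_le_ker_of_lt_top W (lt_top_iff_ne_top.2 h2)
  have hr := LinearMap.finrank_range_add_finrank_ker f
  rw [LinearMap.range_eq_top.2 (LinearMap.surjective hf), finrank_top, Module.finrank_self,
    Module.finrank_fin_fun] at hr
  have hle := Submodule.finrank_mono hW
  have hpos : Module.finrank k W ≠ 0 := fun h => h1 (Submodule.finrank_eq_zero.1 h)
  rcases (show Module.finrank k W = 2 ∨ Module.finrank k W = 1 by omega) with h | h
  · left
    obtain rfl : W = LinearMap.ker f := Submodule.eq_of_le_of_finrank_eq hW (by omega)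
    exact exists_plForm hf
  · right
    obtain ⟨v, hv, hvW⟩ := finrank_eq_one_iff'.1 h
    have hv0 : (v : Fin 3 → k) ≠ 0 := by simpa using hv
    obtain ⟨i, hi, -⟩ := exists_lnMem hv0
    refine ⟨i, fun w => ?_⟩
    rw [lnMem_iff hv0 hi]
    constructor
    · intro hw
      obtain ⟨c, hc⟩ := hvW ⟨w, hw⟩
      exact ⟨c, congrArg Subtype.val hc⟩
    · rintro ⟨c, rfl⟩
      exact W.smul_mem c v.2

/-- The lattices strictly between `t⁻¹ 𝒪³` and `𝒪³` are the preimages of the proper nonzero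
subspaces of `k³`. -/
theorem stdL_neighbors {M : Lattice k} (h1 : (unif k • stdL k).carrier < M.carrier)
    (h2 : M.carrier < (stdL k).carrier) :
    (∃ i : PIdx k, M = pl i • stdL k) ∨ ∃ i : PIdx k, M = ln i • stdL k := by
  let W : Submodule k (Fin 3 → k) :=
    { carrier := {w : Fin 3 → k | (cst w : Fin 3 → k⸨X⸩) ∈ M.carrier}
      zero_mem' := by
        have : (cst 0 : Fin 3 → k⸨X⸩) = 0 := funext fun _ => map_zero _
        rw [Set.mem_ofPred_eq, this]; exact zero_mem _
      add_mem' := by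
        intro v w hv hw
        have : (cst (v + w) : Fin 3 → k⸨X⸩) = cst v + cst w := funext fun _ => map_add _ _ _
        rw [Set.mem_ofPred_eq, this]; exact add_mem hv hw
      smul_mem' := by
        intro c w hw
        have : (cst (c • w) : Fin 3 → k⸨X⸩) = (PowerSeries.C c : k⟦X⟧) • cst w := by
          funext i
          change (HahnSeries.C (c * w i) : k⸨X⸩) = (PowerSeries.C c : k⟦X⟧) • HahnSeries.C (w i)
          rw [Algebra.smul_def (PowerSeries.C c : k⟦X⟧), LaurentSeries.coe_algebraMap,
            HahnSeries.ofPowerSeries_C, map_mul]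
        rw [Set.mem_ofPred_eq, this]; exact M.carrier.smul_mem _ hw }
  have hW : ∀ w, w ∈ W ↔ cst w ∈ M.carrier := fun w => Iff.rfl
  have hM : ∀ v, v ∈ M.carrier ↔ (∀ j, v j ∈ valInt k) ∧ red v ∈ W := by
    intro v
    have key : (∀ j, v j ∈ valInt k) → v - cst (red v) ∈ M.carrier := by
      intro hv
      refine h1.le (mem_unif_smul_stdL.2 ⟨fun i => sub_mem (hv i) (cst_mem _ i), ?_⟩)
      funext i
      change (v i - cst (red v) i).coeff 0 = 0
      rw [HahnSeries.coeff_sub, cst, coeff_zero_C, red, sub_self]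
    constructor
    · intro h
      have hv := mem_stdL.1 (h2.le h)
      refine ⟨hv, (hW _).2 ?_⟩
      have := sub_mem h (key hv)
      rwa [sub_sub_cancel] at this
    · rintro ⟨hv, h⟩
      have := add_mem (key hv) ((hW _).1 h)
      rwa [sub_add_cancel] at this
  have hbot : W ≠ ⊥ := by
    intro h
    refine h1.not_ge fun v hv => ?_
    have := (hM v).1 hv
    rw [h, Submodule.mem_bot] at this
    exact mem_unif_smul_stdL.2 this
  have htop : W ≠ ⊤ := by
    intro h
    refine h2.not_ge fun v hv => (hM v).2 ⟨mem_stdL.1 hv, h ▸ Submodule.mem_top⟩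
  rcases subspace_cases hbot htop with ⟨i, hi⟩ | ⟨i, hi⟩
  · exact .inl ⟨i, Lattice.ext (Submodule.ext fun v => by rw [hM, mem_pl, hi])⟩
  · exact .inr ⟨i, Lattice.ext (Submodule.ext fun v => by rw [hM, mem_ln, hi])⟩

theorem scalar_smul_vertex (s : (k⸨X⸩)ˣ) (x : Vertex k) :
    Matrix.GeneralLinearGroup.scalar (Fin 3) s • x = x := by
  obtain ⟨L, rfl⟩ := toVertex_surjective x
  rw [GL_smul_toVertex, scalar_smul]
  exact toVertex_eq_iff.2 ⟨_, rfl⟩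

theorem adj_GL_smul (g : GL (Fin 3) k⸨X⸩) {x y : Vertex k} (h : Adj x y) : Adj (g • x) (g • y) :=
  adj_smul (QuotientGroup.mk g) h

theorem adj_symm {x y : Vertex k} (h : Adj x y) : Adj y x := by
  obtain ⟨L, M, rfl, rfl, h1, h2⟩ := h
  refine ⟨M, unif k • L, rfl, toVertex_eq_iff.2 ⟨unif k, rfl⟩, ?_, h1⟩
  rw [← zpow_one (unif k), ← scal_smul_stdL, ← scal_smul_stdL, coe_GL_smul, coe_GL_smul]
  exact Submodule.map_strictMono_of_injective (matAct_injective _) h2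

theorem exists_plForm_eq_zero (i : PIdx k) : ∃ w ≠ 0, plForm i w = 0 := by
  rcases i with ⟨a, b⟩ | c | _
  · exact ⟨![-a, 1, 0], fun h => by simpa using congrFun h 1, by simp [plForm]⟩
  · exact ⟨![1, 0, 0], fun h => by simpa using congrFun h 0, by simp [plForm]⟩
  · exact ⟨![1, 0, 0], fun h => by simpa using congrFun h 0, by simp [plForm]⟩

theorem exists_plForm_ne_zero (i : PIdx k) : ∃ w, plForm i w ≠ 0 := by
  rcases i with ⟨a, b⟩ | c | _
  · exact ⟨![1, 0, 0], by simp [plForm]⟩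
  · exact ⟨![0, 1, 0], by simp [plForm]⟩
  · exact ⟨![0, 0, 1], by simp [plForm]⟩

theorem exists_lnMem_of (i : PIdx k) : ∃ w ≠ 0, lnMem i w := by
  rcases i with ⟨b, c⟩ | a | _
  · exact ⟨![b, c, 1], fun h => by simpa using congrFun h 2, by simp [lnMem]⟩
  · exact ⟨![a, 1, 0], fun h => by simpa using congrFun h 1, by simp [lnMem]⟩
  · exact ⟨![1, 0, 0], fun h => by simpa using congrFun h 0, by simp [lnMem]⟩

theorem exists_not_lnMem (i : PIdx k) : ∃ w, ¬ lnMem i w := by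
  rcases i with ⟨b, c⟩ | a | _
  · exact ⟨![b + 1, 0, 1], by simp [lnMem]⟩
  · exact ⟨![0, 0, 1], by simp [lnMem]⟩
  · exact ⟨![0, 0, 1], by simp [lnMem]⟩

theorem adj_x₀_pl (i : PIdx k) : Adj (x₀ k) (pl i • x₀ k) := by
  refine ⟨stdL k, pl i • stdL k, rfl, rfl, lt_of_le_not_ge ?_ ?_, lt_of_le_not_ge ?_ ?_⟩
  · intro v hv
    obtain ⟨h1, h2⟩ := mem_unif_smul_stdL.1 hv
    refine mem_pl.2 ⟨h1, ?_⟩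
    rw [h2]
    rcases i with ⟨a, b⟩ | c | _ <;> simp [plForm]
  · intro h
    obtain ⟨w, hw, hi⟩ := exists_plForm_eq_zero i
    have := (mem_unif_smul_stdL.1 (h (mem_pl.2 ⟨cst_mem w, by rwa [red_cst]⟩))).2
    exact hw (by rwa [red_cst] at this)
  · intro v hv
    exact mem_stdL.2 (mem_pl.1 hv).1
  · intro h
    obtain ⟨w, hw⟩ := exists_plForm_ne_zero i
    have := (mem_pl.1 (h (mem_stdL.2 (cst_mem w)))).2
    exact hw (by rwa [red_cst] at this)

theorem adj_x₀_ln (i : PIdx k) : Adj (x₀ k) (ln i • x₀ k) := by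
  refine ⟨stdL k, ln i • stdL k, rfl, rfl, lt_of_le_not_ge ?_ ?_, lt_of_le_not_ge ?_ ?_⟩
  · intro v hv
    obtain ⟨h1, h2⟩ := mem_unif_smul_stdL.1 hv
    refine mem_ln.2 ⟨h1, ?_⟩
    rw [h2]
    rcases i with ⟨a, b⟩ | c | _ <;> simp [lnMem]
  · intro h
    obtain ⟨w, hw, hi⟩ := exists_lnMem_of i
    have := (mem_unif_smul_stdL.1 (h (mem_ln.2 ⟨cst_mem w, by rwa [red_cst]⟩))).2
    exact hw (by rwa [red_cst] at this)
  · intro v hv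
    exact mem_stdL.2 (mem_ln.1 hv).1
  · intro h
    obtain ⟨w, hw⟩ := exists_not_lnMem i
    have := (mem_ln.1 (h (mem_stdL.2 (cst_mem w)))).2
    exact hw (by rwa [red_cst] at this)

/-- The neighbors of the vertex `g • x₀` correspond to the planes and the lines of `k³`. -/
theorem adj_smul_x₀_iff {g : GL (Fin 3) k⸨X⸩} {y : Vertex k} :
    Adj (g • x₀ k) y ↔ (∃ i : PIdx k, y = g • pl i • x₀ k) ∨ ∃ i : PIdx k, y = g • ln i • x₀ k := by
  constructor
  · rintro ⟨L, M, hL, rfl, h1, h2⟩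
    rw [x₀, GL_smul_toVertex, toVertex_eq_iff] at hL
    obtain ⟨s, rfl⟩ := hL
    set h := Matrix.GeneralLinearGroup.scalar (Fin 3) s * g with hh
    have hL : s • g • stdL k = h • stdL k := by rw [hh, mul_smul, scalar_smul]
    rw [hL] at h1 h2
    have hv : ∀ x : Vertex k, h • x = g • x := by
      intro x; rw [hh, mul_smul, scalar_smul_vertex]
    have e1 : (unif k • stdL k).carrier < (h⁻¹ • M).carrier := by
      have := Submodule.map_strictMono_of_injective (matAct_injective h⁻¹) h1
      rwa [← coe_GL_smul, ← coe_GL_smul, GL_smul_units_smul, inv_smul_smul] at this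
    have e2 : (h⁻¹ • M).carrier < (stdL k).carrier := by
      have := Submodule.map_strictMono_of_injective (matAct_injective h⁻¹) h2
      rwa [← coe_GL_smul, ← coe_GL_smul, inv_smul_smul] at this
    refine (stdL_neighbors e1 e2).imp ?_ ?_
    all_goals
      rintro ⟨i, hi⟩
      rw [inv_smul_eq_iff] at hi
      refine ⟨i, ?_⟩
      rw [hi, ← hv]
      rfl
  · rintro (⟨i, rfl⟩ | ⟨i, rfl⟩)
    · exact adj_GL_smul g (adj_x₀_pl i)
    · exact adj_GL_smul g (adj_x₀_ln i)

theorem plForm_injective {i j : PIdx k} (h : ∀ w, plForm i w = 0 ↔ plForm j w = 0) : i = j := by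
  have h0 := h ![1, 0, 0]
  have h1 := h ![0, 1, 0]
  rcases i with ⟨a, b⟩ | c | _ <;> rcases j with ⟨a', b'⟩ | c' | _
  · have h2 := h ![-a, 1, 0]
    have h3 := h ![-b, 0, 1]
    simp [plForm] at h2 h3
    rw [show a = a' by linear_combination -h2, show b = b' by linear_combination -h3]
  · simp [plForm] at h0
  · simp [plForm] at h0
  · simp [plForm] at h0
  · have h2 := h ![0, -c, 1]
    simp [plForm] at h2
    rw [show c = c' by linear_combination -h2]
  · simp [plForm] at h1
  · simp [plForm] at h0
  · simp [plForm] at h1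
  · rfl

theorem lnMem_injective {i j : PIdx k} (h : ∀ w, lnMem i w ↔ lnMem j w) : i = j := by
  obtain ⟨w, hw, hi⟩ := exists_lnMem_of i
  exact (exists_lnMem hw).unique hi ((h w).1 hi)

theorem pl_smul_stdL_injective {i j : PIdx k} (h : pl i • stdL k = pl j • stdL k) : i = j := by
  refine plForm_injective fun w => ?_
  have : ∀ i, plForm i w = 0 ↔ cst w ∈ (pl i • stdL k).carrier := fun i => by
    rw [mem_pl, red_cst]
    exact (and_iff_right (cst_mem w)).symm
  rw [this, this, h]

theorem smul_pl_injective (g : GL (Fin 3) k⸨X⸩) :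
    Function.Injective fun i : PIdx k => g • pl i • x₀ k := by
  intro i j hij
  have hij' := smul_left_cancel g hij
  rw [smul_x₀_eq_iff_of_vdet (by rw [vdet_pl, vdet_pl])] at hij'
  exact pl_smul_stdL_injective hij'

theorem smul_ln_injective (g : GL (Fin 3) k⸨X⸩) :
    Function.Injective fun i : PIdx k => g • ln i • x₀ k := by
  intro i j hij
  have hij' := smul_left_cancel g hij
  rw [smul_x₀_eq_iff_of_vdet (by rw [vdet_ln, vdet_ln])] at hij'
  refine lnMem_injective fun w => ?_
  have : ∀ i, lnMem i w ↔ cst w ∈ (ln i • stdL k).carrier := fun i => by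
    rw [mem_ln, red_cst]
    exact (and_iff_right (cst_mem w)).symm
  rw [this, this, hij']

theorem color_smul_pl [Finite k] (g : GL (Fin 3) k⸨X⸩) (i : PIdx k) :
    color (g • pl i • x₀ k) = color (g • x₀ k) + 1 := by
  rw [smul_smul, color_smul_x₀, color_smul_x₀, vdet_mul, vdet_pl]
  push_cast; rfl

theorem color_smul_ln [Finite k] (g : GL (Fin 3) k⸨X⸩) (i : PIdx k) :
    color (g • ln i • x₀ k) = color (g • x₀ k) + 2 := by
  rw [smul_smul, color_smul_x₀, color_smul_x₀, vdet_mul, vdet_ln]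
  push_cast; rfl

theorem neighbors_one [Finite k] (g : GL (Fin 3) k⸨X⸩) :
    {y | Adj (g • x₀ k) y ∧ color y = color (g • x₀ k) + 1} =
      Set.range fun i : PIdx k => g • pl i • x₀ k := by
  ext y
  rw [Set.mem_ofPred_eq, adj_smul_x₀_iff]
  constructor
  · rintro ⟨⟨i, rfl⟩ | ⟨i, rfl⟩, h⟩
    · exact ⟨i, rfl⟩
    · rw [color_smul_ln] at h
      exact absurd (add_left_cancel h) (by decide)
  · rintro ⟨i, rfl⟩
    exact ⟨.inl ⟨i, rfl⟩, color_smul_pl g i⟩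

theorem neighbors_two [Finite k] (g : GL (Fin 3) k⸨X⸩) :
    {y | Adj (g • x₀ k) y ∧ color y = color (g • x₀ k) + 2} =
      Set.range fun i : PIdx k => g • ln i • x₀ k := by
  ext y
  rw [Set.mem_ofPred_eq, adj_smul_x₀_iff]
  constructor
  · rintro ⟨⟨i, rfl⟩ | ⟨i, rfl⟩, h⟩
    · rw [color_smul_pl] at h
      exact absurd (add_left_cancel h) (by decide)
    · exact ⟨i, rfl⟩
  · rintro ⟨i, rfl⟩
    exact ⟨.inr ⟨i, rfl⟩, color_smul_ln g i⟩

/-- The neighbors `y` of `x` with `τ(y) = τ(x) + 1` are represented by the sublattices of index `q`,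
that is, by the planes of `k³`. -/
theorem coloredAdj_one [Fintype k] (f : Vertex k → ℂ) (g : GL (Fin 3) k⸨X⸩) :
    coloredAdj 1 f (g • x₀ k) = ∑ i : PIdx k, f (g • pl i • x₀ k) := by
  rw [coloredAdj, neighbors_one, finsum_mem_range (smul_pl_injective g), finsum_eq_sum_of_fintype]

/-- The neighbors `y` of `x` with `τ(y) = τ(x) + 2` are represented by the lines of `k³`. -/
theorem coloredAdj_two [Fintype k] (f : Vertex k → ℂ) (g : GL (Fin 3) k⸨X⸩) :
    coloredAdj 2 f (g • x₀ k) = ∑ i : PIdx k, f (g • ln i • x₀ k) := by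
  rw [coloredAdj, neighbors_two, finsum_mem_range (smul_ln_injective g), finsum_eq_sum_of_fintype]

end Neighbors

section Norm
variable {V : Type*}

/-! ### The weighted norm -/

theorem wNorm_sq (w : V → ℝ) (f : V → ℂ) :
    wNorm w f ^ 2 = ∑' v, ENNReal.ofReal (w v) * ‖f v‖ₑ ^ 2 := by
  rw [wNorm, ← ENNReal.rpow_natCast, ← ENNReal.rpow_mul]
  norm_num

theorem wNorm_le_iff_sq {w : V → ℝ} {f : V → ℂ} {a : ℝ≥0∞} :
    wNorm w f ≤ a ↔ ∑' v, ENNReal.ofReal (w v) * ‖f v‖ₑ ^ 2 ≤ a ^ 2 := by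
  rw [← wNorm_sq]
  exact (ENNReal.pow_le_pow_left_iff two_ne_zero).symm

/-- The weighted norm is the `L²` norm of a sum of point masses, whence the triangle inequality. -/
theorem wNorm_eq_eLpNorm [MeasurableSpace V] [DiscreteMeasurableSpace V] (w : V → ℝ)
    (f : V → ℂ) : wNorm w f = MeasureTheory.eLpNorm f 2
      (MeasureTheory.Measure.sum fun v =>
        ENNReal.ofReal (w v) • MeasureTheory.Measure.dirac v) := by
  rw [MeasureTheory.eLpNorm_eq_lintegral_rpow_enorm_toReal (by norm_num) (by norm_num),
    MeasureTheory.lintegral_sum_measure, wNorm]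
  simp [MeasureTheory.lintegral_smul_measure]

theorem wNorm_add_le (w : V → ℝ) (f g : V → ℂ) : wNorm w (f + g) ≤ wNorm w f + wNorm w g := by
  let _ : MeasurableSpace V := ⊤
  have _ : DiscreteMeasurableSpace V := ⟨fun _ => trivial⟩
  rw [wNorm_eq_eLpNorm, wNorm_eq_eLpNorm, wNorm_eq_eLpNorm]
  have h : ∀ f : V → ℂ, MeasureTheory.AEStronglyMeasurable f
      (MeasureTheory.Measure.sum fun v => ENNReal.ofReal (w v) • MeasureTheory.Measure.dirac v) :=
    fun f => (measurable_from_top (f := f)).aestronglyMeasurable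
  exact MeasureTheory.eLpNorm_add_le (h f) (h g) one_le_two

theorem wNorm_smul (w : V → ℝ) (c : ℂ) (f : V → ℂ) : wNorm w (c • f) = ‖c‖ₑ * wNorm w f := by
  let _ : MeasurableSpace V := ⊤
  have _ : DiscreteMeasurableSpace V := ⟨fun _ => trivial⟩
  rw [wNorm_eq_eLpNorm, wNorm_eq_eLpNorm, MeasureTheory.eLpNorm_const_smul]

theorem wNorm_neg (w : V → ℝ) (f : V → ℂ) : wNorm w (-f) = wNorm w f := by
  simp [wNorm]

theorem wNorm_sub_le (w : V → ℝ) (f g : V → ℂ) : wNorm w (f - g) ≤ wNorm w f + wNorm w g := by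
  rw [sub_eq_add_neg, ← wNorm_neg w g]
  exact wNorm_add_le w f (-g)

theorem wNorm_zero (w : V → ℝ) : wNorm w (0 : V → ℂ) = 0 := by
  simp [wNorm]

theorem wNorm_sum_le {ι : Type*} (s : Finset ι) (w : V → ℝ) (f : ι → V → ℂ) :
    wNorm w (∑ i ∈ s, f i) ≤ ∑ i ∈ s, wNorm w (f i) := by
  classical
  induction s using Finset.induction_on with
  | empty => simp [wNorm_zero]
  | insert a s ha ih =>
    rw [Finset.sum_insert ha, Finset.sum_insert ha]
    exact (wNorm_add_le _ _ _).trans (add_le_add le_rfl ih)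

theorem enorm_sum_sq_le {ι : Type*} (s : Finset ι) (f : ι → ℂ) :
    ‖∑ i ∈ s, f i‖ₑ ^ 2 ≤ s.card * ∑ i ∈ s, ‖f i‖ₑ ^ 2 := by
  have h1 : ‖∑ i ∈ s, f i‖ₑ ≤ ∑ i ∈ s, ‖f i‖ₑ := enorm_sum_le _ _
  have h2 := ENNReal.rpow_sum_le_const_mul_sum_rpow s (fun i => ‖f i‖ₑ) (p := 2) one_le_two
  have h3 := pow_le_pow_left' h1 2
  refine h3.trans ?_
  norm_num at h2
  exact h2

/-- A summation operator over a relation with at most `d` successors and at most `e`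
predecessors of each element has norm at most `√(d e)`. -/
theorem tsum_enorm_sum_sq_le {R : V → V → Prop} {d e : ℕ}
    (hfin : ∀ x, {y | R x y}.Finite) (hd : ∀ x, {y | R x y}.ncard ≤ d)
    (he : ∀ y, {x | R x y}.encard ≤ e) (f : V → ℂ) :
    ∑' x, ‖∑ᶠ y ∈ {y | R x y}, f y‖ₑ ^ 2 ≤ (d * e : ℕ) * ∑' y, ‖f y‖ₑ ^ 2 := by
  classical
  have h1 : ∀ x, ‖∑ᶠ y ∈ {y | R x y}, f y‖ₑ ^ 2 ≤
      d * ∑' y, if R x y then ‖f y‖ₑ ^ 2 else 0 := by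
    intro x
    rw [finsum_mem_eq_finite_toFinset_sum f (hfin x)]
    refine (enorm_sum_sq_le _ _).trans ?_
    gcongr
    · rw [← Set.ncard_eq_toFinset_card _ (hfin x)]; exact hd x
    · refine le_trans (le_of_eq ?_)
        (ENNReal.sum_le_tsum (f := fun y => if R x y then ‖f y‖ₑ ^ 2 else 0) (hfin x).toFinset)
      refine Finset.sum_congr rfl fun y hy => ?_
      rw [if_pos (by simpa using hy)]
  calc ∑' x, ‖∑ᶠ y ∈ {y | R x y}, f y‖ₑ ^ 2
      ≤ ∑' x, d * ∑' y, (if R x y then ‖f y‖ₑ ^ 2 else 0) := ENNReal.tsum_le_tsum h1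
    _ = d * ∑' y, ∑' x, (if R x y then ‖f y‖ₑ ^ 2 else 0) := by
        rw [ENNReal.tsum_mul_left, ENNReal.tsum_comm]
    _ ≤ d * ∑' y, e * ‖f y‖ₑ ^ 2 := by
        gcongr with y
        have : (∑' x, if R x y then ‖f y‖ₑ ^ 2 else 0) = {x | R x y}.encard * ‖f y‖ₑ ^ 2 := by
          rw [← ENNReal.tsum_set_const, tsum_subtype {x | R x y} fun _ => ‖f y‖ₑ ^ 2]
          rfl
        rw [this]
        gcongr
        exact_mod_cast he y
    _ = _ := by
        rw [ENNReal.tsum_mul_left, ← mul_assoc]; push_cast; rfl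

theorem star_eq_inv {s : ℂ} (hs : ‖s‖ = 1) : star s = s⁻¹ := by
  rw [Complex.inv_def, Complex.normSq_eq_norm_sq, hs]
  simp

end Norm

section Borel
variable {k : Type*} [Field k]

/-! ### The horospherical decomposition of the adjacency operators -/

/-- Upper triangular matrices. -/
def IsUp (g : GL (Fin 3) k⸨X⸩) : Prop := ∃ α β γ x y z, g = ut α β γ x y z

theorem isUp_ut (α β γ : (k⸨X⸩)ˣ) (x y z : k⸨X⸩) : IsUp (ut α β γ x y z) :=
  ⟨_, _, _, _, _, _, rfl⟩

theorem IsUp.mul {g h : GL (Fin 3) k⸨X⸩} (hg : IsUp g) (hh : IsUp h) : IsUp (g * h) := by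
  obtain ⟨_, _, _, _, _, _, rfl⟩ := hg
  obtain ⟨_, _, _, _, _, _, rfl⟩ := hh
  exact ⟨_, _, _, _, _, _, ut_mul _ _ _ _ _ _ _ _ _ _ _ _⟩

theorem IsUp.inv {g : GL (Fin 3) k⸨X⸩} (hg : IsUp g) : IsUp g⁻¹ := by
  obtain ⟨_, _, _, _, _, _, rfl⟩ := hg
  exact ⟨_, _, _, _, _, _, ut_inv _ _ _ _ _ _⟩

theorem scal_eq_ut (n : ℤ) : scal k n = ut (unif k ^ n) (unif k ^ n) (unif k ^ n) 0 0 0 := by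
  rw [← dia_const, ← dia_eq_ut]
  congr 1
  ext i
  fin_cases i <;> rfl

theorem isUp_scal (n : ℤ) : IsUp (scal k n) := ⟨_, _, _, _, _, _, scal_eq_ut n⟩

theorem dia_eq_ut' (a : Fin 3 → ℤ) :
    dia k a = ut (unif k ^ a 0) (unif k ^ a 1) (unif k ^ a 2) 0 0 0 := by
  rw [← dia_eq_ut]
  congr 1
  ext i
  fin_cases i <;> rfl

theorem isUp_dia (a : Fin 3 → ℤ) : IsUp (dia k a) := ⟨_, _, _, _, _, _, dia_eq_ut' a⟩

theorem isUp_pl (i : PIdx k) : IsUp (pl i) := by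
  rcases i with ⟨a, b⟩ | c | _ <;> exact isUp_ut _ _ _ _ _ _

theorem isUp_ln (i : PIdx k) : IsUp (ln i) := by
  rcases i with ⟨a, b⟩ | c | _ <;> exact isUp_ut _ _ _ _ _ _

theorem dia_single_eq (j : Fin 3) : ∃ i, dia k (Pi.single j 1) = pl i := by
  fin_cases j
  · exact ⟨.inl (0, 0), by rw [dia_eq_ut', pl]; simp⟩
  · exact ⟨.inr (.inl 0), by rw [dia_eq_ut', pl]; simp⟩
  · exact ⟨.inr (.inr ()), by rw [dia_eq_ut', pl]; simp⟩

/-- The Iwasawa decomposition: the upper triangular matrices act transitively on the vertices. -/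
theorem exists_isUp_smul_x₀ (x : Vertex k) : ∃ b : GL (Fin 3) k⸨X⸩, IsUp b ∧ x = b • x₀ k := by
  have main : ∀ (n : ℕ) (g : GL (Fin 3) k⸨X⸩),
      (∀ i j, (g : Matrix (Fin 3) (Fin 3) k⸨X⸩) i j ∈ valInt k) → vdet g = n →
      ∃ b : GL (Fin 3) k⸨X⸩, IsUp b ∧ g • x₀ k = b • x₀ k := by
    intro n
    induction n with
    | zero =>
      intro g h h0
      refine ⟨1, ⟨_, _, _, _, _, _, ut_one.symm⟩, ?_⟩
      rw [smul_x₀_of_mem (mem_intGL_iff.2 ⟨h, h0⟩), one_smul]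
    | succ n ih =>
      intro g h h0
      obtain ⟨j, g', κ, hκ, hg', rfl⟩ := exists_eq_mul_dia h (by omega)
      have h1 : vdet g' = n := by
        rw [vdet_mul, vdet_mul, vdet_dia, (mem_intGL_iff.1 hκ).2] at h0
        simp at h0
        omega
      obtain ⟨b, hb, hgb⟩ := ih g' hg' h1
      obtain ⟨i, hi⟩ := dia_single_eq (k := k) j
      have h2 : Adj (g' • x₀ k) ((g' * dia k (Pi.single j 1) * κ) • x₀ k) := by
        rw [mul_smul, smul_x₀_of_mem hκ, mul_smul, hi]
        exact adj_GL_smul g' (adj_x₀_pl i)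
      rw [hgb, adj_smul_x₀_iff] at h2
      rcases h2 with ⟨l, hl⟩ | ⟨l, hl⟩
      · exact ⟨b * pl l, hb.mul (isUp_pl l), by rw [hl, mul_smul]⟩
      · exact ⟨b * ln l, hb.mul (isUp_ln l), by rw [hl, mul_smul]⟩
  obtain ⟨g, rfl⟩ := exists_smul_x₀ x
  obtain ⟨n, hn⟩ := exists_scal_mul_integral g
  obtain ⟨m, hm⟩ := Int.eq_ofNat_of_zero_le
    (show 0 ≤ vdet (scal k n * g) from order_nonneg_of_mem (det_mem hn))
  obtain ⟨b, hb, h⟩ := main m _ hn hm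
  refine ⟨b, hb, ?_⟩
  rw [← h, mul_smul, scal_smul_vertex]

theorem ut_mem_intGL {α β γ : (k⸨X⸩)ˣ} {x y z : k⸨X⸩} (h : ut α β γ x y z ∈ intGL k) :
    (α : k⸨X⸩) ∈ valInt k ∧ (β : k⸨X⸩) ∈ valInt k ∧ (γ : k⸨X⸩) ∈ valInt k ∧
    (α : k⸨X⸩).order = 0 ∧ (β : k⸨X⸩).order = 0 ∧ (γ : k⸨X⸩).order = 0 ∧
      x ∈ valInt k ∧ y ∈ valInt k ∧ z ∈ valInt k := by
  obtain ⟨h1, h2⟩ := mem_intGL_iff.1 h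
  rw [vdet_ut] at h2
  have a0 : (α : k⸨X⸩) ∈ valInt k := h1 0 0
  have a1 : (β : k⸨X⸩) ∈ valInt k := h1 1 1
  have a2 : (γ : k⸨X⸩) ∈ valInt k := h1 2 2
  have o0 := order_nonneg_of_mem a0
  have o1 := order_nonneg_of_mem a1
  have o2 := order_nonneg_of_mem a2
  exact ⟨a0, a1, a2, by omega, by omega, by omega, h1 0 1, h1 1 2, h1 0 2⟩

theorem ut_mem_intGL_of {α β γ : (k⸨X⸩)ˣ} {x y z : k⸨X⸩} (hα : (α : k⸨X⸩).order = 0)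
    (hβ : (β : k⸨X⸩).order = 0) (hγ : (γ : k⸨X⸩).order = 0) (hx : x ∈ valInt k)
    (hy : y ∈ valInt k) (hz : z ∈ valInt k) : ut α β γ x y z ∈ intGL k := by
  refine mem_intGL_iff.2 ⟨fun i j => ?_, by rw [vdet_ut, hα, hβ, hγ]; rfl⟩
  rw [ut_coe]
  fin_cases i <;> fin_cases j
  exacts [mem_of_order_nonneg hα.ge, hx, hz, zero_mem _, mem_of_order_nonneg hβ.ge, hy,
    zero_mem _, zero_mem _, mem_of_order_nonneg hγ.ge]

theorem unip_mem_intGL {x y z : k⸨X⸩} (hx : x ∈ valInt k)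
    (hy : y ∈ valInt k) (hz : z ∈ valInt k) : ut 1 1 1 x y z ∈ intGL k :=
  ut_mem_intGL_of (by simp) (by simp) (by simp) hx hy hz

/-- Two upper triangular matrices give the same vertex exactly when they differ by a scalar and an
upper triangular matrix over the valuation ring. -/
theorem IsUp.exists_of_smul_x₀_eq {b b' : GL (Fin 3) k⸨X⸩} (hb : IsUp b) (hb' : IsUp b')
    (h : b' • x₀ k = b • x₀ k) :
    ∃ (n : ℤ) (κ : GL (Fin 3) k⸨X⸩), κ ∈ intGL k ∧ IsUp κ ∧ b' = b * scal k n * κ := by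
  obtain ⟨n, κ, hκ, rfl⟩ := smul_x₀_eq_iff.1 h
  refine ⟨n, κ, hκ, ?_, rfl⟩
  have := (hb.mul (isUp_scal n)).inv.mul hb'
  rwa [inv_mul_cancel_left] at this

/-- In a vertex `b • dia k e • x₀` the integral upper triangular matrix `b` matters only through its
entries above the diagonal, normalized to a unipotent matrix, and only to finite order. -/
theorem ut_dia_smul_eq {α β γ : (k⸨X⸩)ˣ} {x y z p r s : k⸨X⸩} {e : Fin 3 → ℤ}
    (hα : (α : k⸨X⸩).order = 0) (hβ : (β : k⸨X⸩).order = 0) (hγ : (γ : k⸨X⸩).order = 0)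
    (h₁ : ((unif k ^ (e 1 - e 0) : (k⸨X⸩)ˣ) : k⸨X⸩) * (x - p * β) ∈ valInt k)
    (h₂ : ((unif k ^ (e 2 - e 1) : (k⸨X⸩)ˣ) : k⸨X⸩) * (y - r * γ) ∈ valInt k)
    (h₃ : ((unif k ^ (e 2 - e 0) : (k⸨X⸩)ˣ) : k⸨X⸩) * (z - p * y + (p * r - s) * γ) ∈ valInt k) :
    ut α β γ x y z • dia k e • x₀ k = ut 1 1 1 p r s • dia k e • x₀ k := by
  rw [smul_smul, smul_smul, smul_x₀_eq_iff]
  refine ⟨0, _, ut_mem_intGL_of hα hβ hγ h₁ h₂ h₃, ?_⟩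
  rw [scal_zero, mul_one, dia_eq_ut', ut_mul, ut_mul, ut_mul]
  have hu : ∀ a b : ℤ, ((unif k ^ (a - b) : (k⸨X⸩)ˣ) : k⸨X⸩) =
      (unif k ^ a : (k⸨X⸩)ˣ) * ((unif k ^ b : (k⸨X⸩)ˣ) : k⸨X⸩)⁻¹ := by
    intro a b
    rw [zpow_sub, Units.val_mul, Units.val_inv_eq_inv_val]
  have hn : ∀ a : ℤ, ((unif k ^ a : (k⸨X⸩)ˣ) : k⸨X⸩) ≠ 0 := fun a => Units.ne_zero _
  have := hn (e 0)
  have := hn (e 1)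
  have := hn (e 2)
  simp only [hu, Units.val_one, Units.val_mul]
  congr 1
  · rw [one_mul, mul_comm]
  · rw [one_mul, mul_comm]
  · rw [one_mul, mul_comm]
  · field_simp; ring
  · field_simp; ring
  · field_simp; ring

/-- `Step τ x y`: the class `y` is obtained from `x` by shrinking the `τ`-th graded piece of the
standard flag by one step. -/
def Step (τ : Fin 3) (x y : Vertex k) : Prop :=
  ∃ b : GL (Fin 3) k⸨X⸩, IsUp b ∧ x = b • x₀ k ∧ y = b • dia k (Pi.single τ 1) • x₀ k

/-- The successors under `Step τ` of a vertex are controlled by the orbit of one of them under the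
integral upper triangular matrices. -/
theorem step_succ_subset {τ : Fin 3} {ι : Type*} {u : ι → GL (Fin 3) k⸨X⸩} {b : GL (Fin 3) k⸨X⸩}
    (hb : IsUp b)
    (hu : ∀ κ ∈ intGL k, IsUp κ → ∃ i, κ • dia k (Pi.single τ 1) • x₀ k =
      u i • dia k (Pi.single τ 1) • x₀ k) :
    {y | Step τ (b • x₀ k) y} ⊆ Set.range fun i => b • u i • dia k (Pi.single τ 1) • x₀ k := by
  rintro y ⟨b', hb', h, rfl⟩
  obtain ⟨n, κ, hκ, hκ', rfl⟩ := hb.exists_of_smul_x₀_eq hb' h.symm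
  obtain ⟨i, hi⟩ := hu κ hκ hκ'
  refine ⟨i, ?_⟩
  simp only
  rw [mul_smul, hi, mul_smul, scal_smul_vertex]

/-- The analogue of `step_succ_subset` for predecessors. -/
theorem step_pred_subset {τ : Fin 3} {ι : Type*} {u : ι → GL (Fin 3) k⸨X⸩} {b : GL (Fin 3) k⸨X⸩}
    (hb : IsUp b)
    (hu : ∀ κ ∈ intGL k, IsUp κ → ∃ i, κ • dia k (-Pi.single τ 1) • x₀ k =
      u i • dia k (-Pi.single τ 1) • x₀ k) :
    {x | Step τ x (b • x₀ k)} ⊆ Set.range fun i => b • u i • dia k (-Pi.single τ 1) • x₀ k := by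
  rintro y ⟨b', hb', rfl, h⟩
  rw [smul_smul] at h
  obtain ⟨n, κ, hκ, hκ', hbκ⟩ := hb.exists_of_smul_x₀_eq (hb'.mul (isUp_dia _)) h.symm
  obtain ⟨i, hi⟩ := hu κ hκ hκ'
  refine ⟨i, ?_⟩
  simp only
  rw [← eq_mul_inv_iff_mul_eq] at hbκ
  rw [hbκ, ← hi, ← dia_neg, mul_smul, mul_smul, mul_smul, scal_smul_vertex]

theorem exists_C_mul_sub {x β : k⸨X⸩} (hx : x ∈ valInt k) (hβ : β ∈ valInt k) (hβ0 : β ≠ 0)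
    (h0 : β.order = 0) :
    ∃ c : k, ((unif k ^ (-1 : ℤ) : (k⸨X⸩)ˣ) : k⸨X⸩) * (x - HahnSeries.C c * β) ∈ valInt k := by
  refine ⟨x.coeff 0 / β.coeff 0, ?_⟩
  have hc := coeff_ne_zero_of_order hβ0 h0
  obtain ⟨b, hb, h⟩ := (unif_mul_mem_iff (a := x - HahnSeries.C (x.coeff 0 / β.coeff 0) * β)).2
    ⟨sub_mem hx (mul_mem (C_mem _) hβ), by
      rw [HahnSeries.coeff_sub, coeff_zero_C_mul]; field_simp; simp⟩
  rw [h, ← mul_assoc, ← Units.val_mul]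
  simpa using hb

theorem pl_inl_eq (a b : k) : pl (.inl (a, b)) =
    ut 1 1 1 (HahnSeries.C (-a)) 0 (HahnSeries.C (-b)) * dia k (Pi.single 0 1) := by
  rw [dia_eq_ut', ut_mul, pl]
  simp

theorem pl_inr_inl_eq (c : k) : pl (.inr (.inl c)) =
    ut 1 1 1 0 (HahnSeries.C (-c)) 0 * dia k (Pi.single 1 1) := by
  rw [dia_eq_ut', ut_mul, pl]
  simp

theorem pl_inr_inr_eq : pl (k := k) (.inr (.inr ())) = dia k (Pi.single 2 1) := by
  rw [dia_eq_ut', pl]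
  simp

theorem step_of {τ : Fin 3} {b u : GL (Fin 3) k⸨X⸩} (hb : IsUp b) (hu : IsUp u)
    (hu' : u ∈ intGL k) : Step τ (b • x₀ k) (b • u • dia k (Pi.single τ 1) • x₀ k) :=
  ⟨b * u, hb.mul hu, by rw [mul_smul, smul_x₀_of_mem hu'], by rw [mul_smul]⟩

/-- Each vertex has `q²` successors and at most one predecessor (`step_zero_pred`) under
`Step 0`. -/
theorem step_zero {b : GL (Fin 3) k⸨X⸩} (hb : IsUp b) :
    {y | Step 0 (b • x₀ k) y} = Set.range fun p : k × k => b • pl (.inl p) • x₀ k := by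
  apply Set.Subset.antisymm
  · refine (step_succ_subset (u := fun p : k × k =>
      ut 1 1 1 (HahnSeries.C (-p.1)) 0 (HahnSeries.C (-p.2))) hb ?_).trans (le_of_eq ?_)
    · rintro κ hκ ⟨α, β, γ, x, y, z, rfl⟩
      obtain ⟨a0, a1, a2, o0, o1, o2, hx, hy, hz⟩ := ut_mem_intGL hκ
      obtain ⟨p, hp⟩ := exists_C_mul_sub hx a1 β.ne_zero o1
      obtain ⟨s, hs⟩ := exists_C_mul_sub (sub_mem hz (mul_mem (C_mem p) hy)) a2 γ.ne_zero o2
      refine ⟨(-p, -s), ut_dia_smul_eq o0 o1 o2 (by simpa using hp) (by simpa using hy) ?_⟩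
      simpa [sub_eq_add_neg] using hs
    · congr 1
      funext p
      rw [pl_inl_eq, mul_smul]
  · rintro _ ⟨p, rfl⟩
    simp only
    rw [pl_inl_eq, mul_smul]
    exact step_of hb (isUp_ut _ _ _ _ _ _) (unip_mem_intGL (C_mem _) (zero_mem _) (C_mem _))

/-- Each vertex has `q` successors and at most `q` predecessors (`step_one_pred`) under `Step 1`. -/
theorem step_one {b : GL (Fin 3) k⸨X⸩} (hb : IsUp b) :
    {y | Step 1 (b • x₀ k) y} = Set.range fun c : k => b • pl (.inr (.inl c)) • x₀ k := by
  apply Set.Subset.antisymm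
  · refine (step_succ_subset (u := fun c : k =>
      ut 1 1 1 0 (HahnSeries.C (-c)) 0) hb ?_).trans (le_of_eq ?_)
    · rintro κ hκ ⟨α, β, γ, x, y, z, rfl⟩
      obtain ⟨a0, a1, a2, o0, o1, o2, hx, hy, hz⟩ := ut_mem_intGL hκ
      obtain ⟨r, hr⟩ := exists_C_mul_sub hy a2 γ.ne_zero o2
      refine ⟨-r, ut_dia_smul_eq o0 o1 o2 ?_ (by simpa using hr) (by simpa using hz)⟩
      simpa using mul_mem unif_mem hx
    · congr 1
      funext p
      rw [pl_inr_inl_eq, mul_smul]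
  · rintro _ ⟨p, rfl⟩
    simp only
    rw [pl_inr_inl_eq, mul_smul]
    exact step_of hb (isUp_ut _ _ _ _ _ _) (unip_mem_intGL (zero_mem _) (C_mem _) (zero_mem _))

/-- Each vertex has one successor and at most `q²` predecessors (`step_two_pred`) under `Step 2`. -/
theorem step_two {b : GL (Fin 3) k⸨X⸩} (hb : IsUp b) :
    {y | Step 2 (b • x₀ k) y} = Set.range fun _ : Unit => b • pl (k := k) (.inr (.inr ())) • x₀ k := by
  apply Set.Subset.antisymm
  · refine (step_succ_subset (u := fun _ : Unit => 1) hb ?_).trans (le_of_eq ?_)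
    · rintro κ hκ ⟨α, β, γ, x, y, z, rfl⟩
      obtain ⟨a0, a1, a2, o0, o1, o2, hx, hy, hz⟩ := ut_mem_intGL hκ
      refine ⟨(), ?_⟩
      rw [← ut_one]
      refine ut_dia_smul_eq o0 o1 o2 (by simpa using hx) ?_ ?_
      · simpa using mul_mem unif_mem hy
      · simpa using mul_mem unif_mem hz
    · congr 1
      funext p
      rw [pl_inr_inr_eq, one_smul]
  · rintro _ ⟨p, rfl⟩
    simp only
    rw [pl_inr_inr_eq]
    exact ⟨b, hb, rfl, rfl⟩

theorem step_zero_pred {b : GL (Fin 3) k⸨X⸩} (hb : IsUp b) :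
    {x | Step 0 x (b • x₀ k)} ⊆
      Set.range fun _ : Unit => b • (1 : GL (Fin 3) k⸨X⸩) • dia k (-Pi.single 0 1) • x₀ k := by
  refine step_pred_subset (u := fun _ : Unit => 1) hb ?_
  rintro κ hκ ⟨α, β, γ, x, y, z, rfl⟩
  obtain ⟨a0, a1, a2, o0, o1, o2, hx, hy, hz⟩ := ut_mem_intGL hκ
  refine ⟨(), ?_⟩
  rw [← ut_one]
  refine ut_dia_smul_eq o0 o1 o2 ?_ (by simpa using hy) ?_
  · simpa using mul_mem unif_mem hx
  · simpa using mul_mem unif_mem hz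

theorem step_one_pred {b : GL (Fin 3) k⸨X⸩} (hb : IsUp b) :
    {x | Step 1 x (b • x₀ k)} ⊆
      Set.range fun a : k => b • ut 1 1 1 (HahnSeries.C a) 0 0 • dia k (-Pi.single 1 1) • x₀ k := by
  refine step_pred_subset (u := fun a : k => ut 1 1 1 (HahnSeries.C a) 0 0) hb ?_
  rintro κ hκ ⟨α, β, γ, x, y, z, rfl⟩
  obtain ⟨a0, a1, a2, o0, o1, o2, hx, hy, hz⟩ := ut_mem_intGL hκ
  obtain ⟨p, hp⟩ := exists_C_mul_sub hx a1 β.ne_zero o1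
  refine ⟨p, ut_dia_smul_eq o0 o1 o2 (by simpa using hp) ?_ ?_⟩
  · simpa using mul_mem unif_mem hy
  · simpa using sub_mem hz (mul_mem (C_mem p) hy)

theorem step_two_pred {b : GL (Fin 3) k⸨X⸩} (hb : IsUp b) :
    {x | Step 2 x (b • x₀ k)} ⊆ Set.range fun p : k × k =>
      b • ut 1 1 1 0 (HahnSeries.C p.1) (HahnSeries.C p.2) • dia k (-Pi.single 2 1) • x₀ k := by
  refine step_pred_subset
    (u := fun p : k × k => ut 1 1 1 0 (HahnSeries.C p.1) (HahnSeries.C p.2)) hb ?_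
  rintro κ hκ ⟨α, β, γ, x, y, z, rfl⟩
  obtain ⟨a0, a1, a2, o0, o1, o2, hx, hy, hz⟩ := ut_mem_intGL hκ
  obtain ⟨r, hr⟩ := exists_C_mul_sub hy a2 γ.ne_zero o2
  obtain ⟨s, hs⟩ := exists_C_mul_sub hz a2 γ.ne_zero o2
  refine ⟨(r, s), ut_dia_smul_eq o0 o1 o2 (by simpa using hx) (by simpa using hr) ?_⟩
  simpa [sub_eq_add_neg] using hs

/-- The summation operator of the relation `Step τ`. -/
def stepOp (τ : Fin 3) (f : Vertex k → ℂ) (x : Vertex k) : ℂ := ∑ᶠ y ∈ {y | Step τ x y}, f y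

theorem stepOp_two (f : Vertex k → ℂ) {b : GL (Fin 3) k⸨X⸩} (hb : IsUp b) :
    stepOp 2 f (b • x₀ k) = f (b • pl (k := k) (.inr (.inr ())) • x₀ k) := by
  rw [stepOp, step_two hb, finsum_mem_range, finsum_eq_sum_of_fintype]
  · simp
  · exact (smul_pl_injective b).comp (Sum.inr_injective.comp Sum.inr_injective)

variable [Fintype k]

theorem stepOp_zero (f : Vertex k → ℂ) {b : GL (Fin 3) k⸨X⸩} (hb : IsUp b) :
    stepOp 0 f (b • x₀ k) = ∑ p : k × k, f (b • pl (.inl p) • x₀ k) := by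
  rw [stepOp, step_zero hb, finsum_mem_range, finsum_eq_sum_of_fintype]
  exact (smul_pl_injective b).comp Sum.inl_injective

theorem stepOp_one (f : Vertex k → ℂ) {b : GL (Fin 3) k⸨X⸩} (hb : IsUp b) :
    stepOp 1 f (b • x₀ k) = ∑ c : k, f (b • pl (.inr (.inl c)) • x₀ k) := by
  rw [stepOp, step_one hb, finsum_mem_range, finsum_eq_sum_of_fintype]
  exact (smul_pl_injective b).comp (Sum.inr_injective.comp Sum.inl_injective)

theorem ncard_range_le {ι α : Type*} [Fintype ι] (f : ι → α) :
    (Set.range f).ncard ≤ Fintype.card ι := by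
  rw [← Set.image_univ]
  refine (Set.ncard_image_le (Set.toFinite _)).trans ?_
  rw [Set.ncard_univ, Nat.card_eq_fintype_card]

theorem encard_le_of_subset_range {ι α : Type*} [Fintype ι] {f : ι → α} {s : Set α}
    (h : s ⊆ Set.range f) : s.encard ≤ (Fintype.card ι : ℕ) := by
  refine (Set.encard_le_encard h).trans ?_
  rw [← (Set.finite_range f).cast_ncard_eq]
  exact_mod_cast ncard_range_le f

theorem step_finite (τ : Fin 3) (x : Vertex k) : {y | Step τ x y}.Finite := by
  obtain ⟨b, hb, rfl⟩ := exists_isUp_smul_x₀ x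
  fin_cases τ
  · exact (step_zero hb) ▸ Set.finite_range _
  · exact (step_one hb) ▸ Set.finite_range _
  · exact (step_two hb) ▸ Set.finite_range _

/-- The horospherical operators are bounded by `q` on `L²`. -/
theorem wNorm_stepOp_le (τ : Fin 3) (f : Vertex k → ℂ) :
    wNorm (fun _ => 1) (stepOp τ f) ≤ (Fintype.card k : ℝ≥0∞) * wNorm (fun _ => 1) f := by
  have h0 : ∀ f : Vertex k → ℂ, ∑' v, ENNReal.ofReal 1 * ‖f v‖ₑ ^ 2 = ∑' v, ‖f v‖ₑ ^ 2 := by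
    simp
  rw [wNorm_le_iff_sq, mul_pow, wNorm_sq, h0, h0]
  have key : ∀ d e : ℕ, d * e = Fintype.card k ^ 2 →
      (∀ x : Vertex k, {y | Step τ x y}.ncard ≤ d) →
      (∀ y : Vertex k, {x | Step τ x y}.encard ≤ e) →
      ∑' v, ‖stepOp τ f v‖ₑ ^ 2 ≤ (Fintype.card k : ℝ≥0∞) ^ 2 * ∑' v, ‖f v‖ₑ ^ 2 := by
    intro d e hde h2 h3
    refine (tsum_enorm_sum_sq_le (step_finite τ) h2 h3 f).trans ?_
    rw [hde]; push_cast; rfl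
  have hk2 : Fintype.card (k × k) = Fintype.card k ^ 2 := by rw [Fintype.card_prod, sq]
  fin_cases τ
  · refine key (Fintype.card (k × k)) (Fintype.card Unit) (by simp [hk2]) ?_ ?_
    all_goals
      intro x
      obtain ⟨b, hb, rfl⟩ := exists_isUp_smul_x₀ x
    · exact (step_zero hb) ▸ ncard_range_le _
    · exact encard_le_of_subset_range (step_zero_pred hb)
  · refine key (Fintype.card k) (Fintype.card k) (sq _).symm ?_ ?_
    all_goals
      intro x
      obtain ⟨b, hb, rfl⟩ := exists_isUp_smul_x₀ x
    · exact (step_one hb) ▸ ncard_range_le _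
    · exact encard_le_of_subset_range (step_one_pred hb)
  · refine key (Fintype.card Unit) (Fintype.card (k × k)) (by simp [hk2]) ?_ ?_
    all_goals
      intro x
      obtain ⟨b, hb, rfl⟩ := exists_isUp_smul_x₀ x
    · exact (step_two hb) ▸ ncard_range_le _
    · exact encard_le_of_subset_range (step_two_pred hb)

end Borel

section Factor
variable {k : Type*} [Field k]

/-! ### The Hecke polynomial and the bound on the spectrum of the building -/

theorem pl_pl_zero_one (a b c : k) :
    pl (.inl (a, b)) • pl (.inr (.inl c)) • x₀ k = ln (.inl (a * c - b, -c)) • x₀ k := by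
  rw [smul_smul, smul_x₀_eq_iff]
  refine ⟨0, _, unip_mem_intGL (C_mem (-a)) (zero_mem _) (zero_mem _), ?_⟩
  rw [scal_zero, mul_one, pl, pl, ln, ut_mul, ut_mul]
  congr 1 <;> simp [-HahnSeries.C_apply] <;> ring

theorem pl_pl_zero_two (a b : k) :
    pl (.inl (a, b)) • pl (k := k) (.inr (.inr ())) • x₀ k = ln (.inr (.inl (-a))) • x₀ k := by
  rw [smul_smul, smul_x₀_eq_iff]
  refine ⟨0, _, unip_mem_intGL (zero_mem _) (zero_mem _) (C_mem (-b)), ?_⟩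
  rw [scal_zero, mul_one, pl, pl, ln, ut_mul, ut_mul]
  congr 1 <;> simp [-HahnSeries.C_apply] <;> ring

theorem pl_pl_one_two (c : k) :
    pl (.inr (.inl c)) • pl (k := k) (.inr (.inr ())) • x₀ k = ln (k := k) (.inr (.inr ())) • x₀ k := by
  rw [smul_smul, smul_x₀_eq_iff]
  refine ⟨0, _, unip_mem_intGL (zero_mem _) (C_mem (-c)) (zero_mem _), ?_⟩
  rw [scal_zero, mul_one, pl, pl, ln, ut_mul, ut_mul]
  congr 1 <;> simp [-HahnSeries.C_apply] <;> ring

theorem ln_pl_two (b c : k) :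
    ln (.inl (b, c)) • pl (k := k) (.inr (.inr ())) • x₀ k = x₀ k := by
  rw [smul_smul, ← one_smul (GL (Fin 3) k⸨X⸩) (x₀ k), smul_smul, mul_one, smul_x₀_eq_iff]
  refine ⟨1, _, unip_mem_intGL (zero_mem _) (C_mem c) (C_mem b), ?_⟩
  rw [one_mul, scal_eq_ut, pl, ln, ut_mul, ut_mul]
  congr 1 <;> simp [-HahnSeries.C_apply] <;> ring

theorem stepOp_sub [Fintype k] (τ : Fin 3) (f g : Vertex k → ℂ) :
    stepOp τ (f - g) = stepOp τ f - stepOp τ g := by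
  funext x
  simp only [stepOp, Pi.sub_apply, finsum_mem_eq_finite_toFinset_sum _ (step_finite τ x),
    Finset.sum_sub_distrib]

theorem stepOp_smul [Fintype k] (τ : Fin 3) (c : ℂ) (f : Vertex k → ℂ) :
    stepOp τ (c • f) = c • stepOp τ f := by
  funext x
  simp only [stepOp, Pi.smul_apply, finsum_mem_eq_finite_toFinset_sum _ (step_finite τ x),
    Finset.smul_sum]

variable [Fintype k]

/-- The planes of `k³` fall into three classes according to their position relative to the standard
flag, which are the three kinds of steps. -/
theorem coloredAdj_one_eq (f : Vertex k → ℂ) :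
    coloredAdj 1 f = stepOp 0 f + stepOp 1 f + stepOp 2 f := by
  funext x
  obtain ⟨b, hb, rfl⟩ := exists_isUp_smul_x₀ x
  rw [Pi.add_apply, Pi.add_apply, stepOp_zero f hb, stepOp_one f hb, stepOp_two f hb,
    coloredAdj_one, Fintype.sum_sum_type, Fintype.sum_sum_type]
  simp [add_assoc]

theorem stepOp_zero_one (f : Vertex k → ℂ) {b : GL (Fin 3) k⸨X⸩} (hb : IsUp b) :
    stepOp 0 (stepOp 1 f) (b • x₀ k) =
      Fintype.card k * ∑ p : k × k, f (b • ln (.inl p) • x₀ k) := by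
  rw [stepOp_zero _ hb]
  have h : ∀ p : k × k, stepOp 1 f (b • pl (.inl p) • x₀ k) =
      ∑ c, f (b • ln (.inl (p.1 * c - p.2, -c)) • x₀ k) := by
    rintro ⟨a, d⟩
    rw [smul_smul, stepOp_one _ (hb.mul (isUp_pl _))]
    simp only [mul_smul, pl_pl_zero_one]
  simp only [h]
  rw [Fintype.sum_prod_type]
  have h2 : ∀ a : k, ∑ d, ∑ c, f (b • ln (.inl (a * c - d, -c)) • x₀ k) =
      ∑ p : k × k, f (b • ln (.inl p) • x₀ k) := by
    intro a
    rw [Fintype.sum_prod_type_right]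
    rw [Finset.sum_comm]
    refine Fintype.sum_equiv (Equiv.neg k) _ _ fun c => ?_
    exact Fintype.sum_equiv (Equiv.subLeft (a * c)) _ _ fun d => rfl
  simp only [h2, Finset.sum_const, nsmul_eq_mul, Finset.card_univ]

theorem stepOp_zero_two (f : Vertex k → ℂ) {b : GL (Fin 3) k⸨X⸩} (hb : IsUp b) :
    stepOp 0 (stepOp 2 f) (b • x₀ k) =
      Fintype.card k * ∑ a : k, f (b • ln (.inr (.inl a)) • x₀ k) := by
  rw [stepOp_zero _ hb]
  have h : ∀ p : k × k, stepOp 2 f (b • pl (.inl p) • x₀ k) =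
      f (b • ln (.inr (.inl (-p.1))) • x₀ k) := by
    rintro ⟨a, d⟩
    rw [smul_smul, stepOp_two _ (hb.mul (isUp_pl _)), mul_smul, pl_pl_zero_two]
  simp only [h]
  rw [Fintype.sum_prod_type]
  simp only [Finset.sum_const, nsmul_eq_mul, Finset.card_univ]
  rw [← Finset.mul_sum]
  congr 1
  exact Fintype.sum_equiv (Equiv.neg k) _ _ fun c => rfl

theorem stepOp_one_two (f : Vertex k → ℂ) {b : GL (Fin 3) k⸨X⸩} (hb : IsUp b) :
    stepOp 1 (stepOp 2 f) (b • x₀ k) =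
      Fintype.card k * f (b • ln (k := k) (.inr (.inr ())) • x₀ k) := by
  rw [stepOp_one _ hb]
  have h : ∀ c : k, stepOp 2 f (b • pl (.inr (.inl c)) • x₀ k) =
      f (b • ln (k := k) (.inr (.inr ())) • x₀ k) := by
    intro c
    rw [smul_smul, stepOp_two _ (hb.mul (isUp_pl _)), mul_smul, pl_pl_one_two]
  simp only [h, Finset.sum_const, nsmul_eq_mul, Finset.card_univ]

/-- Two steps, taken in this order, lead to each neighbor given by a line in `q` ways. -/
theorem card_smul_coloredAdj_two (f : Vertex k → ℂ) :
    (Fintype.card k : ℂ) • coloredAdj 2 f =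
      stepOp 0 (stepOp 1 f) + stepOp 0 (stepOp 2 f) + stepOp 1 (stepOp 2 f) := by
  funext x
  obtain ⟨b, hb, rfl⟩ := exists_isUp_smul_x₀ x
  rw [Pi.add_apply, Pi.add_apply, stepOp_zero_one f hb, stepOp_zero_two f hb, stepOp_one_two f hb,
    Pi.smul_apply, coloredAdj_two, Fintype.sum_sum_type, Fintype.sum_sum_type, smul_eq_mul]
  simp
  ring

/-- The three steps together shrink the lattice by the factor `t⁻¹`, so that they lead back to the
same vertex, in `q³` ways. -/
theorem stepOp_zero_one_two (f : Vertex k → ℂ) :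
    stepOp 0 (stepOp 1 (stepOp 2 f)) = ((Fintype.card k : ℂ) ^ 3) • f := by
  funext x
  obtain ⟨b, hb, rfl⟩ := exists_isUp_smul_x₀ x
  rw [stepOp_zero_one _ hb]
  have h : ∀ p : k × k, stepOp 2 f (b • ln (.inl p) • x₀ k) = f (b • x₀ k) := by
    rintro ⟨a, d⟩
    rw [smul_smul, stepOp_two _ (hb.mul (isUp_ln _)), mul_smul, ln_pl_two]
  simp only [h, Finset.sum_const, nsmul_eq_mul, Finset.card_univ, Fintype.card_prod,
    Pi.smul_apply, smul_eq_mul]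
  push_cast
  ring

/-- The Hecke polynomial `1 - A₁ T + q A₂ T² - q³ T³` is the product of the three linear factors
`1 - S_τ T`. -/
theorem hecke_factorization (T : ℂ) (f : Vertex k → ℂ) {g h e : Vertex k → ℂ}
    (hg : g = f - T • stepOp 2 f) (hh : h = g - T • stepOp 1 g) (he : e = h - T • stepOp 0 h) :
    e = f - T • coloredAdj 1 f + (Fintype.card k * T ^ 2) • coloredAdj 2 f -
      (Fintype.card k * T) ^ 3 • f := by
  have h1 : (Fintype.card k * T ^ 2) • coloredAdj 2 f =
      T ^ 2 • (Fintype.card k : ℂ) • coloredAdj 2 f := by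
    rw [smul_smul, mul_comm]
  have h2 : ((Fintype.card k : ℂ) * T) ^ 3 • f = T ^ 3 • ((Fintype.card k : ℂ) ^ 3) • f := by
    rw [smul_smul]; ring_nf
  rw [h1, h2, ← stepOp_zero_one_two, card_smul_coloredAdj_two, coloredAdj_one_eq, he, hh, hg]
  simp only [stepOp_sub, stepOp_smul]
  module

/-- Since `S_τ` has norm at most `q`, the operator `1 - S_τ T` is bounded below for `|T| < 1 / q`.
-/
theorem wNorm_le_of_stepOp {τ : Fin 3} {T : ℂ} (hT : Fintype.card k * ‖T‖ < 1)
    {f g : Vertex k → ℂ} (hg : g = f - T • stepOp τ f) (hf : wNorm (fun _ => 1) f ≠ ⊤) :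
    wNorm (fun _ => 1) g ≠ ⊤ ∧ wNorm (fun _ => 1) f ≤
      ENNReal.ofReal (1 - Fintype.card k * ‖T‖)⁻¹ * wNorm (fun _ => 1) g := by
  set q : ℝ := Fintype.card k * ‖T‖ with hq
  have h1 : wNorm (fun _ => 1) (T • stepOp τ f) ≤ ENNReal.ofReal q * wNorm (fun _ => 1) f := by
    rw [wNorm_smul, hq, ENNReal.ofReal_mul (Nat.cast_nonneg _), ENNReal.ofReal_natCast,
      ofReal_norm, mul_comm (Fintype.card k : ℝ≥0∞), mul_assoc]
    gcongr
    exact wNorm_stepOp_le τ f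
  have hfin : wNorm (fun _ => 1) g ≠ ⊤ := by
    rw [hg]
    refine ne_top_of_le_ne_top ?_ ((wNorm_sub_le _ _ _).trans (add_le_add le_rfl h1))
    exact ENNReal.add_ne_top.2 ⟨hf, ENNReal.mul_ne_top ENNReal.ofReal_ne_top hf⟩
  refine ⟨hfin, ?_⟩
  have h2 : wNorm (fun _ => 1) f ≤ wNorm (fun _ => 1) g + ENNReal.ofReal q * wNorm (fun _ => 1) f := by
    have : f = g + T • stepOp τ f := by rw [hg]; module
    calc wNorm (fun _ => 1) f = wNorm (fun _ => 1) (g + T • stepOp τ f) := by rw [← this]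
      _ ≤ _ := (wNorm_add_le _ _ _).trans (add_le_add le_rfl h1)
  have hq0 : 0 ≤ q := by positivity
  obtain ⟨a, ha, ha'⟩ : ∃ a : ℝ, 0 ≤ a ∧ wNorm (fun _ => 1) f = ENNReal.ofReal a :=
    ⟨_, ENNReal.toReal_nonneg, (ENNReal.ofReal_toReal hf).symm⟩
  obtain ⟨c, hc, hc'⟩ : ∃ a : ℝ, 0 ≤ a ∧ wNorm (fun _ => 1) g = ENNReal.ofReal a :=
    ⟨_, ENNReal.toReal_nonneg, (ENNReal.ofReal_toReal hfin).symm⟩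
  have hpos : 0 < 1 - q := by linarith
  rw [ha', hc', ← ENNReal.ofReal_mul hq0, ← ENNReal.ofReal_add hc (by positivity),
    ENNReal.ofReal_le_ofReal_iff (by positivity)] at h2
  rw [ha', hc', ← ENNReal.ofReal_mul (by positivity)]
  apply ENNReal.ofReal_le_ofReal
  rw [inv_mul_eq_div, le_div_iff₀ hpos]
  linarith

/-- For `(l₁, l₂)` in the spectrum, the Hecke polynomial has no zero in the disc `|T| < 1 / q`. -/
theorem hecke_poly_ne_zero {p : ℂ × ℂ} (hp : p ∈ buildingSpectrum k) {T : ℂ}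
    (hT : Fintype.card k * ‖T‖ < 1) :
    1 - p.1 * T + Fintype.card k * p.2 * T ^ 2 - (Fintype.card k * T) ^ 3 ≠ 0 := by
  intro h0
  obtain ⟨f, hf, h1, h2⟩ := hp
  -- at a zero of the polynomial, the product of the bounded below operators `1 - S_τ T` sends `f n`
  -- to a combination of the two errors, which tend to zero
  obtain ⟨C, hC, hle⟩ : ∃ C : ℝ≥0∞, C ≠ ⊤ ∧ ∀ n, wNorm (fun _ => 1) (f n) ≤
      C * (‖T‖ₑ * wNorm (fun _ => 1) (coloredAdj 1 (f n) - p.1 • f n) +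
        ‖(Fintype.card k * T ^ 2 : ℂ)‖ₑ * wNorm (fun _ => 1) (coloredAdj 2 (f n) - p.2 • f n)) := by
    set c := ENNReal.ofReal (1 - Fintype.card k * ‖T‖)⁻¹
    refine ⟨c * (c * c), by finiteness, fun n => ?_⟩
    obtain ⟨g1, g2⟩ := wNorm_le_of_stepOp (τ := 2) hT (f := f n) rfl (by rw [hf n]; simp)
    obtain ⟨g3, g4⟩ := wNorm_le_of_stepOp (τ := 1) hT rfl g1
    obtain ⟨g5, g6⟩ := wNorm_le_of_stepOp (τ := 0) hT rfl g3
    rw [hecke_factorization T (f n) rfl rfl rfl] at g6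
    have e : f n - T • coloredAdj 1 (f n) + (Fintype.card k * T ^ 2) • coloredAdj 2 (f n) -
        (Fintype.card k * T) ^ 3 • f n =
        (Fintype.card k * T ^ 2 : ℂ) • (coloredAdj 2 (f n) - p.2 • f n) -
          T • (coloredAdj 1 (f n) - p.1 • f n) +
        (1 - p.1 * T + Fintype.card k * p.2 * T ^ 2 - (Fintype.card k * T) ^ 3) • f n := by
      module
    rw [e, h0, zero_smul, add_zero] at g6
    have g7 := g6.trans (mul_le_mul_right (wNorm_sub_le _ _ _) c)
    rw [wNorm_smul, wNorm_smul, add_comm] at g7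
    exact g2.trans ((mul_le_mul_right (g4.trans (mul_le_mul_right g7 c)) c).trans
      (le_of_eq (by ring)))
  have hlim : Filter.Tendsto (fun n => C * (‖T‖ₑ *
      wNorm (fun _ => 1) (coloredAdj 1 (f n) - p.1 • f n) + ‖(Fintype.card k * T ^ 2 : ℂ)‖ₑ *
        wNorm (fun _ => 1) (coloredAdj 2 (f n) - p.2 • f n))) Filter.atTop (nhds 0) := by
    have := ENNReal.Tendsto.const_mul (a := C) ((ENNReal.Tendsto.const_mul (a := ‖T‖ₑ) h1
      (Or.inr enorm_ne_top)).add (ENNReal.Tendsto.const_mul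
        (a := ‖(Fintype.card k * T ^ 2 : ℂ)‖ₑ) h2 (Or.inr enorm_ne_top))) (Or.inr hC)
    simpa using this
  have h3 := ge_of_tendsto' hlim (b := 1) fun n => by rw [← hf n]; exact hle n
  simp at h3

/-- A monic cubic polynomial over `ℂ` splits. -/
theorem exists_cubic_roots (a b c : ℂ) :
    ∃ s₁ s₂ s₃ : ℂ, a = s₁ + s₂ + s₃ ∧ b = s₁ * s₂ + s₁ * s₃ + s₂ * s₃ ∧ c = s₁ * s₂ * s₃ := by
  obtain ⟨s, hs⟩ : ∃ s : ℂ, s ^ 3 - a * s ^ 2 + b * s - c = 0 := by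
    have hd : (Polynomial.X ^ 3 - Polynomial.C a * Polynomial.X ^ 2 + Polynomial.C b * Polynomial.X -
        Polynomial.C c : ℂ[X]).degree = 3 := by compute_degree!
    obtain ⟨s, hs⟩ := IsAlgClosed.exists_root _ (by rw [hd]; norm_num)
    exact ⟨s, by simpa [Polynomial.IsRoot] using hs⟩
  -- the other two roots come from the quadratic formula, with `d²` the discriminant
  obtain ⟨d, hd⟩ := IsAlgClosed.exists_pow_nat_eq ((a - s) ^ 2 - 4 * (b - s * (a - s))) two_pos
  refine ⟨s, (a - s + d) / 2, (a - s - d) / 2, by ring, ?_, ?_⟩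
  · linear_combination hd / 4
  · linear_combination s * hd / 4 - hs

/-- The inverse roots of the Hecke polynomial, divided by `q`, have absolute value at most `1` and
product `1`, hence lie on the unit circle. -/
theorem mem_Sigma2_of_mem_buildingSpectrum {p : ℂ × ℂ} (hp : p ∈ buildingSpectrum k) :
    p.1 ∈ Sigma2 (Fintype.card k) ∧ p.2 = star p.1 := by
  set q : ℂ := ((Fintype.card k : ℕ) : ℂ) with hq
  have hq0 : q ≠ 0 := by simp [hq]
  obtain ⟨s₁, s₂, s₃, ha, hb, hc⟩ := exists_cubic_roots (p.1 / q) (p.2 / q) 1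
  have hne : s₁ ≠ 0 ∧ s₂ ≠ 0 ∧ s₃ ≠ 0 := by
    refine ⟨?_, ?_, ?_⟩ <;> rintro rfl <;> simp at hc
  -- a root `s` of the cubic gives the zero `1 / (q s)` of the Hecke polynomial
  have key : ∀ s : ℂ, s ≠ 0 → (s - s₁) * (s - s₂) * (s - s₃) = 0 → ‖s‖ ≤ 1 := by
    intro s hs h0
    by_contra hlt
    rw [not_le] at hlt
    have hT : (Fintype.card k : ℝ) * ‖1 / (q * s)‖ < 1 := by
      have hk : (0 : ℝ) < Fintype.card k := by exact_mod_cast Fintype.card_pos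
      rw [norm_div, norm_mul, hq, Complex.norm_natCast, norm_one]
      rw [one_div, mul_inv, mul_inv_cancel_left₀ hk.ne']
      exact inv_lt_one_of_one_lt₀ hlt
    refine hecke_poly_ne_zero hp hT ?_
    have h1 : p.1 = q * (s₁ + s₂ + s₃) := by rw [← ha]; field_simp
    have h2 : p.2 = q * (s₁ * s₂ + s₁ * s₃ + s₂ * s₃) := by rw [← hb]; field_simp
    rw [h1, h2, ← hq]
    field_simp
    linear_combination h0 - hc
  have n1 := key s₁ hne.1 (by ring)
  have n2 := key s₂ hne.2.1 (by ring)
  have n3 := key s₃ hne.2.2 (by ring)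
  have hn : ‖s₁‖ * ‖s₂‖ * ‖s₃‖ = 1 := by rw [← norm_mul, ← norm_mul, ← hc, norm_one]
  have p1 := norm_pos_iff.2 hne.1
  have p2 := norm_pos_iff.2 hne.2.1
  have p3 := norm_pos_iff.2 hne.2.2
  have m1 : ‖s₁‖ = 1 := by
    have : ‖s₂‖ * ‖s₃‖ ≤ 1 := mul_le_one₀ n2 p3.le n3
    nlinarith
  have m2 : ‖s₂‖ = 1 := by
    rw [m1, one_mul] at hn; nlinarith
  have m3 : ‖s₃‖ = 1 := by
    rw [m1, m2] at hn; linarith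
  have h1 : p.1 = q * (s₁ + s₂ + s₃) := by rw [← ha]; field_simp
  have h2 : p.2 = q * (s₁ * s₂ + s₁ * s₃ + s₂ * s₃) := by rw [← hb]; field_simp
  refine ⟨⟨s₁, s₂, s₃, m1, m2, m3, hc.symm, h1⟩, ?_⟩
  rw [h1, h2, star_mul', star_add, star_add, star_eq_inv m1, star_eq_inv m2, star_eq_inv m3, hq,
    star_natCast]
  obtain ⟨z1, z2, z3⟩ := hne
  field_simp
  linear_combination (-(s₁ * s₂ + s₁ * s₃ + s₂ * s₃)) * hc

end Factor

section Orbits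
variable {k : Type*} [Field k]

/-! ### Orbits of the integral unipotent group -/

theorem ut_inj {α β γ : (k⸨X⸩)ˣ} {x y z : k⸨X⸩} {α' β' γ' : (k⸨X⸩)ˣ} {x' y' z' : k⸨X⸩}
    (h : ut α β γ x y z = ut α' β' γ' x' y' z') :
    α = α' ∧ β = β' ∧ γ = γ' ∧ x = x' ∧ y = y' ∧ z = z' := by
  have h' : ∀ i j, (ut α β γ x y z).1 i j = (ut α' β' γ' x' y' z').1 i j := fun i j => by rw [h]
  exact ⟨Units.ext (h' 0 0), Units.ext (h' 1 1), Units.ext (h' 2 2), h' 0 1, h' 1 2, h' 0 2⟩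

variable (k) in
/-- The orbit, under the unipotent upper triangular matrices over the valuation ring, of the
vertex of `diag(t^-(α+β), t^-β, 1)`. -/
def orb (p : ℤ × ℤ) : Set (Vertex k) :=
  {x | ∃ a ∈ valInt k, ∃ b ∈ valInt k, ∃ c ∈ valInt k,
    x = ut 1 1 1 a b c • dia k ![p.1 + p.2, p.2, 0] • x₀ k}

theorem mem_orb_of_dia {a b c : k⸨X⸩} (ha : a ∈ valInt k) (hb : b ∈ valInt k) (hc : c ∈ valInt k)
    (e : Fin 3 → ℤ) : ut 1 1 1 a b c • dia k e • x₀ k ∈ orb k (e 0 - e 1, e 1 - e 2) := by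
  refine ⟨a, ha, b, hb, c, hc, ?_⟩
  have : e = ![e 0 - e 1 + (e 1 - e 2), e 1 - e 2, 0] + fun _ => e 2 := by
    ext i; fin_cases i <;> simp
  conv_lhs => rw [this, dia_add, dia_const, mul_smul, scal_smul_vertex]

theorem orb_disjoint {p p' : ℤ × ℤ} {x : Vertex k} (h : x ∈ orb k p) (h' : x ∈ orb k p') :
    p = p' := by
  obtain ⟨a, ha, b, hb, c, hc, rfl⟩ := h
  obtain ⟨a', ha', b', hb', c', hc', h⟩ := h'
  rw [smul_smul, smul_smul] at h
  obtain ⟨n, κ, hκ, ⟨α, β, γ, x, y, z, rfl⟩, h2⟩ := ((isUp_ut _ _ _ _ _ _).mul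
    (isUp_dia _)).exists_of_smul_x₀_eq ((isUp_ut _ _ _ _ _ _).mul (isUp_dia _)) h
  obtain ⟨_, _, _, o0, o1, o2, _⟩ := ut_mem_intGL hκ
  rw [dia_eq_ut, dia_eq_ut, ut_mul, scal_eq_ut, ut_mul, ut_mul, ut_mul] at h2
  obtain ⟨h3, h4, h5, -⟩ := ut_inj h2
  have ho : ∀ (a b n : ℤ) (u : (k⸨X⸩)ˣ), (u : k⸨X⸩).order = 0 →
      1 * unif k ^ a = 1 * unif k ^ b * unif k ^ n * u → a = b + n := by
    intro a b n u hu h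
    have := congrArg (fun u : (k⸨X⸩)ˣ => (u : k⸨X⸩).order) h
    simp only [one_mul] at this
    rw [← zpow_add, Units.val_mul, HahnSeries.order_mul (Units.ne_zero _) (Units.ne_zero _),
      order_unif_zpow, order_unif_zpow, hu] at this
    omega
  have e0 := ho _ _ _ _ o0 h3
  have e1 := ho _ _ _ _ o1 h4
  have e2 := ho _ _ _ _ o2 h5
  ext <;> omega

/-- The polynomial of degree less than `n` in `t⁻¹` with given coefficients. -/
def trunc (n : ℕ) (c : Fin n → k) : k⸨X⸩ :=
  algebraMap k⟦X⟧ k⸨X⸩ (PowerSeries.mk fun i => if h : i < n then c ⟨i, h⟩ else 0)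

theorem trunc_mem (n : ℕ) (c : Fin n → k) : trunc n c ∈ valInt k := ⟨_, rfl⟩

theorem trunc_coeff (n : ℕ) (c : Fin n → k) (i : Fin n) : (trunc n c).coeff (i : ℕ) = c i := by
  rw [trunc, LaurentSeries.coe_algebraMap, PowerSeries.coeff_coe]
  simp

theorem trunc_injective {n : ℕ} {c c' : Fin n → k}
    (h : ((unif k ^ (-(n : ℤ)) : (k⸨X⸩)ˣ) : k⸨X⸩) * (trunc n c - trunc n c') ∈ valInt k) :
    c = c' := by
  rw [unif_zpow_mul_mem_iff] at h
  funext i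
  have := h (i : ℕ) (by have := i.2; omega)
  rwa [HahnSeries.coeff_sub, trunc_coeff, trunc_coeff, sub_eq_zero] at this

theorem exists_trunc (n : ℕ) {a : k⸨X⸩} (ha : a ∈ valInt k) :
    ∃ c, ((unif k ^ (-(n : ℤ)) : (k⸨X⸩)ˣ) : k⸨X⸩) * (a - trunc n c) ∈ valInt k := by
  refine ⟨fun i => a.coeff (i : ℕ), ?_⟩
  rw [unif_zpow_mul_mem_iff]
  intro m hm
  rw [HahnSeries.coeff_sub]
  rcases lt_or_ge m 0 with h | h
  · rw [mem_valInt_iff.1 ha m h, mem_valInt_iff.1 (trunc_mem _ _) m h, sub_zero]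
  · lift m to ℕ using h
    have := trunc_coeff n (fun i => a.coeff (i : ℕ)) ⟨m, by omega⟩
    simp only at this
    rw [this, sub_self]

/-- When two unipotent matrices give the same vertex in an orbit, their entries agree to the order
prescribed by the diagonal. -/
theorem unip_dia_eq {a b c a' b' c' : k⸨X⸩} {e : Fin 3 → ℤ}
    (h : ut 1 1 1 a b c • dia k e • x₀ k = ut 1 1 1 a' b' c' • dia k e • x₀ k) :
    ((unif k ^ (e 1 - e 0) : (k⸨X⸩)ˣ) : k⸨X⸩) * (a - a') ∈ valInt k ∧
    ((unif k ^ (e 2 - e 1) : (k⸨X⸩)ˣ) : k⸨X⸩) * (b - b') ∈ valInt k ∧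
    ((unif k ^ (e 2 - e 0) : (k⸨X⸩)ˣ) : k⸨X⸩) * (c - a' * b + (a' * b' - c')) ∈ valInt k := by
  rw [smul_smul, smul_smul, smul_x₀_eq_iff_of_vdet (by simp [vdet_ut]), smul_stdL_eq_smul_iff] at h
  have h2 : (ut 1 1 1 a' b' c' * dia k e)⁻¹ * (ut 1 1 1 a b c * dia k e) =
      ut 1 1 1 (((unif k ^ (e 1 - e 0) : (k⸨X⸩)ˣ) : k⸨X⸩) * (a - a'))
        (((unif k ^ (e 2 - e 1) : (k⸨X⸩)ˣ) : k⸨X⸩) * (b - b'))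
        (((unif k ^ (e 2 - e 0) : (k⸨X⸩)ˣ) : k⸨X⸩) * (c - a' * b + (a' * b' - c'))) := by
    rw [inv_mul_eq_iff_eq_mul, dia_eq_ut', ut_mul, ut_mul, ut_mul]
    have hu : ∀ a b : ℤ, ((unif k ^ (a - b) : (k⸨X⸩)ˣ) : k⸨X⸩) =
        (unif k ^ a : (k⸨X⸩)ˣ) * ((unif k ^ b : (k⸨X⸩)ˣ) : k⸨X⸩)⁻¹ := by
      intro a b
      rw [zpow_sub, Units.val_mul, Units.val_inv_eq_inv_val]
    have hn : ∀ a : ℤ, ((unif k ^ a : (k⸨X⸩)ˣ) : k⸨X⸩) ≠ 0 := fun a => Units.ne_zero _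
    have := hn (e 0)
    have := hn (e 1)
    have := hn (e 2)
    simp only [hu, Units.val_one, Units.val_mul]
    congr 1
    · rw [mul_one]
    · rw [mul_one]
    · rw [mul_one]
    · field_simp; ring
    · field_simp; ring
    · field_simp; ring
  rw [h2] at h
  exact (ut_mem_intGL h).2.2.2.2.2.2

/-- The orbit is parametrized by the unipotent matrices with entries modulo `t^-m`, `t^-n` and
`t^-(m + n)`. -/
theorem encard_orb [Fintype k] (m n : ℕ) :
    (orb k (m, n)).encard = (Fintype.card k ^ (2 * (m + n)) : ℕ) := by
  let φ : (Fin m → k) × (Fin n → k) × (Fin (m + n) → k) → Vertex k := fun c =>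
    ut 1 1 1 (trunc m c.1) (trunc n c.2.1) (trunc (m + n) c.2.2) •
      dia k ![(m : ℤ) + n, n, 0] • x₀ k
  have hinj : Function.Injective φ := by
    rintro ⟨c₁, c₂, c₃⟩ ⟨c₁', c₂', c₃'⟩ h
    obtain ⟨h1, h2, h3⟩ := unip_dia_eq h
    have e1 : c₁ = c₁' := trunc_injective (by simpa using h1)
    have e2 : c₂ = c₂' := trunc_injective (by simpa using h2)
    subst e1 e2
    have e3 : c₃ = c₃' := trunc_injective (by
      rw [sub_add_sub_cancel] at h3
      simpa [add_comm] using h3)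
    rw [e3]
  have hrange : orb k (m, n) = Set.range φ := by
    apply Set.Subset.antisymm
    · rintro x ⟨a, ha, b, hb, c, hc, rfl⟩
      obtain ⟨c₁, h₁⟩ := exists_trunc m ha
      obtain ⟨c₂, h₂⟩ := exists_trunc n hb
      obtain ⟨c₃, h₃⟩ := exists_trunc (m + n)
        (a := c - trunc m c₁ * b + trunc m c₁ * trunc n c₂)
        (add_mem (sub_mem hc (mul_mem (trunc_mem _ _) hb)) (mul_mem (trunc_mem _ _) (trunc_mem _ _)))
      refine ⟨(c₁, c₂, c₃), (ut_dia_smul_eq (by simp) (by simp) (by simp) ?_ ?_ ?_).symm⟩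
      · simpa using h₁
      · simpa using h₂
      · rw [add_sub_assoc] at h₃
        simpa [add_comm] using h₃
    · rintro _ ⟨c, rfl⟩
      exact ⟨_, trunc_mem _ _, _, trunc_mem _ _, _, trunc_mem _ _, rfl⟩
  rw [hrange, ← Set.image_univ, hinj.encard_image, Set.encard_univ, ENat.card_eq_coe_fintype_card]
  congr 1
  simp only [Fintype.card_prod, Fintype.card_fun, Fintype.card_fin]
  ring

theorem dia_mul_unip (e : Fin 3 → ℤ) (a b c : k⸨X⸩) : dia k e * ut 1 1 1 a b c =
    ut 1 1 1 (((unif k ^ (e 0 - e 1) : (k⸨X⸩)ˣ) : k⸨X⸩) * a)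
      (((unif k ^ (e 1 - e 2) : (k⸨X⸩)ˣ) : k⸨X⸩) * b)
      (((unif k ^ (e 0 - e 2) : (k⸨X⸩)ˣ) : k⸨X⸩) * c) * dia k e := by
  rw [dia_eq_ut', ut_mul, ut_mul]
  have hu : ∀ a b : ℤ, ((unif k ^ (a - b) : (k⸨X⸩)ˣ) : k⸨X⸩) =
      (unif k ^ a : (k⸨X⸩)ˣ) * ((unif k ^ b : (k⸨X⸩)ˣ) : k⸨X⸩)⁻¹ := by
    intro a b
    rw [zpow_sub, Units.val_mul, Units.val_inv_eq_inv_val]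
  have hn : ∀ a : ℤ, ((unif k ^ a : (k⸨X⸩)ˣ) : k⸨X⸩) ≠ 0 := fun a => Units.ne_zero _
  have := hn (e 0)
  have := hn (e 1)
  have := hn (e 2)
  simp only [hu]
  congr 1
  · rw [mul_comm]
  · rw [mul_comm]
  · rw [mul_comm]
  · field_simp; simp
  · field_simp; simp
  · field_simp; simp

/-- Conjugation by a dominant diagonal matrix preserves the integral unipotent matrices, so the
parameters of the orbits add up. -/
theorem unip_dia_step {a b c a' b' c' : k⸨X⸩} (ha : a ∈ valInt k) (hb : b ∈ valInt k)
    (hc : c ∈ valInt k) (ha' : a' ∈ valInt k) (hb' : b' ∈ valInt k) (hc' : c' ∈ valInt k)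
    {e : Fin 3 → ℤ} (h1 : 0 ≤ e 0 - e 1) (h2 : 0 ≤ e 1 - e 2) (d : Fin 3 → ℤ) :
    ut 1 1 1 a b c • dia k e • ut 1 1 1 a' b' c' • dia k d • x₀ k ∈
      orb k (e 0 + d 0 - (e 1 + d 1), e 1 + d 1 - (e 2 + d 2)) := by
  rw [smul_smul (dia k e), dia_mul_unip, mul_smul, smul_smul (ut 1 1 1 a b c), ut_mul,
    smul_smul (dia k e), ← dia_add]
  simp only [Units.val_one, one_mul, mul_one]
  have h3 : 0 ≤ e 0 - e 2 := by omega
  exact mem_orb_of_dia (add_mem (mul_mem (unif_zpow_mem h1) ha') ha)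
    (add_mem (mul_mem (unif_zpow_mem h2) hb') hb)
    (add_mem (add_mem (mul_mem (unif_zpow_mem h3) hc')
      (mul_mem ha (mul_mem (unif_zpow_mem h2) hb'))) hc) (e + d)

theorem ln_inl_eq (b c : k) : ln (.inl (b, c)) =
    ut 1 1 1 0 (HahnSeries.C c) (HahnSeries.C b) * dia k ![1, 1, 0] := by
  rw [dia_eq_ut, ut_mul, ln]
  simp

theorem ln_inr_inl_eq (a : k) : ln (.inr (.inl a)) =
    ut 1 1 1 (HahnSeries.C a) 0 0 * dia k ![1, 0, 1] := by
  rw [dia_eq_ut, ut_mul, ln]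
  simp

theorem ln_inr_inr_eq : ln (.inr (.inr ())) = ut 1 1 1 0 0 0 * dia k ![0, 1, 1] := by
  rw [dia_eq_ut, ut_mul, ln]
  simp

/-- The displacement of the orbit parameters under a step to the neighbor of index `i` of type
`1`. -/
def plShift : PIdx k → ℤ × ℤ
  | .inl _ => (1, 0)
  | .inr (.inl _) => (-1, 1)
  | .inr (.inr _) => (0, -1)

/-- The displacement of the orbit parameters under a step to the neighbor of index `i` of type
`2`. -/
def lnShift : PIdx k → ℤ × ℤ
  | .inl _ => (0, 1)
  | .inr (.inl _) => (1, -1)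
  | .inr (.inr _) => (-1, 0)

/-- The orbit of a neighbor depends only on the orbit of the vertex and on the class of the
neighbor relative to the standard flag. -/
theorem exists_of_mem_orb {p : ℤ × ℤ} {x : Vertex k} (hx : x ∈ orb k p) (h1 : 0 ≤ p.1)
    (h2 : 0 ≤ p.2) : ∃ g : GL (Fin 3) k⸨X⸩, x = g • x₀ k ∧
      (∀ i : PIdx k, g • pl i • x₀ k ∈ orb k (p + plShift i)) ∧
      ∀ i : PIdx k, g • ln i • x₀ k ∈ orb k (p + lnShift i) := by
  obtain ⟨a, ha, b, hb, c, hc, rfl⟩ := hx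
  refine ⟨ut 1 1 1 a b c * dia k ![p.1 + p.2, p.2, 0], by rw [mul_smul], fun i => ?_, fun i => ?_⟩
  all_goals
    have key : ∀ {a' b' c' : k⸨X⸩}, a' ∈ valInt k → b' ∈ valInt k → c' ∈ valInt k →
      ∀ (d : Fin 3 → ℤ) (r : ℤ × ℤ), r = p + (d 0 - d 1, d 1 - d 2) →
      (ut 1 1 1 a b c * dia k ![p.1 + p.2, p.2, 0]) • (ut 1 1 1 a' b' c' * dia k d) • x₀ k ∈
        orb k r := by
      intro a' b' c' ha' hb' hc' d r hr
      have := unip_dia_step ha hb hc ha' hb' hc' (e := ![p.1 + p.2, p.2, 0])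
        (by simpa using h1) (by simpa using h2) d
      rw [mul_smul, mul_smul]
      convert this using 2
      rw [hr]
      ext <;> simp <;> ring
  · rcases i with ⟨a', b'⟩ | c' | _
    · rw [pl_inl_eq]
      exact key (C_mem _) (zero_mem _) (C_mem _) _ _ rfl
    · rw [pl_inr_inl_eq]
      exact key (zero_mem _) (C_mem _) (zero_mem _) _ _ rfl
    · have h := key (zero_mem _) (zero_mem _) (zero_mem _) (Pi.single 2 1) _ rfl
      rw [ut_one, one_mul, ← pl_inr_inr_eq] at h
      exact h
  · rcases i with ⟨a', b'⟩ | c' | _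
    · rw [ln_inl_eq]
      exact key (zero_mem _) (C_mem _) (C_mem _) _ _ rfl
    · rw [ln_inr_inl_eq]
      exact key (C_mem _) (zero_mem _) (zero_mem _) _ _ rfl
    · have h := key (zero_mem _) (zero_mem _) (zero_mem _) ![0, 1, 1] _ rfl
      rw [← ln_inr_inr_eq] at h
      exact h

end Orbits

section Approx
variable {k : Type*} [Field k]

/-! ### Approximate eigenfunctions on the building -/

open Classical in
variable (k) in
/-- The function on the vertices that takes the value `φ p` on the orbit of parameter `p`, and
vanishes outside all these orbits. -/
def liftF (φ : ℤ × ℤ → ℂ) (x : Vertex k) : ℂ :=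
  if h : ∃ p, x ∈ orb k p then φ h.choose else 0

theorem liftF_of_mem {φ : ℤ × ℤ → ℂ} {x : Vertex k} {p : ℤ × ℤ} (hx : x ∈ orb k p) :
    liftF k φ x = φ p := by
  have h : ∃ p, x ∈ orb k p := ⟨p, hx⟩
  rw [liftF, dif_pos h, orb_disjoint h.choose_spec hx]

theorem liftF_of_not {φ : ℤ × ℤ → ℂ} {x : Vertex k} (hx : ¬ ∃ p, x ∈ orb k p) :
    liftF k φ x = 0 := by
  rw [liftF, dif_neg hx]

theorem exists_of_liftF_ne_zero {φ : ℤ × ℤ → ℂ} {x : Vertex k} (h : liftF k φ x ≠ 0) :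
    ∃ p, x ∈ orb k p ∧ φ p ≠ 0 := by
  by_cases hx : ∃ p, x ∈ orb k p
  · obtain ⟨p, hp⟩ := hx
    exact ⟨p, hp, by rwa [liftF_of_mem hp] at h⟩
  · exact absurd (liftF_of_not hx) h

theorem tsum_liftF (φ : ℤ × ℤ → ℂ) :
    ∑' x, ‖liftF k φ x‖ₑ ^ 2 = ∑' p, ((orb k p).encard : ℝ≥0∞) * ‖φ p‖ₑ ^ 2 := by
  classical
  have h : ∀ x, ‖liftF k φ x‖ₑ ^ 2 = ∑' p, if x ∈ orb k p then ‖φ p‖ₑ ^ 2 else 0 := by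
    intro x
    by_cases hx : ∃ p, x ∈ orb k p
    · obtain ⟨p, hp⟩ := hx
      rw [tsum_eq_single p, if_pos hp, liftF_of_mem hp]
      intro p' hp'
      rw [if_neg]
      exact fun h => hp' (orb_disjoint h hp)
    · rw [liftF_of_not hx]
      simp only [not_exists] at hx
      simp [hx]
  simp only [h]
  rw [ENNReal.tsum_comm]
  refine tsum_congr fun p => ?_
  rw [← ENNReal.tsum_set_const, tsum_subtype (orb k p) fun _ => ‖φ p‖ₑ ^ 2]
  rfl

/-- A summation operator over neighbors, applied to a function that is constant on the orbits. -/
theorem adj_liftF {φ : ℤ × ℤ → ℂ} (hφ : ∀ p, φ p ≠ 0 → 2 ≤ p.1 ∧ 2 ≤ p.2) [Fintype k]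
    {A : (Vertex k → ℂ) → Vertex k → ℂ} {m : PIdx k → GL (Fin 3) k⸨X⸩} {σ : PIdx k → ℤ × ℤ}
    (hA : ∀ (f : Vertex k → ℂ) (g : GL (Fin 3) k⸨X⸩), A f (g • x₀ k) = ∑ i, f (g • m i • x₀ k))
    (hadj : ∀ (g : GL (Fin 3) k⸨X⸩) i, Adj (g • x₀ k) (g • m i • x₀ k))
    (hσ : ∀ i, |(σ i).1| ≤ 1 ∧ |(σ i).2| ≤ 1)
    (hm : ∀ p x, x ∈ orb k p → 0 ≤ p.1 → 0 ≤ p.2 → ∃ g : GL (Fin 3) k⸨X⸩, x = g • x₀ k ∧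
      ∀ i, g • m i • x₀ k ∈ orb k (p + σ i)) :
    A (liftF k φ) = liftF k fun p => ∑ i, φ (p + σ i) := by
  funext x
  by_cases hx : ∃ p, x ∈ orb k p ∧ 0 ≤ p.1 ∧ 0 ≤ p.2
  · obtain ⟨p, hp, h1, h2⟩ := hx
    rw [liftF_of_mem hp]
    obtain ⟨g, rfl, hg⟩ := hm p x hp h1 h2
    rw [hA]
    exact Finset.sum_congr rfl fun i _ => liftF_of_mem (hg i)
  -- `x` is outside the dominant orbits, and the neighbors of a vertex that carries `φ` are inside
  · have hL : A (liftF k φ) x = 0 := by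
      obtain ⟨g, rfl⟩ := exists_smul_x₀ x
      rw [hA]
      refine Finset.sum_eq_zero fun i _ => ?_
      by_contra hne
      obtain ⟨p, hp, hp0⟩ := exists_of_liftF_ne_zero hne
      obtain ⟨h1, h2⟩ := hφ p hp0
      obtain ⟨g', hg', h3, h4⟩ := exists_of_mem_orb hp (by omega) (by omega)
      have h5 := adj_symm (hadj g i)
      rw [hg', adj_smul_x₀_iff] at h5
      rcases h5 with ⟨j, hj⟩ | ⟨j, hj⟩
      · refine hx ⟨_, hj ▸ h3 j, ?_⟩
        rcases j with _ | _ | _ <;> simp [plShift] <;> omega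
      · refine hx ⟨_, hj ▸ h4 j, ?_⟩
        rcases j with _ | _ | _ <;> simp [lnShift] <;> omega
    rw [hL, eq_comm]
    by_contra hne
    obtain ⟨p, hp, hp0⟩ := exists_of_liftF_ne_zero hne
    obtain ⟨i, -, hi⟩ := Finset.exists_ne_zero_of_sum_ne_zero hp0
    have h1 := hφ _ hi
    have h2 := hσ i
    rw [abs_le, abs_le] at h2
    refine hx ⟨p, hp, ?_⟩
    simp only [Prod.fst_add, Prod.snd_add] at h1
    constructor <;> omega

/-- The character of the orbit parameters attached to `s₁`, `s₂`, normalized by the square root of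
the size of the orbits. -/
def chi (q : ℕ) (s₁ s₂ : ℂ) (p : ℤ × ℤ) : ℂ :=
  (q : ℂ) ^ (-(p.1 + p.2)) * s₁ ^ (p.1 + p.2) * s₂ ^ p.2

theorem chi_add {q : ℕ} {s₁ s₂ : ℂ} (hq : q ≠ 0) (h1 : s₁ ≠ 0) (h2 : s₂ ≠ 0) (p r : ℤ × ℤ) :
    chi q s₁ s₂ (p + r) = chi q s₁ s₂ p * chi q s₁ s₂ r := by
  have hq' : (q : ℂ) ≠ 0 := by exact_mod_cast hq
  simp only [chi, Prod.fst_add, Prod.snd_add]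
  rw [show -(p.1 + r.1 + (p.2 + r.2)) = -(p.1 + p.2) + -(r.1 + r.2) by ring,
    show p.1 + r.1 + (p.2 + r.2) = (p.1 + p.2) + (r.1 + r.2) by ring,
    zpow_add₀ hq', zpow_add₀ h1, zpow_add₀ h2]
  ring

/-- The normalization of the characters cancels the size `q^(2(m + n))` of the orbits. -/
theorem wNorm_liftF_chi [Fintype k] {s₁ s₂ : ℂ} (h1 : ‖s₁‖ = 1) (h2 : ‖s₂‖ = 1)
    {ψ : ℤ × ℤ → ℂ} (hψ : ∀ p, ψ p ≠ 0 → 0 ≤ p.1 ∧ 0 ≤ p.2) :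
    wNorm (fun _ => 1) (liftF k fun p => chi (Fintype.card k) s₁ s₂ p * ψ p) ^ 2 =
      ∑' p, ‖ψ p‖ₑ ^ 2 := by
  rw [wNorm_sq]
  simp only [ENNReal.ofReal_one, one_mul]
  rw [tsum_liftF]
  refine tsum_congr fun p => ?_
  by_cases hp : ψ p = 0
  · simp [hp]
  · obtain ⟨⟨m, n⟩, rfl⟩ : ∃ r : ℕ × ℕ, p = ((r.1 : ℤ), (r.2 : ℤ)) := by
      obtain ⟨ha, hb⟩ := hψ p hp
      exact ⟨(p.1.toNat, p.2.toNat), by ext <;> simp [ha, hb]⟩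
    have hq0 : (Fintype.card k : ℝ) ≠ 0 := by simp
    have hn : ‖chi (Fintype.card k) s₁ s₂ ((m : ℤ), (n : ℤ))‖ =
        ((Fintype.card k : ℝ) ^ (m + n))⁻¹ := by
      rw [chi, norm_mul, norm_mul, norm_zpow, norm_zpow, norm_zpow, h1, h2, one_zpow, one_zpow,
        Complex.norm_natCast, zpow_neg, ← Nat.cast_add, zpow_natCast]
      simp
    have he : ‖chi (Fintype.card k) s₁ s₂ ((m : ℤ), (n : ℤ))‖ₑ =
        ((Fintype.card k : ℝ≥0∞) ^ (m + n))⁻¹ := by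
      rw [← ofReal_norm, hn, ENNReal.ofReal_inv_of_pos (by positivity), ENNReal.ofReal_pow
        (by positivity), ENNReal.ofReal_natCast]
    rw [encard_orb, enorm_mul, mul_pow, ← mul_assoc, he]
    have hc : ((Fintype.card k : ℝ≥0∞) ^ (m + n)) ^ 2 ≠ 0 := by simp
    have hc' : ((Fintype.card k : ℝ≥0∞) ^ (m + n)) ^ 2 ≠ ⊤ := by finiteness
    have : (((Fintype.card k ^ (2 * (m + n)) : ℕ) : ℕ∞) : ℝ≥0∞) =
        ((Fintype.card k : ℝ≥0∞) ^ (m + n)) ^ 2 := by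
      push_cast
      ring
    rw [this, ← ENNReal.inv_pow, ENNReal.mul_inv_cancel hc hc', one_mul]

/-- The normalized indicator function of the window `[2, N + 1]²`. -/
def win (N : ℕ) (p : ℤ × ℤ) : ℂ :=
  if 2 ≤ p.1 ∧ p.1 ≤ N + 1 ∧ 2 ≤ p.2 ∧ p.2 ≤ N + 1 then (N : ℂ)⁻¹ else 0

theorem win_ne_zero {N : ℕ} {p : ℤ × ℤ} (h : win N p ≠ 0) : 2 ≤ p.1 ∧ 2 ≤ p.2 := by
  rw [win] at h
  split_ifs at h with h1
  · exact ⟨h1.1, h1.2.2.1⟩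
  · exact absurd rfl h

theorem tsum_win {N : ℕ} (hN : N ≠ 0) : ∑' p, ‖win N p‖ₑ ^ 2 = 1 := by
  rw [tsum_eq_sum (s := Finset.Icc (2 : ℤ) (N + 1) ×ˢ Finset.Icc (2 : ℤ) (N + 1))]
  · have h : ∀ p ∈ Finset.Icc (2 : ℤ) (N + 1) ×ˢ Finset.Icc (2 : ℤ) (N + 1),
        ‖win N p‖ₑ ^ 2 = ((N : ℝ≥0∞) ^ 2)⁻¹ := by
      intro p hp
      simp only [Finset.mem_product, Finset.mem_Icc] at hp
      rw [win, if_pos ⟨hp.1.1, hp.1.2, hp.2.1, hp.2.2⟩, enorm_inv (by exact_mod_cast hN),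
        ENNReal.inv_pow]
      congr 2
      rw [← ofReal_norm, Complex.norm_natCast, ENNReal.ofReal_natCast]
    rw [Finset.sum_congr rfl h, Finset.sum_const, Finset.card_product, Int.card_Icc, nsmul_eq_mul]
    have h1 : ((N : ℤ) + 1 + 1 - 2).toNat = N := by omega
    rw [h1]
    push_cast
    rw [← sq]
    exact ENNReal.mul_inv_cancel (by simpa using hN) (by finiteness)
  · intro p hp
    simp only [Finset.mem_product, Finset.mem_Icc] at hp
    rw [win, if_neg (by tauto)]
    simp

theorem win_diff_eq_zero {N : ℕ} {p σ : ℤ × ℤ} (h1 : |σ.1| ≤ 1) (h2 : |σ.2| ≤ 1)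
    (hp : p ∉ (Finset.Icc (1 : ℤ) (N + 2) ×ˢ Finset.Icc (1 : ℤ) (N + 2)) \
      (Finset.Icc (3 : ℤ) N ×ˢ Finset.Icc (3 : ℤ) N)) : win N (p + σ) - win N p = 0 := by
  rw [abs_le] at h1 h2
  simp only [Finset.mem_sdiff, Finset.mem_product, Finset.mem_Icc] at hp
  have : (2 ≤ (p + σ).1 ∧ (p + σ).1 ≤ N + 1 ∧ 2 ≤ (p + σ).2 ∧ (p + σ).2 ≤ N + 1) ↔
      2 ≤ p.1 ∧ p.1 ≤ N + 1 ∧ 2 ≤ p.2 ∧ p.2 ≤ N + 1 := by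
    simp only [Prod.fst_add, Prod.snd_add]
    omega
  rw [win, win]
  simp only [this, sub_self]

theorem norm_win_diff_le (N : ℕ) (p σ : ℤ × ℤ) :
    ‖win N (p + σ) - win N p‖ ≤ (N : ℝ)⁻¹ := by
  have h : 0 ≤ (N : ℝ)⁻¹ := by positivity
  rw [win, win]
  split_ifs <;> simp

/-- The boundary of the window, where the cut-off is felt, has size `O(N)`, while the window has
`N²` elements. -/
theorem card_boundary_le {N : ℕ} (hN : N ≠ 0) :
    ((Finset.Icc (1 : ℤ) (N + 2) ×ˢ Finset.Icc (1 : ℤ) (N + 2)) \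
      (Finset.Icc (3 : ℤ) N ×ˢ Finset.Icc (3 : ℤ) N)).card ≤ 9 * N := by
  rw [Finset.card_sdiff_of_subset]
  · simp only [Finset.card_product, Int.card_Icc]
    have h1 : ((N : ℤ) + 2 + 1 - 1).toNat = N + 2 := by omega
    have h2 : ((N : ℤ) + 1 - 3).toNat = N - 2 := by omega
    rw [h1, h2, tsub_le_iff_right]
    rcases Nat.lt_or_ge N 2 with h | h
    · interval_cases N <;> simp at *
    · obtain ⟨m, rfl⟩ := Nat.exists_eq_add_of_le h
      rw [Nat.add_sub_cancel_left]
      nlinarith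
  · intro p
    simp only [Finset.mem_product, Finset.mem_Icc]
    omega

theorem rpow_half_sq (x : ℝ≥0∞) : (x ^ 2) ^ (1 / 2 : ℝ) = x := by
  rw [← ENNReal.rpow_natCast, ← ENNReal.rpow_mul]
  norm_num

theorem tendsto_zero_of_sq {a : ℕ → ℝ≥0∞}
    (h : Filter.Tendsto (fun n => a n ^ 2) Filter.atTop (nhds 0)) :
    Filter.Tendsto a Filter.atTop (nhds 0) := by
  have h1 := h.ennrpow_const (1 / 2 : ℝ)
  simp only [rpow_half_sq] at h1
  simpa using h1

/-- The windowed characters are approximate eigenfunctions of a summation operator over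
neighbors. -/
theorem tendsto_approx [Fintype k] {s₁ s₂ : ℂ} (h1 : ‖s₁‖ = 1) (h2 : ‖s₂‖ = 1)
    {A : (Vertex k → ℂ) → Vertex k → ℂ} {m : PIdx k → GL (Fin 3) k⸨X⸩} {σ : PIdx k → ℤ × ℤ}
    (hA : ∀ (f : Vertex k → ℂ) (g : GL (Fin 3) k⸨X⸩), A f (g • x₀ k) = ∑ i, f (g • m i • x₀ k))
    (hadj : ∀ (g : GL (Fin 3) k⸨X⸩) i, Adj (g • x₀ k) (g • m i • x₀ k))
    (hσ : ∀ i, |(σ i).1| ≤ 1 ∧ |(σ i).2| ≤ 1)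
    (hm : ∀ p x, x ∈ orb k p → 0 ≤ p.1 → 0 ≤ p.2 → ∃ g : GL (Fin 3) k⸨X⸩, x = g • x₀ k ∧
      ∀ i, g • m i • x₀ k ∈ orb k (p + σ i)) :
    Filter.Tendsto (fun n : ℕ => wNorm (fun _ => 1)
      (A (liftF k fun p => chi (Fintype.card k) s₁ s₂ p * win (n + 1) p) -
        (∑ i, chi (Fintype.card k) s₁ s₂ (σ i)) •
          liftF k fun p => chi (Fintype.card k) s₁ s₂ p * win (n + 1) p)) Filter.atTop (nhds 0) := by
  have hs1 : s₁ ≠ 0 := by rintro rfl; simp at h1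
  have hs2 : s₂ ≠ 0 := by rintro rfl; simp at h2
  set χ := chi (Fintype.card k) s₁ s₂ with hχ
  set C : ℝ := ∑ i, ‖χ (σ i)‖ with hC
  have hC0 : 0 ≤ C := Finset.sum_nonneg fun _ _ => norm_nonneg _
  have hadd : ∀ p r, χ (p + r) = χ p * χ r := chi_add Fintype.card_ne_zero hs1 hs2
  have hbound : ∀ N : ℕ, N ≠ 0 → wNorm (fun _ => 1)
      (A (liftF k fun p => χ p * win N p) - (∑ i, χ (σ i)) • liftF k fun p => χ p * win N p) ^ 2 ≤
      ENNReal.ofReal (9 * C ^ 2 / N) := by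
    intro N hN
    have e1 : A (liftF k fun p => χ p * win N p) - (∑ i, χ (σ i)) • liftF k (fun p => χ p * win N p)
        = liftF k fun p => χ p * ∑ i, χ (σ i) * (win N (p + σ i) - win N p) := by
      rw [adj_liftF (fun p hp => win_ne_zero (right_ne_zero_of_mul hp)) hA hadj hσ hm]
      funext x
      by_cases hx : ∃ p, x ∈ orb k p
      · obtain ⟨p, hp⟩ := hx
        rw [Pi.sub_apply, Pi.smul_apply, liftF_of_mem hp, liftF_of_mem hp, liftF_of_mem hp,
          smul_eq_mul, Finset.sum_mul, Finset.mul_sum, ← Finset.sum_sub_distrib]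
        refine Finset.sum_congr rfl fun i _ => ?_
        rw [hadd]
        ring
      · rw [Pi.sub_apply, Pi.smul_apply, liftF_of_not hx, liftF_of_not hx, liftF_of_not hx]
        simp
    have hzero : ∀ p ∉ (Finset.Icc (1 : ℤ) (N + 2) ×ˢ Finset.Icc (1 : ℤ) (N + 2)) \
        (Finset.Icc (3 : ℤ) N ×ˢ Finset.Icc (3 : ℤ) N),
        ∑ i, χ (σ i) * (win N (p + σ i) - win N p) = 0 := by
      intro p hp
      refine Finset.sum_eq_zero fun i _ => ?_
      rw [win_diff_eq_zero (hσ i).1 (hσ i).2 hp, mul_zero]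
    rw [e1, wNorm_liftF_chi h1 h2, tsum_eq_sum (s := (Finset.Icc (1 : ℤ) (N + 2) ×ˢ
      Finset.Icc (1 : ℤ) (N + 2)) \ (Finset.Icc (3 : ℤ) N ×ˢ Finset.Icc (3 : ℤ) N))]
    · have hle : ∀ p, ‖∑ i, χ (σ i) * (win N (p + σ i) - win N p)‖ₑ ^ 2 ≤
          ENNReal.ofReal ((C / N) ^ 2) := by
        intro p
        rw [← ofReal_norm, ← ENNReal.ofReal_pow (norm_nonneg _)]
        apply ENNReal.ofReal_le_ofReal
        gcongr
        refine (norm_sum_le _ _).trans ?_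
        rw [hC, div_eq_mul_inv, Finset.sum_mul]
        refine Finset.sum_le_sum fun i _ => ?_
        rw [norm_mul]
        gcongr
        exact norm_win_diff_le _ _ _
      refine (Finset.sum_le_card_nsmul _ _ _ fun p _ => hle p).trans ?_
      rw [nsmul_eq_mul, ← ENNReal.ofReal_natCast, ← ENNReal.ofReal_mul (Nat.cast_nonneg _)]
      apply ENNReal.ofReal_le_ofReal
      have h3 : (((Finset.Icc (1 : ℤ) (N + 2) ×ˢ Finset.Icc (1 : ℤ) (N + 2)) \
        (Finset.Icc (3 : ℤ) N ×ˢ Finset.Icc (3 : ℤ) N)).card : ℝ) ≤ 9 * N := by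
        exact_mod_cast card_boundary_le hN
      have hN' : (0 : ℝ) < N := by positivity
      calc _ ≤ 9 * (N : ℝ) * (C / N) ^ 2 := by gcongr
        _ = _ := by field_simp
    · intro p hp
      rw [hzero p hp]
      simp
    · intro p hp
      by_contra hcon
      refine hp (hzero p ?_)
      simp only [Finset.mem_sdiff, Finset.mem_product, Finset.mem_Icc]
      omega
  apply tendsto_zero_of_sq
  refine tendsto_of_tendsto_of_tendsto_of_le_of_le tendsto_const_nhds ?_ (fun n => zero_le)
    fun n => hbound (n + 1) n.succ_ne_zero
  rw [← ENNReal.ofReal_zero]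
  refine ENNReal.tendsto_ofReal ?_
  exact (tendsto_const_div_atTop_nhds_zero_nat _).comp (Filter.tendsto_add_atTop_nat 1)

/-- The sum of a character over the displacements of the neighbors of type `1` is
`q² χ(1, 0) + q χ(-1, 1) + χ(0, -1) = q (s₁ + s₂ + s₃)`. -/
theorem mem_buildingSpectrum_of_mem_Sigma2 [Fintype k] {z : ℂ} (hz : z ∈ Sigma2 (Fintype.card k)) :
    (z, star z) ∈ buildingSpectrum k := by
  obtain ⟨s₁, s₂, s₃, h1, h2, h3, h123, rfl⟩ := hz
  have hs1 : s₁ ≠ 0 := by rintro rfl; simp at h1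
  have hs2 : s₂ ≠ 0 := by rintro rfl; simp at h2
  have hs3 : s₃ ≠ 0 := by rintro rfl; simp at h3
  have hq : (Fintype.card k : ℂ) ≠ 0 := by simp
  refine ⟨fun n => liftF k fun p => chi (Fintype.card k) s₁ s₂ p * win (n + 1) p, fun n => ?_,
    ?_, ?_⟩
  · have h := wNorm_liftF_chi (k := k) h1 h2 (ψ := win (n + 1))
      (fun p hp => by have := win_ne_zero hp; omega)
    rw [tsum_win n.succ_ne_zero] at h
    rw [← rpow_half_sq (wNorm _ _), h, ENNReal.one_rpow]
  · have h := tendsto_approx h1 h2 (A := coloredAdj (k := k) 1) (m := pl) (σ := plShift)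
      coloredAdj_one (fun g i => adj_GL_smul g (adj_x₀_pl i))
      (by rintro (_ | _ | _) <;> simp [plShift])
      (fun p x hx h1 h2 => by
        obtain ⟨g, hg, h, -⟩ := exists_of_mem_orb hx h1 h2
        exact ⟨g, hg, h⟩)
    have e : ∑ i : PIdx k, chi (Fintype.card k) s₁ s₂ (plShift i) =
        Fintype.card k * (s₁ + s₂ + s₃) := by
      have : s₃ = s₁⁻¹ * s₂⁻¹ := by field_simp; linear_combination h123
      rw [Fintype.sum_sum_type, Fintype.sum_sum_type, this]
      simp [plShift, chi]
      field_simp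
      ring
    rw [e] at h
    exact h
  · have h := tendsto_approx h1 h2 (A := coloredAdj (k := k) 2) (m := ln) (σ := lnShift)
      coloredAdj_two (fun g i => adj_GL_smul g (adj_x₀_ln i))
      (by rintro (_ | _ | _) <;> simp [lnShift])
      (fun p x hx h1 h2 => by
        obtain ⟨g, hg, -, h⟩ := exists_of_mem_orb hx h1 h2
        exact ⟨g, hg, h⟩)
    have e : ∑ i : PIdx k, chi (Fintype.card k) s₁ s₂ (lnShift i) =
        star (Fintype.card k * (s₁ + s₂ + s₃)) := by
      have h4 : s₃⁻¹ = s₁ * s₂ := by field_simp; linear_combination -h123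
      rw [star_mul', star_add, star_add, star_eq_inv h1, star_eq_inv h2, star_eq_inv h3, star_natCast, h4,
        Fintype.sum_sum_type, Fintype.sum_sum_type]
      simp [lnShift, chi]
      field_simp
      ring
    rw [e] at h
    exact h

end Approx

section Poly
variable {k : Type*} [Field k]

/-! ### Polynomial matrices -/

theorem polyEmb_monomial (n : ℕ) (a : k) :
    polyEmb k (Polynomial.monomial n a) = HahnSeries.single (-(n : ℤ)) a := by
  have h1 : polyEmb k (Polynomial.monomial n a) =
      algebraMap k k⸨X⸩ a * (((unif k)⁻¹ : (k⸨X⸩)ˣ) : k⸨X⸩) ^ n :=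
    Polynomial.aeval_monomial _
  have h2 : (((unif k)⁻¹ : (k⸨X⸩)ˣ) : k⸨X⸩) ^ n = HahnSeries.single (-(n : ℤ)) 1 := by
    rw [← unif_zpow_val, zpow_neg, zpow_natCast, ← Units.val_pow_eq_pow_val, inv_pow]
  have h3 : algebraMap k k⸨X⸩ a = HahnSeries.single 0 a := by
    change HahnSeries.ofPowerSeries ℤ k (algebraMap k k⟦X⟧ a) = _
    rw [PowerSeries.algebraMap_apply, Algebra.algebraMap_self, RingHom.id_apply,
      HahnSeries.ofPowerSeries_C, HahnSeries.C_apply]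
  rw [h1, h2, h3, HahnSeries.single_mul_single, zero_add, mul_one]

theorem coeff_polyEmb (p : k[X]) (n : ℤ) :
    (polyEmb k p).coeff n = if n ≤ 0 then p.coeff (-n).toNat else 0 := by
  induction p using Polynomial.induction_on' with
  | add p q hp hq =>
    rw [map_add, HahnSeries.coeff_add, hp, hq]
    split_ifs <;> simp
  | monomial m a =>
    rw [polyEmb_monomial, HahnSeries.coeff_single, Polynomial.coeff_monomial]
    split_ifs <;> first | rfl | omega

theorem polyEmb_injective : Function.Injective (polyEmb k) := by
  intro p q h
  ext n
  have := congrArg (fun a => HahnSeries.coeff a (-(n : ℤ))) h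
  simpa [coeff_polyEmb] using this

theorem unif_zpow_mul_polyEmb_mem_iff {n : ℤ} {p : k[X]} :
    ((unif k ^ n : (k⸨X⸩)ˣ) : k⸨X⸩) * polyEmb k p ∈ valInt k ↔
      p ∈ Polynomial.degreeLT k (n + 1).toNat := by
  rw [unif_zpow_mul_mem_iff, Polynomial.mem_degreeLT, Polynomial.degree_lt_iff_coeff_zero]
  simp only [coeff_polyEmb]
  constructor
  · intro h m hm
    have := h (-(m : ℤ)) (by omega)
    simpa using this
  · intro h m hm
    split_ifs with h0
    · exact h _ (by omega)
    · rfl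

theorem polyEmb_C (a : k) : polyEmb k (Polynomial.C a) = HahnSeries.C a := by
  rw [← Polynomial.monomial_zero_left, polyEmb_monomial]
  rfl

theorem polyEmb_X_pow (n : ℕ) :
    polyEmb k (Polynomial.X ^ n) = ((unif k ^ (-(n : ℤ)) : (k⸨X⸩)ˣ) : k⸨X⸩) := by
  rw [← Polynomial.monomial_one_right_eq_X_pow, polyEmb_monomial, unif_zpow_val]

theorem card_degreeLT [Finite k] (n : ℕ) : Nat.card (Polynomial.degreeLT k n) = Nat.card k ^ n := by
  rw [Nat.card_congr (Polynomial.degreeLTEquiv k n).toEquiv, Nat.card_fun, Nat.card_fin]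

instance [Finite k] (n : ℕ) : Finite (Polynomial.degreeLT k n) :=
  Finite.of_equiv _ (Polynomial.degreeLTEquiv k n).toEquiv.symm

/-- The embedding of `GL(3, k[t])` into `GL(3, k((t⁻¹)))`. -/
abbrev emb : GL (Fin 3) k[X] →* GL (Fin 3) k⸨X⸩ :=
  Matrix.GeneralLinearGroup.map (n := Fin 3) (polyEmb k)

theorem emb_apply (γ : GL (Fin 3) k[X]) (i j : Fin 3) :
    (emb γ : Matrix (Fin 3) (Fin 3) k⸨X⸩) i j = polyEmb k (γ.1 i j) := rfl

theorem vdet_emb (γ : GL (Fin 3) k[X]) : vdet (emb γ) = 0 := by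
  have h : IsUnit (γ.1.det) := (Matrix.isUnit_iff_isUnit_det _).1 γ.isUnit
  obtain ⟨c, hc, h1⟩ := Polynomial.isUnit_iff.1 h
  have h2 : (emb γ : Matrix (Fin 3) (Fin 3) k⸨X⸩).det = polyEmb k γ.1.det :=
    (RingHom.map_det _ _).symm
  rw [vdet, h2, ← h1, polyEmb_C, HahnSeries.C_apply, HahnSeries.order_single hc.ne_zero]

/-- The class in `Γ` of a polynomial matrix. -/
def toGam (γ : GL (Fin 3) k[X]) : Gam k := ⟨QuotientGroup.mk (emb γ), γ, rfl⟩

theorem toGam_surjective : Function.Surjective (toGam (k := k)) := by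
  rintro ⟨_, γ, rfl⟩
  exact ⟨γ, rfl⟩

theorem toGam_smul (γ : GL (Fin 3) k[X]) (x : Vertex k) : toGam γ • x = emb γ • x := by
  obtain ⟨L, rfl⟩ := toVertex_surjective x
  rfl

theorem toQ_eq_iff {x y : Vertex k} : x.toQ = y.toQ ↔ ∃ γ : GL (Fin 3) k[X], emb γ • y = x := by
  refine (Quotient.eq (r := MulAction.orbitRel (Gam k) (Vertex k))).trans ?_
  rw [MulAction.orbitRel_apply]
  constructor
  · rintro ⟨γ, h⟩
    obtain ⟨γ, rfl⟩ := toGam_surjective γ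
    exact ⟨γ, (toGam_smul γ y).symm.trans h⟩
  · rintro ⟨γ, rfl⟩
    exact ⟨toGam γ, toGam_smul γ y⟩

theorem toQ_surjective : Function.Surjective (Vertex.toQ (k := k)) := Quotient.mk_surjective

theorem color_gam_smul [Finite k] (γ : Gam k) (x : Vertex k) : color (γ • x) = color x := by
  obtain ⟨γ, rfl⟩ := toGam_surjective γ
  rw [toGam_smul, color_smul, vdet_emb, Int.cast_zero, add_zero]

/-! ### Reduction theory -/

/-- The identity matrix with the column `j` replaced by a vector whose entry of index `j` is
a nonzero constant, over the polynomial ring. -/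
def colPoly (j : Fin 3) (c : Fin 3 → k[X]) (hc : IsUnit (c j)) : GL (Fin 3) k[X] :=
  Matrix.GeneralLinearGroup.mk'' (Matrix.updateCol 1 j c) (by
    rw [← Matrix.cramer_apply, Matrix.cramer_one]; exact hc)

theorem emb_colPoly_mul_dia (A : Matrix (Fin 3) (Fin 3) k⸨X⸩) (j : Fin 3) (c : Fin 3 → k[X])
    (hc : IsUnit (c j)) (s : Fin 3 → ℤ) (i l : Fin 3) :
    (A * (emb (colPoly j c hc)).1 * (dia k s).1) i l =
      (if l = j then ∑ m, A i m * polyEmb k (c m) else A i l) *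
        ((unif k ^ s l : (k⸨X⸩)ˣ) : k⸨X⸩) := by
  rw [mul_dia_apply, Matrix.mul_apply]
  congr 1
  have h : ∀ m, (emb (colPoly j c hc)).1 m l =
      if l = j then polyEmb k (c m) else if m = l then 1 else 0 := by
    intro m
    rw [emb_apply]
    change polyEmb k (Matrix.updateCol 1 j c m l) = _
    rw [Matrix.updateCol_apply]
    split_ifs with h1 h2
    · rfl
    · rw [h2, Matrix.one_apply_eq, map_one]
    · rw [Matrix.one_apply_ne h2, map_zero]
  simp only [h]
  split_ifs <;> simp

/-- Elementary column operations over `k[t]` make `g` a product of a polynomial, a diagonal and an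
integral matrix, by induction on the valuation of the determinant. -/
theorem exists_reduced (g : GL (Fin 3) k⸨X⸩) (N : ℕ) : ∀ (γ : GL (Fin 3) k[X]) (s : Fin 3 → ℤ),
    (∀ i j, ((g⁻¹ * emb γ * dia k s : GL (Fin 3) k⸨X⸩) : Matrix (Fin 3) (Fin 3) k⸨X⸩) i j ∈
      valInt k) → vdet (g⁻¹ * emb γ * dia k s) = N →
    ∃ (γ : GL (Fin 3) k[X]) (s : Fin 3 → ℤ), g⁻¹ * emb γ * dia k s ∈ intGL k := by
  induction N with
  | zero => exact fun γ s h h0 => ⟨γ, s, mem_intGL_iff.2 ⟨h, by exact_mod_cast h0⟩⟩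
  | succ N ih =>
    intro γ s h h0
    obtain ⟨c, hc, hb⟩ := exists_mulVec_mem_unif h (by rw [← vdet, h0]; positivity)
    classical
    -- among the indices with `c j ≠ 0`, the largest `s j` makes `t ^ (s j - s i)` a polynomial
    obtain ⟨j, hj, hmax⟩ := Finset.exists_max_image (Finset.univ.filter fun j => c j ≠ 0) s (by
      obtain ⟨j, hj⟩ := Function.ne_iff.1 hc
      exact ⟨j, by simpa using hj⟩)
    simp only [Finset.mem_filter, Finset.mem_univ, true_and] at hj hmax
    set p : Fin 3 → k[X] := fun i => Polynomial.C (c i) * Polynomial.X ^ (s j - s i).toNat with hp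
    have hpj : IsUnit (p j) := by
      rw [hp]; simpa using hj
    have hpe : ∀ i, polyEmb k (p i) * ((unif k ^ s j : (k⸨X⸩)ˣ) : k⸨X⸩) =
        ((unif k ^ s i : (k⸨X⸩)ˣ) : k⸨X⸩) * HahnSeries.C (c i) := by
      intro i
      by_cases hi : c i = 0
      · simp [hp, hi]
      · rw [hp, map_mul, polyEmb_C, polyEmb_X_pow, Int.toNat_of_nonneg (by linarith [hmax i hi]),
          mul_assoc, ← Units.val_mul, ← zpow_add, mul_comm]
        congr 3
        ring
    refine ih (γ * colPoly j p hpj) (s - Pi.single j 1) (fun i l => ?_) ?_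
    · rw [map_mul, ← mul_assoc, Units.val_mul, Units.val_mul, emb_colPoly_mul_dia]
      split_ifs with hl
      · subst hl
        obtain ⟨b, hb, hb'⟩ := hb i
        have e : (∑ m, (g⁻¹ * emb γ).1 i m * polyEmb k (p m)) *
            ((unif k ^ s l : (k⸨X⸩)ˣ) : k⸨X⸩) = ((unif k : (k⸨X⸩)ˣ) : k⸨X⸩) * b := by
          rw [← hb', Finset.sum_mul]
          refine Finset.sum_congr rfl fun m _ => ?_
          rw [mul_assoc, hpe, Units.val_mul _ (dia k s), mul_dia_apply, mul_assoc]
        have e2 : ((unif k ^ (s - Pi.single l 1 : Fin 3 → ℤ) l : (k⸨X⸩)ˣ) : k⸨X⸩) =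
            ((unif k ^ s l : (k⸨X⸩)ˣ) : k⸨X⸩) * (((unif k)⁻¹ : (k⸨X⸩)ˣ) : k⸨X⸩) := by
          rw [Pi.sub_apply, Pi.single_eq_same, zpow_sub_one, Units.val_mul]
        rw [e2, ← mul_assoc, e, mul_right_comm, Units.mul_inv, one_mul]
        exact hb
      · have := h i l
        rw [Units.val_mul _ (dia k s), mul_dia_apply] at this
        rwa [Pi.sub_apply, Pi.single_eq_of_ne hl, sub_zero]
    · simp only [vdet_mul, vdet_emb, vdet_dia, vdet_inv, Pi.sub_apply, Finset.sum_sub_distrib,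
        Finset.sum_pi_single'] at h0 ⊢
      push_cast at h0
      simp
      omega

/-- A permutation matrix, over any commutative ring. -/
def permGL {R : Type*} [CommRing R] (σ : Equiv.Perm (Fin 3)) : GL (Fin 3) R :=
  ⟨σ.permMatrix R, σ⁻¹.permMatrix R, by rw [← Matrix.permMatrix_mul]; simp,
    by rw [← Matrix.permMatrix_mul]; simp⟩

theorem permGL_apply {R : Type*} [CommRing R] (σ : Equiv.Perm (Fin 3)) (i j : Fin 3) :
    (permGL σ : GL (Fin 3) R).1 i j = if σ i = j then 1 else 0 := by
  change PEquiv.toMatrix _ i j = _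
  simp [PEquiv.toMatrix_apply, eq_comm]

theorem emb_permGL (σ : Equiv.Perm (Fin 3)) : emb (permGL σ : GL (Fin 3) k[X]) = permGL σ := by
  ext i j
  rw [emb_apply, permGL_apply, permGL_apply]
  split_ifs <;> simp

theorem permGL_mem (σ : Equiv.Perm (Fin 3)) : permGL σ ∈ intGL k := by
  rw [mem_intGL_iff, ← emb_permGL, vdet_emb]
  refine ⟨fun i j => ?_, rfl⟩
  rw [emb_permGL, permGL_apply]
  split_ifs
  · exact one_mem _
  · exact zero_mem _

theorem dia_mul_permGL (s : Fin 3 → ℤ) (σ : Equiv.Perm (Fin 3)) :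
    permGL σ * dia k s = dia k (s ∘ σ) * permGL σ := by
  ext i j
  rw [Units.val_mul, Units.val_mul, mul_dia_apply, dia_mul_apply, permGL_apply]
  split_ifs with h
  · subst h; simp
  · simp

variable (k) in
/-- The vertex of the lattice `t^(a 0) 𝒪 ⊕ t^(a 1) 𝒪 ⊕ t^(a 2) 𝒪`. -/
def dv (a : Fin 3 → ℤ) : Vertex k := dia k (-a) • x₀ k

/-- Every orbit of `Γ` contains the vertex of a diagonal matrix with decreasing exponents: a vector
bundle of rank 3 on the projective line is a sum of line bundles. -/
theorem exists_toQ_eq_dv (x : Vertex k) : ∃ a : Fin 3 → ℤ, Antitone a ∧ x.toQ = (dv k a).toQ := by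
  obtain ⟨g, rfl⟩ := exists_smul_x₀ x
  obtain ⟨n, hn⟩ := exists_scal_mul_integral g⁻¹
  have e : scal k n * g⁻¹ = g⁻¹ * emb 1 * dia k (fun _ => n) := by
    rw [dia_const, map_one, mul_one, scal_comm]
  rw [e] at hn
  obtain ⟨N, hN⟩ := Int.eq_ofNat_of_zero_le (order_nonneg_of_mem (det_mem hn))
  obtain ⟨γ, s, h⟩ := exists_reduced g N _ _ hn hN
  have hx : g • x₀ k = emb γ • dia k s • x₀ k := by
    have e : emb γ * dia k s = g * (g⁻¹ * emb γ * dia k s) := by group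
    rw [smul_smul, e, mul_smul, smul_x₀_of_mem h]
  set σ := Tuple.sort s
  refine ⟨-(s ∘ σ), (Tuple.monotone_sort s).neg, ?_⟩
  rw [hx, toQ_eq_iff]
  refine ⟨γ * (permGL σ)⁻¹, ?_⟩
  rw [dv, neg_neg, map_mul, map_inv, emb_permGL, mul_smul, inv_smul_eq_iff.2]
  rw [smul_smul, dia_mul_permGL, mul_smul, smul_x₀_of_mem (permGL_mem σ)]

end Poly

section Descent
variable {k : Type*} [Field k]

/-! ### Stabilizers in `Γ` -/

/-- The stabilizer of a diagonal vertex is the automorphism group of a sum of line bundles: its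
entries are polynomials of degree at most `a i - a j`. -/
theorem emb_smul_dv_eq_iff {γ : GL (Fin 3) k[X]} {a : Fin 3 → ℤ} :
    emb γ • dv k a = dv k a ↔
      ∀ i j, γ.1 i j ∈ Polynomial.degreeLT k (a i - a j + 1).toNat := by
  rw [dv, smul_smul, smul_x₀_eq_iff_of_vdet (by rw [vdet_mul, vdet_emb, zero_add]),
    smul_stdL_eq_smul_iff, mem_intGL_iff, and_iff_left (by simp [vdet_emb])]
  refine forall_congr' fun i => forall_congr' fun j => ?_
  rw [← unif_zpow_mul_polyEmb_mem_iff, ← dia_neg, neg_neg, ← mul_assoc, Units.val_mul,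
    mul_dia_apply, Units.val_mul, dia_mul_apply, emb_apply, mul_right_comm, ← Units.val_mul,
    ← zpow_add]
  rfl

/-- A class in `Γ` has a representative with entries of bounded degree, which determines it. -/
theorem exists_stabilizer_injective (a : Fin 3 → ℤ) :
    ∃ φ : MulAction.stabilizer (Gam k) (dv k a) → ∀ i j,
      Polynomial.degreeLT k (a i - a j + 1).toNat, Function.Injective φ := by
  have h : ∀ γ : MulAction.stabilizer (Gam k) (dv k a), ∃ γ' : GL (Fin 3) k[X],
      toGam γ' = γ.1 ∧ emb γ' • dv k a = dv k a := by
    intro γ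
    obtain ⟨γ', h⟩ := toGam_surjective γ.1
    exact ⟨γ', h, by rw [← toGam_smul, h]; exact γ.2⟩
  choose r hr hr' using h
  refine ⟨fun γ i j => ⟨(r γ).1 i j, emb_smul_dv_eq_iff.1 (hr' γ) i j⟩, fun γ γ' h => ?_⟩
  have : r γ = r γ' := by
    refine Units.ext (Matrix.ext fun i j => ?_)
    exact congrArg Subtype.val (congrFun (congrFun h i) j)
  exact Subtype.ext (by rw [← hr, ← hr, this])

instance finite_stabilizer [Finite k] (x : Vertex k) :
    Finite (MulAction.stabilizer (Gam k) x) := by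
  obtain ⟨a, -, h⟩ := exists_toQ_eq_dv x
  obtain ⟨φ, hφ⟩ := exists_stabilizer_injective (k := k) a
  have := Finite.of_injective φ hφ
  exact Finite.of_equiv _
    (MulAction.stabilizerEquivStabilizerOfOrbitRel (Quotient.exact h)).toEquiv.symm

theorem card_stabilizer_le [Finite k] (a : Fin 3 → ℤ) :
    Nat.card (MulAction.stabilizer (Gam k) (dv k a)) ≤
      Nat.card k ^ ∑ i, ∑ j, (a i - a j + 1).toNat := by
  obtain ⟨φ, hφ⟩ := exists_stabilizer_injective (k := k) a
  refine (Nat.card_le_card_of_injective φ hφ).trans ?_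
  simp only [Nat.card_pi, card_degreeLT, Finset.prod_pow_eq_pow_sum]
  exact le_rfl

/-- An upper triangular unipotent polynomial matrix. -/
def unipPoly (p q r : k[X]) : GL (Fin 3) k[X] :=
  Matrix.GeneralLinearGroup.mk'' !![1, p, r; 0, 1, q; 0, 0, 1] (by
    simp [Matrix.det_fin_three])

theorem toGam_unipPoly_injective {p q r p' q' r' : k[X]}
    (h : toGam (unipPoly p q r) = toGam (unipPoly p' q' r')) : p = p' ∧ q = q' ∧ r = r' := by
  have h1 := QuotientGroup.eq.1 (congrArg Subtype.val h)
  rw [Matrix.GeneralLinearGroup.center_eq_range_scalar] at h1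
  obtain ⟨s, hs⟩ := h1
  rw [eq_inv_mul_iff_mul_eq] at hs
  have h2 : ∀ i j, polyEmb k ((unipPoly p q r).1 i j) * s = polyEmb k ((unipPoly p' q' r').1 i j) := by
    intro i j
    rw [← emb_apply, ← emb_apply, ← hs, Units.val_mul, Matrix.GeneralLinearGroup.coe_scalar,
      Matrix.scalar_apply, Matrix.mul_diagonal]
  have h3 : (s : k⸨X⸩) = 1 := by
    have := h2 0 0
    simpa [unipPoly] using this
  rw [h3] at h2
  simp only [mul_one] at h2
  exact ⟨polyEmb_injective (h2 0 1), polyEmb_injective (h2 1 2), polyEmb_injective (h2 0 2)⟩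

/-- The unipotent matrices alone make the stabilizers large. -/
theorem le_card_stabilizer [Finite k] {a : Fin 3 → ℤ} (ha : Antitone a) :
    Nat.card k ^ (2 * (a 0 - a 2).toNat) ≤ Nat.card (MulAction.stabilizer (Gam k) (dv k a)) := by
  have h01 : a 1 ≤ a 0 := ha (by decide)
  have h12 : a 2 ≤ a 1 := ha (by decide)
  have hstab : ∀ p : Polynomial.degreeLT k (a 0 - a 1 + 1).toNat ×
      Polynomial.degreeLT k (a 1 - a 2 + 1).toNat × Polynomial.degreeLT k (a 0 - a 2 + 1).toNat,
      toGam (unipPoly p.1.1 p.2.1.1 p.2.2.1) ∈ MulAction.stabilizer (Gam k) (dv k a) := by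
    rintro ⟨⟨p, hp⟩, ⟨q, hq⟩, ⟨r, hr⟩⟩
    rw [MulAction.mem_stabilizer_iff, toGam_smul, emb_smul_dv_eq_iff]
    have h1 : (1 : k[X]) ∈ Polynomial.degreeLT k 1 := by
      rw [Polynomial.mem_degreeLT, Polynomial.degree_one]; norm_num
    intro i j
    fin_cases i <;> fin_cases j <;> simp [unipPoly] <;> assumption
  have hinj : Function.Injective fun p => (⟨_, hstab p⟩ : MulAction.stabilizer (Gam k) (dv k a)) := by
    rintro ⟨⟨p, hp⟩, ⟨q, hq⟩, ⟨r, hr⟩⟩ ⟨⟨p', hp'⟩, ⟨q', hq'⟩, ⟨r', hr'⟩⟩ h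
    obtain ⟨h1, h2, h3⟩ := toGam_unipPoly_injective (congrArg Subtype.val h)
    simp only at h1 h2 h3
    subst h1 h2 h3
    rfl
  refine le_trans ?_ (Nat.card_le_card_of_injective _ hinj)
  rw [Nat.card_prod, Nat.card_prod, card_degreeLT, card_degreeLT, card_degreeLT, ← pow_add,
    ← pow_add]
  exact Nat.pow_le_pow_right Nat.card_pos (by omega)

theorem weightConst_pos [Finite k] : 0 < weightConst k := by
  have : (1 : ℝ) < Nat.card k := by exact_mod_cast Finite.one_lt_card
  have h : 0 < (Nat.card k : ℝ) - 1 := by linarith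
  unfold weightConst
  positivity

theorem vertexWeight_toQ (x : Vertex k) : vertexWeight x.toQ =
    weightConst k / Nat.card (MulAction.stabilizer (Gam k) x) := rfl

theorem vertexWeight_dv_le [Finite k] {a : Fin 3 → ℤ} (ha : Antitone a) :
    vertexWeight (dv k a).toQ ≤ weightConst k / (Nat.card k : ℝ) ^ (2 * (a 0 - a 2).toNat) := by
  rw [vertexWeight_toQ]
  have h := le_card_stabilizer (k := k) ha
  have h0 : 0 < Nat.card k := Nat.card_pos
  have := weightConst_pos (k := k)
  gcongr
  exact_mod_cast h

theorem le_vertexWeight_dv [Finite k] (a : Fin 3 → ℤ) :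
    weightConst k / (Nat.card k : ℝ) ^ (∑ i, ∑ j, (a i - a j + 1).toNat) ≤
      vertexWeight (dv k a).toQ := by
  rw [vertexWeight_toQ]
  have h := card_stabilizer_le (k := k) a
  have h0 : 0 < Nat.card (MulAction.stabilizer (Gam k) (dv k a)) := Nat.card_pos
  have := weightConst_pos (k := k)
  gcongr
  exact_mod_cast h

/-! ### The weighted adjacency operators -/

theorem finite_neighbors [Finite k] (x : Vertex k) : {y | Adj x y}.Finite := by
  have := Fintype.ofFinite k
  obtain ⟨g, rfl⟩ := exists_smul_x₀ x
  refine ((Set.finite_range fun i : PIdx k => g • pl i • x₀ k).union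
    (Set.finite_range fun i : PIdx k => g • ln i • x₀ k)).subset ?_
  intro y hy
  rcases adj_smul_x₀_iff.1 hy with ⟨i, rfl⟩ | ⟨i, rfl⟩
  · exact Or.inl ⟨i, rfl⟩
  · exact Or.inr ⟨i, rfl⟩

/-- By the orbit-stabilizer theorem, the ratio of the weights counts the edges at a vertex that have
the same image in the quotient. -/
theorem ncard_orbit_edge [Finite k] (p : DirEdge k) :
    ((MulAction.orbit (MulAction.stabilizer (Gam k) p.1.1) p).ncard : ℝ) =
      edgeWeight p.toQ / vertexWeight p.1.1.toQ := by
  set H := MulAction.stabilizer (Gam k) p.1.1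
  have hle : MulAction.stabilizer (Gam k) p ≤ H := by
    intro γ hγ
    exact congrArg (fun e : DirEdge k => e.1.1) hγ
  have h1 : MulAction.stabilizer H p = (MulAction.stabilizer (Gam k) p).subgroupOf H := rfl
  have h2 := Subgroup.card_mul_index (MulAction.stabilizer H p)
  rw [MulAction.index_stabilizer, h1, Nat.card_congr (Subgroup.subgroupOfEquivOfLe hle).toEquiv] at h2
  have h3 : Nat.card H ≠ 0 := Nat.card_pos.ne'
  have h4 : (Nat.card (MulAction.stabilizer (Gam k) p) : ℝ) ≠ 0 := by
    intro h
    rw [Nat.cast_eq_zero] at h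
    rw [h, zero_mul] at h2
    exact h3 h2.symm
  have h5 : (Nat.card H : ℝ) ≠ 0 := by exact_mod_cast h3
  have h6 := (weightConst_pos (k := k)).ne'
  change _ = (weightConst k / Nat.card (MulAction.stabilizer (Gam k) p)) /
    (weightConst k / Nat.card H)
  have h7 : (Nat.card (MulAction.stabilizer (Gam k) p) : ℝ) *
      ((MulAction.orbit H p).ncard : ℝ) = Nat.card H := by exact_mod_cast h2
  field_simp
  linarith

theorem toQ_edge_eq_iff {p p' : DirEdge k} : p'.toQ = p.toQ ↔ ∃ γ : Gam k, γ • p = p' :=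
  Quotient.eq (r := MulAction.orbitRel (Gam k) (DirEdge k))

/-- The weighted adjacency operators are induced by the adjacency operators of the building. -/
theorem weightedAdj_toQ [Finite k] (j : ZMod 3) (f : QVertex k → ℂ) (x : Vertex k) :
    weightedAdj j f x.toQ = coloredAdj j (fun y => f y.toQ) x := by
  classical
  -- the edges from `x` to the neighbors over which `A_j` sums
  set S : Set (DirEdge k) := {p | p.1.1 = x ∧ color p.1.2 = color p.1.1 + j} with hS
  have hinj : Set.InjOn (fun p : DirEdge k => p.1.2) S := by
    rintro ⟨⟨a, b⟩, h⟩ ⟨h1, -⟩ ⟨⟨a', b'⟩, h'⟩ ⟨h2, -⟩ hb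
    simp only at h1 h2 hb
    subst h1 h2 hb
    rfl
  have himg : (fun p : DirEdge k => p.1.2) '' S = {y | Adj x y ∧ color y = color x + j} := by
    ext y
    constructor
    · rintro ⟨⟨⟨a, b⟩, h⟩, ⟨h1, h2⟩, rfl⟩
      simp only at h1 h2
      subst h1
      exact ⟨h, h2⟩
    · rintro ⟨h1, h2⟩
      exact ⟨⟨(x, y), h1⟩, ⟨rfl, h2⟩, rfl⟩
  have hfin : S.Finite := by
    refine Set.Finite.of_finite_image ?_ hinj
    rw [himg]
    exact (finite_neighbors x).subset fun y hy => hy.1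
  obtain ⟨F, hF⟩ := hfin.exists_finset_coe
  have hmem : ∀ p, p ∈ F ↔ p ∈ S := fun p => by rw [← Finset.mem_coe, hF]
  have hR : coloredAdj j (fun y => f y.toQ) x = ∑ p ∈ F, f (terminus p.toQ) := by
    rw [coloredAdj, ← himg, finsum_mem_image hinj, ← hF, finsum_mem_coe_finset]
    rfl
  have hT : {e : QEdge k | origin e = x.toQ ∧ EdgeColor j e} = (F.image DirEdge.toQ : Finset _) := by
    rw [Finset.coe_image, hF]
    ext e
    constructor
    · rintro ⟨h1, p, rfl, hp⟩
      obtain ⟨γ, hγ⟩ := toQ_eq_iff.1 h1.symm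
      refine ⟨toGam γ • p, ⟨(toGam_smul γ p.1.1).trans hγ, ?_⟩, toQ_edge_eq_iff.2 ⟨toGam γ, rfl⟩⟩
      change color (toGam γ • p.1.2) = color (toGam γ • p.1.1) + j
      rw [color_gam_smul, color_gam_smul, hp]
    · rintro ⟨p, ⟨h1, h2⟩, rfl⟩
      exact ⟨congrArg Vertex.toQ h1, p, rfl, h2⟩
  -- group the edges at `x` by their image in the quotient; each group is an orbit of the stabilizer
  -- of `x`, because `Γ` preserves colors
  rw [hR, Finset.sum_comp (fun e => f (terminus e)) DirEdge.toQ, weightedAdj, hT,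
    finsum_mem_coe_finset]
  refine Finset.sum_congr rfl fun e he => ?_
  obtain ⟨p, hp, rfl⟩ := Finset.mem_image.1 he
  rw [nsmul_eq_mul]
  congr 1
  obtain ⟨h1, h2⟩ := (hmem p).1 hp
  rw [← h1, ← ncard_orbit_edge, Complex.ofReal_natCast, ← Set.ncard_coe_finset]
  congr 2
  ext p'
  rw [Finset.mem_coe, Finset.mem_filter, hmem, toQ_edge_eq_iff]
  constructor
  · rintro ⟨γ, rfl⟩
    refine ⟨⟨?_, ?_⟩, γ.1, rfl⟩
    · exact γ.2.trans h1
    · change color (γ.1 • p.1.2) = color (γ.1 • p.1.1) + j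
      rw [color_gam_smul, color_gam_smul, h2]
  · rintro ⟨⟨h3, -⟩, γ, rfl⟩
    exact ⟨⟨γ, h3.trans h1.symm⟩, rfl⟩

end Descent

section Height

/-! ### The height of a vector at a vertex -/

theorem card_PIdx {k : Type*} [Fintype k] : Fintype.card (PIdx k) =
    Fintype.card k ^ 2 + Fintype.card k + 1 := by
  simp only [PIdx, Fintype.card_sum, Fintype.card_prod, Fintype.card_unit]
  ring

variable {k : Type*} [Field k]

/-- `IsHeight v x m`: the vertex `x` has a representative `L = g 𝒪³`, with `det g` of valuation
`-m`, such that `v` is in `L` but not in `t⁻¹ L`. -/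
def IsHeight (v : Fin 3 → k⸨X⸩) (x : Vertex k) (m : ℤ) : Prop :=
  ∃ g : GL (Fin 3) k⸨X⸩, x = g • x₀ k ∧ vdet g = -m ∧ v ∈ (g • stdL k).carrier ∧
    v ∉ ((g * scal k 1) • stdL k).carrier

theorem scal_one_smul : scal k 1 • stdL k = unif k • stdL k := by
  rw [scal_smul_stdL, zpow_one]

theorem mem_scal_smul_iff {g : GL (Fin 3) k⸨X⸩} {n : ℤ} {v : Fin 3 → k⸨X⸩} :
    v ∈ ((g * scal k n) • stdL k).carrier ↔
      ∀ i, ((unif k ^ (-n) : (k⸨X⸩)ˣ) : k⸨X⸩) * (g⁻¹.1.mulVec v) i ∈ valInt k := by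
  rw [mul_smul, mem_smul_iff, ← dia_const, mem_dia_smul]

/-- Divide by the highest power of `t⁻¹` possible. -/
theorem exists_isHeight {v : Fin 3 → k⸨X⸩} (hv : v ≠ 0) (x : Vertex k) : ∃ m, IsHeight v x m := by
  classical
  obtain ⟨g, rfl⟩ := exists_smul_x₀ x
  set w := g⁻¹.1.mulVec v with hw
  have hw0 : w ≠ 0 := by
    intro h
    apply hv
    have : g.1.mulVec w = v := by
      rw [hw, Matrix.mulVec_mulVec, ← Units.val_mul, mul_inv_cancel, Units.val_one,
        Matrix.one_mulVec]
    rw [← this, h, Matrix.mulVec_zero]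
  obtain ⟨j, hj, hmin⟩ := Finset.exists_min_image (Finset.univ.filter fun j => w j ≠ 0)
    (fun j => (w j).order) (by
      obtain ⟨j, hj⟩ := Function.ne_iff.1 hw0
      exact ⟨j, by simpa using hj⟩)
  simp only [Finset.mem_filter, Finset.mem_univ, true_and] at hj hmin
  refine ⟨-vdet (g * scal k (w j).order), g * scal k (w j).order, ?_, by rw [neg_neg], ?_, ?_⟩
  · rw [mul_smul, scal_smul_vertex]
  · rw [mem_scal_smul_iff]
    intro i
    rw [unif_zpow_mul_mem_iff]
    intro m hm
    by_cases hi : w i = 0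
    · rw [← hw, hi]; rfl
    · have := hmin i hi
      change (w i).coeff m = 0
      exact HahnSeries.coeff_eq_zero_of_lt_order (by omega)
  · rw [mul_assoc, ← scal_add, mem_scal_smul_iff]
    intro h
    have := unif_zpow_mul_mem_iff.1 (h j) (w j).order (by omega)
    exact HahnSeries.coeff_order_eq_zero.not.2 hj this

theorem scal_smul_le {g : GL (Fin 3) k⸨X⸩} {n : ℤ} (hn : 0 ≤ n) :
    ((g * scal k n) • stdL k).carrier ≤ (g • stdL k).carrier := by
  rw [mul_smul]
  refine smul_mono g (smul_stdL_le fun i j => ?_)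
  rw [← dia_const, dia_coe, Matrix.diagonal_apply]
  split_ifs
  · exact unif_zpow_mem hn
  · exact zero_mem _

theorem IsHeight.unique {v : Fin 3 → k⸨X⸩} {x : Vertex k} {m m' : ℤ} (h : IsHeight v x m)
    (h' : IsHeight v x m') : m = m' := by
  wlog hlt : m < m' generalizing m m'
  · rcases lt_trichotomy m m' with h1 | h1 | h1
    · exact absurd h1 hlt
    · exact h1
    · exact (this h' h h1).symm
  obtain ⟨g, hg, hd, h1, h2⟩ := h
  obtain ⟨g', hg', hd', h1', h2'⟩ := h'
  exfalso
  obtain ⟨n, κ, hκ, e⟩ := smul_x₀_eq_iff.1 (hg.symm.trans hg')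
  have hv : vdet g = vdet g' + 3 * n := by
    rw [e, vdet_mul, vdet_mul, vdet_scal, (mem_intGL_iff.1 hκ).2]; ring
  have hL : g • stdL k = (g' * scal k n) • stdL k := by
    rw [e, mul_smul, smul_stdL_eq_iff.2 hκ]
  apply h2'
  have h3 : g' * scal k n = g' * scal k 1 * scal k (n - 1) := by
    rw [mul_assoc, ← scal_add]; congr 2; ring
  rw [hL, h3] at h1
  exact scal_smul_le (by omega) h1

open Classical in
/-- The height of a nonzero vector at a vertex; it is `0` for the zero vector, which has none. -/
def height (v : Fin 3 → k⸨X⸩) (x : Vertex k) : ℤ :=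
  if h : ∃ m, IsHeight v x m then h.choose else 0

theorem IsHeight.height_eq {v : Fin 3 → k⸨X⸩} {x : Vertex k} {m : ℤ} (h : IsHeight v x m) :
    height v x = m := by
  have h' : ∃ m, IsHeight v x m := ⟨m, h⟩
  rw [height, dif_pos h']
  exact h'.choose_spec.unique h

theorem isHeight_height {v : Fin 3 → k⸨X⸩} (hv : v ≠ 0) (x : Vertex k) :
    IsHeight v x (height v x) := by
  obtain ⟨m, hm⟩ := exists_isHeight hv x
  rwa [hm.height_eq]

/-- The height is invariant under matrices of determinant a unit, in particular under `GL(3, k[t])`.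
-/
theorem height_mulVec {v : Fin 3 → k⸨X⸩} (hv : v ≠ 0) (x : Vertex k) {γ : GL (Fin 3) k⸨X⸩}
    (hγ : vdet γ = 0) : height (γ.1.mulVec v) (γ • x) = height v x := by
  obtain ⟨g, hg, hd, h1, h2⟩ := isHeight_height hv x
  refine IsHeight.height_eq ⟨γ * g, by rw [mul_smul, ← hg], by rw [vdet_mul, hγ, hd, zero_add],
    ?_, ?_⟩
  · rw [mul_smul]
    exact ⟨v, h1, rfl⟩
  · rw [mul_assoc, mul_smul]
    rintro ⟨w, hw, hwv⟩
    exact h2 (matAct_injective γ hwv ▸ hw)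

/-- The effect on the height of passing to a neighboring vertex. -/
theorem height_neighbor {g h : GL (Fin 3) k⸨X⸩} {v : Fin 3 → k⸨X⸩}
    (hle : (h • stdL k).carrier ≤ (stdL k).carrier)
    (hle' : (scal k 1 • stdL k).carrier ≤ (h • stdL k).carrier)
    (hv : v ∈ (g • stdL k).carrier) (hv' : v ∉ ((g * scal k 1) • stdL k).carrier) :
    (g⁻¹.1.mulVec v ∈ (h • stdL k).carrier → height v (g • h • x₀ k) = -vdet g - vdet h) ∧
    (g⁻¹.1.mulVec v ∉ (h • stdL k).carrier → height v (g • h • x₀ k) = -vdet g - vdet h + 3) := by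
  constructor
  · intro hw
    refine IsHeight.height_eq ⟨g * h, by rw [mul_smul], by rw [vdet_mul]; ring, ?_, ?_⟩
    · rw [mul_smul, mem_smul_iff]; exact hw
    · intro hmem
      apply hv'
      rw [mul_smul]
      refine smul_mono g (L := scal k 1 • h • stdL k) ?_ ?_
      · exact smul_mono _ hle
      · rwa [smul_smul, smul_smul, mul_assoc, scal_comm, ← mul_assoc]
  · intro hw
    refine IsHeight.height_eq ⟨g * h * scal k (-1), ?_, ?_, ?_, ?_⟩
    · rw [mul_smul, scal_smul_vertex, mul_smul]
    · rw [vdet_mul, vdet_mul, vdet_scal]; ring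
    · have e : g * h * scal k (-1) = g * scal k (-1) * h := by
        rw [mul_assoc, ← scal_comm, ← mul_assoc]
      rw [e, mul_smul]
      refine smul_mono (g * scal k (-1)) hle' ?_
      rwa [smul_smul, mul_assoc, ← scal_add, neg_add_cancel, scal_zero, mul_one]
    · rw [mul_assoc, ← scal_add, neg_add_cancel, scal_zero, mul_one, mul_smul, mem_smul_iff]
      exact hw

theorem red_ne_zero {g : GL (Fin 3) k⸨X⸩} {v : Fin 3 → k⸨X⸩}
    (hv : v ∈ (g • stdL k).carrier) (hv' : v ∉ ((g * scal k 1) • stdL k).carrier) :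
    red (g⁻¹.1.mulVec v) ≠ 0 := by
  intro h
  apply hv'
  rw [mul_smul, mem_smul_iff, scal_one_smul, mem_unif_smul_stdL]
  exact ⟨mem_stdL.1 (mem_smul_iff.1 hv), h⟩

theorem pl_between (i : PIdx k) : (pl i • stdL k).carrier ≤ (stdL k).carrier ∧
    (scal k 1 • stdL k).carrier ≤ (pl i • stdL k).carrier := by
  refine ⟨fun v hv => mem_stdL.2 (mem_pl.1 hv).1, fun v hv => mem_pl.2 ?_⟩
  rw [scal_one_smul, mem_unif_smul_stdL] at hv
  refine ⟨hv.1, ?_⟩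
  rw [hv.2]
  rcases i with _ | _ | _ <;> simp [plForm]

theorem ln_between (i : PIdx k) : (ln i • stdL k).carrier ≤ (stdL k).carrier ∧
    (scal k 1 • stdL k).carrier ≤ (ln i • stdL k).carrier := by
  refine ⟨fun v hv => mem_stdL.2 (mem_ln.1 hv).1, fun v hv => mem_ln.2 ?_⟩
  rw [scal_one_smul, mem_unif_smul_stdL] at hv
  refine ⟨hv.1, ?_⟩
  rw [hv.2]
  rcases i with _ | _ | _ <;> simp [lnMem]

open Classical in
/-- A nonzero vector of `k³` lies in `q + 1` planes. -/
theorem card_plForm_eq_zero [Fintype k] {w : Fin 3 → k} (hw : w ≠ 0) :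
    (Finset.univ.filter fun i : PIdx k => plForm i w = 0).card = Fintype.card k + 1 := by
  have hone : ∀ u v : k, v ≠ 0 → ∑ b : k, (if u + b * v = 0 then 1 else 0 : ℕ) = 1 := by
    intro u v hv
    rw [Finset.sum_eq_single (-u / v)]
    · rw [if_pos]; field_simp; ring
    · intro b _ hb
      rw [if_neg]
      intro h
      apply hb
      field_simp
      linear_combination h
    · simp
  rw [Finset.card_filter, Fintype.sum_sum_type, Fintype.sum_sum_type, Fintype.sum_prod_type]
  by_cases h2 : w 2 = 0
  · by_cases h1 : w 1 = 0
    · have h0 : w 0 ≠ 0 := by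
        intro h0
        apply hw
        ext i
        fin_cases i <;> assumption
      simp [plForm, h0, h1, h2]
    · simp only [plForm, h2, mul_zero, add_zero]
      rw [Finset.sum_comm]
      simp only [hone _ _ h1]
      simp [h1]
  · have e1 : ∀ a : k, ∑ b : k, (if plForm (.inl (a, b)) w = 0 then 1 else 0 : ℕ) = 1 := fun a =>
      hone (w 0 + a * w 1) (w 2) h2
    have e2 : ∑ c : k, (if plForm (.inr (.inl c)) w = 0 then 1 else 0 : ℕ) = 1 :=
      hone (w 1) (w 2) h2
    simp only [e1, e2]
    simp [plForm, h2]

open Classical in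
/-- Summing over the neighbors of one color a function of the height. -/
theorem sum_height_pl [Fintype k] (φ : ℤ → ℂ) {v : Fin 3 → k⸨X⸩} (hv : v ≠ 0)
    {g : GL (Fin 3) k⸨X⸩} :
    ∑ i : PIdx k, φ (height v (g • pl i • x₀ k)) =
      (Fintype.card k + 1) * φ (height v (g • x₀ k) - 1) +
        (Fintype.card k : ℂ) ^ 2 * φ (height v (g • x₀ k) + 2) := by
  obtain ⟨g', hg, hd, h1, h2⟩ := isHeight_height hv (g • x₀ k)
  have e : ∑ i : PIdx k, φ (height v (g • pl i • x₀ k)) =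
      ∑ i : PIdx k, φ (height v (g' • pl i • x₀ k)) := by
    rw [← coloredAdj_one (fun x => φ (height v x)), ← coloredAdj_one (fun x => φ (height v x)), hg]
  set w := red (g'⁻¹.1.mulVec v) with hw
  have hw0 : w ≠ 0 := red_ne_zero h1 h2
  have hterm : ∀ i : PIdx k, φ (height v (g' • pl i • x₀ k)) =
      if plForm i w = 0 then φ (height v (g • x₀ k) - 1) else φ (height v (g • x₀ k) + 2) := by
    intro i
    have h3 := height_neighbor (pl_between i).1 (pl_between i).2 h1 h2
    rw [mem_pl, and_iff_right (mem_stdL.1 (mem_smul_iff.1 h1)), vdet_pl, hd] at h3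
    split_ifs with hi
    · rw [h3.1 hi, neg_neg]
    · rw [h3.2 hi, neg_neg]; congr 1; ring
  rw [e, Finset.sum_congr rfl fun i _ => hterm i, Finset.sum_ite, Finset.sum_const,
    Finset.sum_const, card_plForm_eq_zero hw0, Finset.filter_not, Finset.card_sdiff_of_subset
    (Finset.filter_subset _ _), card_plForm_eq_zero hw0, Finset.card_univ, card_PIdx,
    nsmul_eq_mul, nsmul_eq_mul, add_assoc, Nat.add_sub_cancel]
  push_cast
  ring

open Classical in
/-- The same for the other color: a nonzero vector of `k³` lies in one line. -/
theorem sum_height_ln [Fintype k] (φ : ℤ → ℂ) {v : Fin 3 → k⸨X⸩} (hv : v ≠ 0)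
    {g : GL (Fin 3) k⸨X⸩} :
    ∑ i : PIdx k, φ (height v (g • ln i • x₀ k)) =
      1 * φ (height v (g • x₀ k) - 2) +
        ((Fintype.card k : ℂ) ^ 2 + Fintype.card k) * φ (height v (g • x₀ k) + 1) := by
  obtain ⟨g', hg, hd, h1, h2⟩ := isHeight_height hv (g • x₀ k)
  have e : ∑ i : PIdx k, φ (height v (g • ln i • x₀ k)) =
      ∑ i : PIdx k, φ (height v (g' • ln i • x₀ k)) := by
    rw [← coloredAdj_two (fun x => φ (height v x)), ← coloredAdj_two (fun x => φ (height v x)), hg]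
  set w := red (g'⁻¹.1.mulVec v) with hw
  have hw0 : w ≠ 0 := red_ne_zero h1 h2
  obtain ⟨i₀, hi₀, huniq⟩ := exists_lnMem hw0
  have hterm : ∀ i : PIdx k, φ (height v (g' • ln i • x₀ k)) =
      if i = i₀ then φ (height v (g • x₀ k) - 2) else φ (height v (g • x₀ k) + 1) := by
    intro i
    have h3 := height_neighbor (ln_between i).1 (ln_between i).2 h1 h2
    rw [mem_ln, and_iff_right (mem_stdL.1 (mem_smul_iff.1 h1)), vdet_ln, hd] at h3
    split_ifs with hi
    · rw [h3.1 (hi ▸ hi₀), neg_neg]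
    · rw [h3.2 (fun h => hi (huniq i h)), neg_neg]; congr 1; ring
  rw [e, Finset.sum_congr rfl fun i _ => hterm i, Finset.sum_ite, Finset.sum_const,
    Finset.sum_const, Finset.filter_not, Finset.card_sdiff_of_subset
    (Finset.filter_subset _ _), Finset.filter_eq', if_pos (Finset.mem_univ _),
    Finset.card_singleton, Finset.card_univ, card_PIdx,
    nsmul_eq_mul, nsmul_eq_mul, Nat.add_sub_cancel]
  push_cast
  ring

end Height

section Eisenstein
variable {k : Type*} [Field k]

/-! ### Incomplete Eisenstein series -/

variable (k) in
/-- The primitive (unimodular) vectors of `k[t]³`. -/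
def primVec : Set (Fin 3 → k[X]) := {v | ∃ w : Fin 3 → k[X], w ⬝ᵥ v = 1}

/-- The image in `k((t⁻¹))³` of a vector of polynomials. -/
def pv (v : Fin 3 → k[X]) : Fin 3 → k⸨X⸩ := fun i => polyEmb k (v i)

theorem pv_ne_zero {v : Fin 3 → k[X]} (hv : v ∈ primVec k) : pv v ≠ 0 := by
  rintro h
  obtain ⟨w, hw⟩ := hv
  have : v = 0 := funext fun i => polyEmb_injective (by
    have := congrFun h i
    rwa [pv, Pi.zero_apply, ← map_zero (polyEmb k)] at this)
  rw [this, dotProduct_zero] at hw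
  exact zero_ne_one hw

theorem pv_mulVec (γ : GL (Fin 3) k[X]) (v : Fin 3 → k[X]) :
    pv (γ.1.mulVec v) = (emb γ).1.mulVec (pv v) := by
  ext1 i
  simp only [pv, Matrix.mulVec, dotProduct, map_sum, map_mul]
  rfl

theorem mulVec_mem_primVec (γ : GL (Fin 3) k[X]) {v : Fin 3 → k[X]} (hv : v ∈ primVec k) :
    γ.1.mulVec v ∈ primVec k := by
  obtain ⟨w, hw⟩ := hv
  refine ⟨Matrix.vecMul w γ⁻¹.1, ?_⟩
  rw [← Matrix.dotProduct_mulVec, Matrix.mulVec_mulVec, ← Units.val_mul, inv_mul_cancel,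
    Units.val_one, Matrix.one_mulVec, hw]

/-- The action of a polynomial matrix on the primitive vectors. -/
def primEquiv (γ : GL (Fin 3) k[X]) : primVec k ≃ primVec k where
  toFun v := ⟨γ.1.mulVec v.1, mulVec_mem_primVec γ v.2⟩
  invFun v := ⟨γ⁻¹.1.mulVec v.1, mulVec_mem_primVec γ⁻¹ v.2⟩
  left_inv v := Subtype.ext (by
    change γ⁻¹.1.mulVec (γ.1.mulVec v.1) = v.1
    rw [Matrix.mulVec_mulVec, ← Units.val_mul, inv_mul_cancel, Units.val_one, Matrix.one_mulVec])
  right_inv v := Subtype.ext (by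
    change γ.1.mulVec (γ⁻¹.1.mulVec v.1) = v.1
    rw [Matrix.mulVec_mulVec, ← Units.val_mul, mul_inv_cancel, Units.val_one, Matrix.one_mulVec])

/-- The incomplete Eisenstein series of a function of the height: the sum of its values at the
heights of all primitive vectors. -/
def eis (φ : ℤ → ℂ) (x : Vertex k) : ℂ := ∑ᶠ v : primVec k, φ (height (pv v.1) x)

theorem eis_emb_smul (φ : ℤ → ℂ) (γ : GL (Fin 3) k[X]) (x : Vertex k) :
    eis φ (emb γ • x) = eis φ x := by
  rw [eis, eis, ← finsum_comp_equiv (primEquiv γ)]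
  refine finsum_congr fun v => ?_
  change φ (height (pv (γ.1.mulVec v.1)) _) = _
  rw [pv_mulVec, height_mulVec (pv_ne_zero v.2) x (vdet_emb γ)]

/-- The incomplete Eisenstein series, as a function on the quotient. -/
def eisQ (φ : ℤ → ℂ) : QVertex k → ℂ :=
  Quotient.lift (eis φ) (by
    intro x y h
    obtain ⟨γ, rfl⟩ := toQ_eq_iff.1 (Quotient.sound h)
    exact eis_emb_smul φ γ y)

theorem eisQ_toQ (φ : ℤ → ℂ) (x : Vertex k) : eisQ φ x.toQ = eis φ x := rfl

theorem isHeight_iff {g : GL (Fin 3) k⸨X⸩} {m : ℤ} (hg : vdet g = -m) {v : Fin 3 → k⸨X⸩} :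
    IsHeight v (g • x₀ k) m ↔ v ∈ (g • stdL k).carrier ∧ v ∉ ((g * scal k 1) • stdL k).carrier := by
  constructor
  · rintro ⟨g', hg', hd, h1, h2⟩
    have e := (smul_x₀_eq_iff_of_vdet (hg.trans hd.symm)).1 hg'
    rw [← scal_comm, mul_smul] at h2 ⊢
    rw [e]
    exact ⟨h1, h2⟩
  · rintro ⟨h1, h2⟩
    exact ⟨g, rfl, hg, h1, h2⟩

/-- Polynomials are discrete in `k((t⁻¹))`: a lattice contains only finitely many polynomial
vectors. -/
theorem finite_mem_smul_stdL [Finite k] (g : GL (Fin 3) k⸨X⸩) :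
    {v : Fin 3 → k[X] | pv v ∈ (g • stdL k).carrier}.Finite := by
  obtain ⟨n, hn⟩ := exists_scal_mul_integral g
  have h : ∀ v ∈ {v : Fin 3 → k[X] | pv v ∈ (g • stdL k).carrier}, ∀ i,
      v i ∈ Polynomial.degreeLT k (n + 1).toNat := by
    intro v hv i
    rw [← unif_zpow_mul_polyEmb_mem_iff]
    obtain ⟨w, hw, hwv⟩ := hv
    have h1 := mulVec_mem_std hn (mem_stdL.1 hw) i
    rw [Units.val_mul, ← Matrix.mulVec_mulVec, ← matAct_apply g, hwv, scal_coe,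
      Matrix.scalar_apply, Matrix.mulVec_diagonal] at h1
    exact h1
  refine Set.Finite.subset (Set.finite_range fun (c : Fin 3 → Polynomial.degreeLT k (n + 1).toNat)
    i => (c i).1) fun v hv => ⟨fun i => ⟨v i, h v hv i⟩, rfl⟩

theorem finite_height_eq [Finite k] (x : Vertex k) (m : ℤ) :
    {v : primVec k | height (pv v.1) x = m}.Finite := by
  by_cases hx : ∃ g : GL (Fin 3) k⸨X⸩, x = g • x₀ k ∧ vdet g = -m
  · obtain ⟨g, rfl, hg⟩ := hx
    refine Set.Finite.of_finite_image ((finite_mem_smul_stdL g).subset ?_)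
      Subtype.val_injective.injOn
    rintro _ ⟨v, hv, rfl⟩
    have h := isHeight_height (pv_ne_zero v.2) (g • x₀ k)
    rw [show height (pv v.1) (g • x₀ k) = m from hv, isHeight_iff hg] at h
    exact h.1
  · convert Set.finite_empty
    rw [Set.eq_empty_iff_forall_notMem]
    intro v hv
    obtain ⟨g, h1, h2, -⟩ := isHeight_height (pv_ne_zero v.2) x
    exact hx ⟨g, h1, by rw [h2, show height (pv v.1) x = m from hv]⟩

theorem finite_support_height [Finite k] {φ : ℤ → ℂ} (hφ : φ.support.Finite) (x : Vertex k) :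
    (Function.support fun v : primVec k => φ (height (pv v.1) x)).Finite := by
  refine (hφ.biUnion fun m _ => finite_height_eq x m).subset fun v hv => ?_
  exact Set.mem_biUnion (x := height (pv v.1) x) hv rfl

theorem eis_smul (c : ℂ) (φ : ℤ → ℂ) (x : Vertex k) : eis (c • φ) x = c * eis φ x := by
  rw [eis, eis, ← smul_eq_mul, smul_finsum]
  rfl

theorem eis_eq_sum [Finite k] {φ : ℤ → ℂ} {s : Finset ℤ} (hφ : ∀ m ∉ s, φ m = 0) (x : Vertex k) :
    eis φ x = ∑ m ∈ s, φ m * eis (Pi.single m 1) x := by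
  have h : ∀ m, φ m * eis (Pi.single m 1) x =
      ∑ᶠ v : primVec k, φ m * (Pi.single m 1 : ℤ → ℂ) (height (pv v.1) x) := by
    intro m
    rw [eis, ← smul_eq_mul, smul_finsum]
    rfl
  simp only [h]
  rw [← finsum_sum_comm, eis]
  · refine finsum_congr fun v => ?_
    by_cases hv : height (pv v.1) x ∈ s
    · rw [Finset.sum_eq_single _ _ fun h => absurd hv h]
      · simp
      · intro m _ hm
        rw [Pi.single_eq_of_ne hm.symm, mul_zero]
    · rw [hφ _ hv, eq_comm]
      refine Finset.sum_eq_zero fun m hm => ?_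
      rw [Pi.single_eq_of_ne (fun h => hv (by rwa [h])), mul_zero]
  · intro m _
    refine (finite_height_eq x m).subset fun v hv => ?_
    by_contra hne
    exact hv (by simp only [Pi.single_eq_of_ne (show height (pv v.1) x ≠ m from hne), mul_zero])

/-- The operator on functions of the height corresponding to a sum over neighbors. -/
def shiftOp (c₁ c₂ : ℂ) (s₁ s₂ : ℤ) (φ : ℤ → ℂ) (m : ℤ) : ℂ := c₁ * φ (m + s₁) + c₂ * φ (m + s₂)

/-- The adjacency operator acts on incomplete Eisenstein series through shifts of the height. -/
theorem coloredAdj_one_eis [Fintype k] {φ : ℤ → ℂ} (hφ : φ.support.Finite) :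
    coloredAdj 1 (eis (k := k) φ) =
      eis (shiftOp (Fintype.card k + 1) ((Fintype.card k : ℂ) ^ 2) (-1) 2 φ) := by
  funext x
  obtain ⟨g, rfl⟩ := exists_smul_x₀ x
  rw [coloredAdj_one]
  simp only [eis]
  rw [← finsum_sum_comm _ _ fun i _ => finite_support_height hφ _]
  exact finsum_congr fun v => sum_height_pl φ (pv_ne_zero v.2)

theorem coloredAdj_two_eis [Fintype k] {φ : ℤ → ℂ} (hφ : φ.support.Finite) :
    coloredAdj 2 (eis (k := k) φ) =
      eis (shiftOp 1 ((Fintype.card k : ℂ) ^ 2 + Fintype.card k) (-2) 1 φ) := by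
  funext x
  obtain ⟨g, rfl⟩ := exists_smul_x₀ x
  rw [coloredAdj_two]
  simp only [eis]
  rw [← finsum_sum_comm _ _ fun i _ => finite_support_height hφ _]
  exact finsum_congr fun v => sum_height_ln φ (pv_ne_zero v.2)

theorem weightedAdj_one_eisQ [Fintype k] {φ : ℤ → ℂ} (hφ : φ.support.Finite) :
    weightedAdj 1 (eisQ (k := k) φ) =
      eisQ (shiftOp (Fintype.card k + 1) ((Fintype.card k : ℂ) ^ 2) (-1) 2 φ) := by
  funext u
  obtain ⟨x, rfl⟩ := toQ_surjective u
  rw [weightedAdj_toQ, eisQ_toQ, ← coloredAdj_one_eis hφ]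
  rfl

theorem weightedAdj_neg_one_eisQ [Fintype k] {φ : ℤ → ℂ} (hφ : φ.support.Finite) :
    weightedAdj (-1) (eisQ (k := k) φ) =
      eisQ (shiftOp 1 ((Fintype.card k : ℂ) ^ 2 + Fintype.card k) (-2) 1 φ) := by
  funext u
  obtain ⟨x, rfl⟩ := toQ_surjective u
  rw [weightedAdj_toQ, eisQ_toQ, ← coloredAdj_two_eis hφ]
  rfl

/-! ### Values at the diagonal vertices -/

theorem dv_add_const (a : Fin 3 → ℤ) (n : ℤ) : dv k (a + fun _ => n) = dv k a := by
  rw [dv, neg_add, dia_add, mul_smul, show -(fun _ : Fin 3 => n) = fun _ => -n from rfl, dia_const,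
    scal_smul_vertex, dv]

/-- A polynomial vector is primitive in `t^(a 0) 𝒪 ⊕ t^(a 1) 𝒪 ⊕ t^(a 2) 𝒪` when its entries have
degree at most `a i`, with equality somewhere. -/
theorem isHeight_dv_iff {a : Fin 3 → ℤ} {v : Fin 3 → k[X]} :
    IsHeight (pv v) (dv k a) (∑ i, a i) ↔ (∀ i, v i ∈ Polynomial.degreeLT k (a i + 1).toNat) ∧
      ∃ i, v i ∉ Polynomial.degreeLT k (a i).toNat := by
  rw [dv, isHeight_iff (by simp), ← dia_const, ← dia_add, mem_dia_smul, mem_dia_smul, not_forall]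
  refine and_congr (forall_congr' fun i => ?_) (exists_congr fun i => not_congr ?_)
  · rw [← unif_zpow_mul_polyEmb_mem_iff, Pi.neg_apply, neg_neg]; rfl
  · have h := unif_zpow_mul_polyEmb_mem_iff (n := a i - 1) (p := v i)
    rw [sub_add_cancel] at h
    rw [← h, Pi.add_apply, Pi.neg_apply, show -(-a i + 1) = a i - 1 by ring]; rfl

/-- If some primitive vector has height `m` at the diagonal vertex, its exponents may be taken
of sum `m`. -/
theorem exists_dv_eq_of_isHeight {a : Fin 3 → ℤ} {v : Fin 3 → k⸨X⸩} {m : ℤ}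
    (h : IsHeight v (dv k a) m) : ∃ n : ℤ, ∑ i, (a + fun _ => n : Fin 3 → ℤ) i = m := by
  obtain ⟨g, hg, hd, -⟩ := h
  obtain ⟨n, κ, hκ, e⟩ := smul_x₀_eq_iff.1 hg
  have hv := congrArg vdet e
  rw [vdet_mul, vdet_mul, vdet_scal, (mem_intGL_iff.1 hκ).2, hd, vdet_dia] at hv
  refine ⟨n, ?_⟩
  simp only [Pi.neg_apply, Fin.sum_univ_three, Pi.add_apply] at hv ⊢
  omega

theorem mem_primVec_single {p : k[X]} (h : ![p, 0, 0] ∈ primVec k) : IsUnit p := by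
  obtain ⟨w, hw⟩ := h
  refine IsUnit.of_mul_eq_one (w 0) ?_
  simpa [dotProduct, Fin.sum_univ_three, mul_comm] using hw

end Eisenstein

section Norms
variable {k : Type*} [Field k]

/-! ### Norms of incomplete Eisenstein series -/

theorem eq_zero_of_mem_degreeLT {p : k[X]} {n : ℤ} (hn : n < 0)
    (h : p ∈ Polynomial.degreeLT k (n + 1).toNat) : p = 0 := by
  rw [show (n + 1).toNat = 0 by omega, Polynomial.mem_degreeLT,
    Polynomial.degree_lt_iff_coeff_zero] at h
  exact Polynomial.ext fun i => h i i.zero_le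

/-- A negative height forces the last entry of the primitive vectors to vanish; the others have
bounded degree. -/
theorem norm_eis_single_le [Fintype k] {a : Fin 3 → ℤ} {m : ℤ} (ha : Antitone a)
    (hm : ∑ i, a i = m) (hneg : m < 0) : ‖eis (k := k) (Pi.single m 1) (dv k a)‖ ≤
      (Fintype.card k : ℝ) ^ ((a 0 + 1).toNat + (a 1 + 1).toNat) := by
  obtain ⟨F, hF⟩ := (finite_height_eq (dv k a) m).exists_finset_coe
  have hmem : ∀ v, v ∈ F ↔ height (pv v.1) (dv k a) = m := fun v => by
    rw [← Finset.mem_coe, hF]; rfl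
  have h1 : eis (k := k) (Pi.single m 1) (dv k a) = F.card := by
    rw [eis, finsum_eq_sum_of_support_subset (s := F)]
    · rw [Finset.sum_congr rfl fun v hv => by rw [(hmem v).1 hv, Pi.single_eq_same]]
      simp
    · intro v hv
      rw [Finset.mem_coe, hmem]
      by_contra hne
      exact hv (Pi.single_eq_of_ne hne _)
  have h2 : a 2 < 0 := by
    have h01 : a 1 ≤ a 0 := ha (by decide)
    have h12 : a 2 ≤ a 1 := ha (by decide)
    rw [Fin.sum_univ_three] at hm
    omega
  have hdeg : ∀ v : F, ∀ i, v.1.1 i ∈ Polynomial.degreeLT k (a i + 1).toNat := by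
    intro v
    have h := isHeight_height (pv_ne_zero v.1.2) (dv k a)
    rw [(hmem v.1).1 v.2, ← hm] at h
    exact (isHeight_dv_iff.1 h).1
  have hinj : Function.Injective fun v : F =>
      ((⟨_, hdeg v 0⟩, ⟨_, hdeg v 1⟩) : Polynomial.degreeLT k (a 0 + 1).toNat ×
        Polynomial.degreeLT k (a 1 + 1).toNat) := by
    intro v w h
    have e2 : ∀ v : F, v.1.1 2 = 0 := fun v => eq_zero_of_mem_degreeLT h2 (hdeg v 2)
    refine Subtype.ext (Subtype.ext (funext fun i => ?_))
    fin_cases i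
    · exact congrArg (fun p => p.1.1) h
    · exact congrArg (fun p => p.2.1) h
    · exact (e2 v).trans (e2 w).symm
  have h3 := Nat.card_le_card_of_injective _ hinj
  rw [Nat.card_eq_finsetCard, Nat.card_prod, card_degreeLT, card_degreeLT, ← pow_add,
    Nat.card_eq_fintype_card] at h3
  rw [h1, Complex.norm_natCast]
  exact_mod_cast h3

/-- Once the exponents have sum `m`, the largest one bounds the degree of a nonzero polynomial
vector, hence is nonnegative. -/
theorem exists_of_eisQ_single_ne_zero {m : ℤ} {u : QVertex k}
    (h : eisQ (Pi.single m 1) u ≠ 0) :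
    ∃ a : Fin 3 → ℤ, Antitone a ∧ ∑ i, a i = m ∧ 0 ≤ a 0 ∧ u = (dv k a).toQ := by
  obtain ⟨x, rfl⟩ := toQ_surjective u
  obtain ⟨a, ha, hx⟩ := exists_toQ_eq_dv x
  rw [hx] at h ⊢
  obtain ⟨v, hv⟩ : ∃ v : primVec k, height (pv v.1) (dv k a) = m := by
    by_contra hcon
    push Not at hcon
    refine h ?_
    rw [eisQ_toQ, eis]
    exact finsum_eq_zero_of_forall_eq_zero fun v => Pi.single_eq_of_ne (hcon v) _
  have hh := isHeight_height (pv_ne_zero v.2) (dv k a)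
  rw [hv] at hh
  obtain ⟨n, hn⟩ := exists_dv_eq_of_isHeight hh
  refine ⟨a + fun _ => n, fun i j hij => by simpa using ha hij, hn, ?_, by rw [dv_add_const]⟩
  rw [← hn, ← dv_add_const a n, isHeight_dv_iff] at hh
  by_contra hneg
  have h1 : ∀ i, a i ≤ a 0 := fun i => ha (Fin.zero_le i)
  refine pv_ne_zero v.2 (funext fun i => ?_)
  have h5 : v.1 i = 0 := eq_zero_of_mem_degreeLT (by
    have := h1 i
    simp only [Pi.add_apply] at hneg ⊢
    omega) (hh.1 i)
  rw [pv, h5, map_zero]; rfl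

variable (k) in
/-- Twice the double geometric series of ratio `1 / q`. -/
def geomSum [Fintype k] : ℝ≥0∞ :=
  ∑' t : Bool × ℕ × ℕ, (Fintype.card k : ℝ≥0∞)⁻¹ ^ t.2.1 * (Fintype.card k : ℝ≥0∞)⁻¹ ^ t.2.2

theorem geomSum_ne_top [Fintype k] : geomSum k ≠ ⊤ := by
  have hq : (Fintype.card k : ℝ≥0∞)⁻¹ < 1 := by
    rw [ENNReal.inv_lt_one]
    exact_mod_cast Fintype.one_lt_card
  have h : (1 - (Fintype.card k : ℝ≥0∞)⁻¹)⁻¹ ≠ ⊤ := by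
    rw [ENNReal.inv_ne_top]
    exact (tsub_pos_of_lt hq).ne'
  rw [geomSum]
  simp only [ENNReal.tsum_prod', ENNReal.tsum_mul_left, ENNReal.tsum_mul_right,
    ENNReal.tsum_geometric, tsum_fintype, Finset.sum_const, Finset.card_univ, nsmul_eq_mul]
  finiteness

/-- The stabilizers of the vertices that carry the series outgrow the number of primitive vectors of
height `m`, which leaves a double geometric series. -/
theorem wNorm_eisQ_single_sq_le [Fintype k] {m : ℤ} (hneg : m < 0) :
    wNorm (vertexWeight (k := k)) (eisQ (Pi.single m 1)) ^ 2 ≤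
      ENNReal.ofReal (weightConst k * (Fintype.card k : ℝ) ^ (4 + m)) * geomSum k := by
  set Q : ℝ := (Fintype.card k : ℝ) with hQ
  have hQ1 : 1 < Q := by rw [hQ]; exact_mod_cast Fintype.one_lt_card
  have hQ0 : 0 < Q := by linarith
  have hwc := weightConst_pos (k := k)
  set S := Function.support (eisQ (k := k) (Pi.single m 1)) with hS
  choose a ha hsum hpos hu using fun u : S => exists_of_eisQ_single_ne_zero u.2
  -- the exponents have a fixed sum, so the largest one together with the middle one, or with its distance
  -- to the smallest one when it is negative, determines all three
  let J : S → Bool × ℕ × ℕ := fun u =>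
    if a u 1 < 0 then (true, (a u 0).toNat, (a u 1 - a u 2).toNat)
    else (false, (a u 0).toNat, (a u 1).toNat)
  have hJ : Function.Injective J := by
    intro u u' h
    have e : a u = a u' := by
      have h1 := hsum u
      have h2 := hsum u'
      have h3 := hpos u
      have h4 := hpos u'
      have h5 : a u 2 ≤ a u 1 := ha u (by decide)
      have h6 : a u' 2 ≤ a u' 1 := ha u' (by decide)
      rw [Fin.sum_univ_three] at h1 h2
      have h7 : a u 0 = a u' 0 ∧ a u 1 = a u' 1 ∧ a u 2 = a u' 2 := by
        simp only [J] at h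
        split_ifs at h <;> simp only [Prod.mk.injEq, true_and, false_and, reduceCtorEq] at h <;>
          omega
      funext i
      fin_cases i
      exacts [h7.1, h7.2.1, h7.2.2]
    apply Subtype.ext
    rw [hu, hu u', e]
  have hterm : ∀ u : S, ENNReal.ofReal (vertexWeight u.1) * ‖eisQ (k := k) (Pi.single m 1) u.1‖ₑ ^ 2 ≤
      ENNReal.ofReal (weightConst k * Q ^ (4 + m)) *
        ((Fintype.card k : ℝ≥0∞)⁻¹ ^ (J u).2.1 * (Fintype.card k : ℝ≥0∞)⁻¹ ^ (J u).2.2) := by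
    intro u
    have h1 := hsum u
    have h3 := hpos u
    have h5 : a u 2 ≤ a u 1 := ha u (by decide)
    have h6 : a u 1 ≤ a u 0 := ha u (by decide)
    have hw : vertexWeight u.1 ≤ weightConst k / Q ^ (2 * (a u 0 - a u 2).toNat) := by
      rw [hu u, hQ, ← Nat.card_eq_fintype_card]
      exact vertexWeight_dv_le (ha u)
    have hE : ‖eisQ (k := k) (Pi.single m 1) u.1‖ ≤ Q ^ ((a u 0 + 1).toNat + (a u 1 + 1).toNat) := by
      rw [hu u]
      exact norm_eis_single_le (ha u) h1 hneg
    have hinv : (Fintype.card k : ℝ≥0∞)⁻¹ = ENNReal.ofReal Q⁻¹ := by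
      rw [ENNReal.ofReal_inv_of_pos hQ0, hQ, ENNReal.ofReal_natCast]
    rw [hinv, ← ENNReal.ofReal_pow (by positivity), ← ENNReal.ofReal_pow (by positivity),
      ← ENNReal.ofReal_mul (by positivity), ← ENNReal.ofReal_mul (by positivity), ← ofReal_norm,
      ← ENNReal.ofReal_pow (norm_nonneg _), ← ENNReal.ofReal_mul' (by positivity)]
    apply ENNReal.ofReal_le_ofReal
    -- the square of the number of primitive vectors against the weight
    have hJ1 : 2 * (((a u 0 + 1).toNat + (a u 1 + 1).toNat : ℕ) : ℤ) -
        ((2 * (a u 0 - a u 2).toNat : ℕ) : ℤ) ≤ 4 + m - ((J u).2.1 : ℤ) - ((J u).2.2 : ℤ) := by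
      rw [Fin.sum_univ_three] at h1
      simp only [J]
      split_ifs <;> simp only <;> omega
    calc vertexWeight u.1 * ‖eisQ (k := k) (Pi.single m 1) u.1‖ ^ 2
        ≤ weightConst k / Q ^ (2 * (a u 0 - a u 2).toNat) *
          (Q ^ ((a u 0 + 1).toNat + (a u 1 + 1).toNat)) ^ 2 := by gcongr
      _ = weightConst k * Q ^ (2 * (((a u 0 + 1).toNat + (a u 1 + 1).toNat : ℕ) : ℤ) -
        ((2 * (a u 0 - a u 2).toNat : ℕ) : ℤ)) := by
          rw [zpow_sub₀ hQ0.ne', zpow_natCast, mul_comm (2 : ℤ), zpow_mul, zpow_natCast]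
          rw [show (2 : ℤ) = ((2 : ℕ) : ℤ) from rfl, zpow_natCast]
          ring
      _ ≤ weightConst k * Q ^ (4 + m - ((J u).2.1 : ℤ) - ((J u).2.2 : ℤ)) := by
          gcongr
          exact hQ1.le
      _ = _ := by
          rw [zpow_sub₀ hQ0.ne', zpow_sub₀ hQ0.ne', zpow_natCast, zpow_natCast, inv_pow, inv_pow]
          field_simp
  rw [wNorm_sq, ← tsum_subtype_eq_of_support_subset (s := S)]
  · refine (ENNReal.tsum_le_tsum hterm).trans ?_
    rw [ENNReal.tsum_mul_left]
    gcongr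
    exact ENNReal.tsum_comp_le_tsum_of_injective hJ fun t : Bool × ℕ × ℕ =>
      (Fintype.card k : ℝ≥0∞)⁻¹ ^ t.2.1 * (Fintype.card k : ℝ≥0∞)⁻¹ ^ t.2.2
  · intro u hu
    rw [hS, Function.mem_support]
    rintro h0
    rw [Function.mem_support, h0] at hu
    simp at hu

/-- Incomplete Eisenstein series have bounded norm as long as the function of the height has
bounded support size and decays like the square root of the measure of the sets of given height. -/
theorem wNorm_eisQ_le [Fintype k] {φ : ℤ → ℂ} {s : Finset ℤ} (hφ : ∀ m ∉ s, φ m = 0)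
    (hs : ∀ m ∈ s, m < 0) {D : ℝ} (hD : ∀ m ∈ s, ‖φ m‖ ^ 2 ≤ D * (Fintype.card k : ℝ) ^ (-m)) :
    wNorm (vertexWeight (k := k)) (eisQ φ) ≤ s.card *
      (ENNReal.ofReal (D * weightConst k * (Fintype.card k : ℝ) ^ 4) * geomSum k) ^ (1 / 2 : ℝ) := by
  have hQ0 : (0 : ℝ) < Fintype.card k := by exact_mod_cast Fintype.card_pos
  have e : eisQ (k := k) φ = ∑ m ∈ s, φ m • eisQ (Pi.single m 1) := by
    funext u
    obtain ⟨x, rfl⟩ := toQ_surjective u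
    rw [Finset.sum_apply]
    exact eis_eq_sum hφ x
  rw [e, ← nsmul_eq_mul]
  refine (wNorm_sum_le s _ _).trans (Finset.sum_le_card_nsmul _ _ _ fun m hm => ?_)
  rw [← rpow_half_sq (wNorm _ _)]
  refine ENNReal.rpow_le_rpow ?_ (by norm_num)
  rw [wNorm_smul, mul_pow]
  have hwc := weightConst_pos (k := k)
  have h1 : ‖φ m‖ₑ ^ 2 ≤ ENNReal.ofReal (D * (Fintype.card k : ℝ) ^ (-m)) := by
    rw [← ofReal_norm, ← ENNReal.ofReal_pow (norm_nonneg _)]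
    exact ENNReal.ofReal_le_ofReal (hD m hm)
  refine (mul_le_mul' h1 (wNorm_eisQ_single_sq_le (hs m hm))).trans ?_
  rw [← mul_assoc, ← ENNReal.ofReal_mul' (by positivity)]
  refine le_of_eq ?_
  congr 2
  rw [zpow_add₀ hQ0.ne', zpow_neg]
  have : (Fintype.card k : ℝ) ^ m ≠ 0 := (zpow_pos hQ0 m).ne'
  field_simp

/-! ### Values along a ray -/

/-- At the vertices `(n, 0, 0)` the only primitive vectors whose height can be negative are the
nonzero constant multiples of the first basis vector, of height `-2 n`. -/
theorem eis_ray [Fintype k] {φ : ℤ → ℂ} (hφ : ∀ m, 0 ≤ m → φ m = 0) (n : ℕ) :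
    eis φ (dv k ![(n : ℤ), 0, 0]) = (Fintype.card k - 1) * φ (-(2 * n)) := by
  classical
  let ι : kˣ → primVec k := fun c => ⟨![Polynomial.C (c : k), 0, 0],
    ![Polynomial.C ((c⁻¹ : kˣ) : k), 0, 0], by
      simp [dotProduct, Fin.sum_univ_three, ← Polynomial.C_mul]⟩
  have hι : Function.Injective ι := by
    intro c c' h
    have := congrFun (congrArg Subtype.val h) 0
    exact Units.ext (Polynomial.C_injective this)
  have hdv : dv k ![(n : ℤ), 0, 0] = dv k ![0, -(n : ℤ), -(n : ℤ)] := by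
    rw [← dv_add_const ![(n : ℤ), 0, 0] (-(n : ℤ))]
    congr 1
    ext i
    fin_cases i <;> simp
  have hheight : ∀ c, height (pv (ι c).1) (dv k ![(n : ℤ), 0, 0]) = -(2 * n) := by
    intro c
    apply IsHeight.height_eq
    have hsum : ∑ i, (![0, -(n : ℤ), -(n : ℤ)] : Fin 3 → ℤ) i = -(2 * n) := by
      simp [Fin.sum_univ_three]; ring
    rw [hdv, ← hsum, isHeight_dv_iff]
    refine ⟨fun i => ?_, 0, ?_⟩
    · fin_cases i
      · simp only [ι, Polynomial.mem_degreeLT]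
        simp
      · exact zero_mem _
      · exact zero_mem _
    · simp [ι, Polynomial.mem_degreeLT]
  have hsupp : ∀ v : primVec k, φ (height (pv v.1) (dv k ![(n : ℤ), 0, 0])) ≠ 0 →
      v ∈ Set.range ι := by
    intro v hv
    have hh := isHeight_height (pv_ne_zero v.2) (dv k ![(n : ℤ), 0, 0])
    have hneg : height (pv v.1) (dv k ![(n : ℤ), 0, 0]) < 0 := by
      by_contra hcon
      exact hv (hφ _ (not_lt.1 hcon))
    set m := height (pv v.1) (dv k ![(n : ℤ), 0, 0])
    obtain ⟨j, hj⟩ := exists_dv_eq_of_isHeight hh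
    rw [← hj, ← dv_add_const _ j, isHeight_dv_iff] at hh
    have hj0 : j < 0 := by
      simp [Fin.sum_univ_three] at hj
      omega
    have hz : ∀ i, (![(n : ℤ), 0, 0] + (fun _ => j) : Fin 3 → ℤ) i < 0 → v.1 i = 0 :=
      fun i hi => eq_zero_of_mem_degreeLT hi (hh.1 i)
    have h1 : v.1 1 = 0 := hz 1 (by simpa using hj0)
    have h2 : v.1 2 = 0 := hz 2 (by simpa using hj0)
    have hv0 : v.1 = ![v.1 0, 0, 0] := by
      ext1 i
      fin_cases i
      exacts [rfl, h1, h2]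
    obtain ⟨c, hc, hc'⟩ := Polynomial.isUnit_iff.1 (mem_primVec_single (hv0 ▸ v.2))
    refine ⟨hc.unit, Subtype.ext ?_⟩
    rw [hv0, ← hc']
    rfl
  rw [eis, ← finsum_mem_univ, finsum_mem_inter_support_eq' _ Set.univ (Set.range ι)
    fun v hv => ⟨fun _ => hsupp v hv, fun _ => trivial⟩, finsum_mem_range hι]
  simp only [hheight]
  rw [finsum_eq_sum_of_fintype, Finset.sum_const, Finset.card_univ, Fintype.card_units,
    nsmul_eq_mul, Nat.cast_sub Fintype.card_pos, Nat.cast_one]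

/-- The Eisenstein series attached to a single height separates the vertices `(n, 0, 0)`. -/
theorem ray_injective [Fintype k] {n n' : ℕ} (hn : n ≠ 0)
    (h : (dv k ![(n : ℤ), 0, 0]).toQ = (dv k ![(n' : ℤ), 0, 0]).toQ) : n = n' := by
  have hφ : ∀ m : ℤ, 0 ≤ m → (Pi.single (-(2 * n : ℤ)) 1 : ℤ → ℂ) m = 0 := fun m hm =>
    Pi.single_eq_of_ne (by omega) _
  have h1 := congrArg (eisQ (Pi.single (-(2 * n : ℤ)) 1)) h
  rw [eisQ_toQ, eisQ_toQ, eis_ray hφ, eis_ray hφ, Pi.single_eq_same] at h1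
  by_contra hne
  rw [Pi.single_eq_of_ne (by omega), mul_zero, mul_one, sub_eq_zero] at h1
  have : Fintype.card k = 1 := by exact_mod_cast h1
  exact (Fintype.one_lt_card (α := k)).ne' this

theorem le_vertexWeight_ray [Fintype k] {n : ℕ} (hn : n ≠ 0) :
    weightConst k / (Fintype.card k : ℝ) ^ (2 * n + 7) ≤
      vertexWeight (dv k ![(n : ℤ), 0, 0]).toQ := by
  have h := le_vertexWeight_dv (k := k) ![(n : ℤ), 0, 0]
  have e : ∑ i, ∑ j, ((![(n : ℤ), 0, 0] : Fin 3 → ℤ) i - (![(n : ℤ), 0, 0] : Fin 3 → ℤ) j + 1).toNat =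
      2 * n + 7 := by
    simp [Fin.sum_univ_three]
    omega
  rwa [e, Nat.card_eq_fintype_card] at h

end Norms

section Automorphic
variable {k : Type*} [Field k]

/-! ### The automorphic spectrum -/

/-- The function `z ^ m` of the height `m`, cut off to `-2 N ≤ m ≤ -3`. -/
def cutPow (z : ℂ) (N : ℕ) (m : ℤ) : ℂ := if -(2 * N) ≤ m ∧ m ≤ -3 then z ^ m else 0

theorem cutPow_of_nonneg {z : ℂ} {N : ℕ} {m : ℤ} (hm : 0 ≤ m) : cutPow z N m = 0 :=
  if_neg (by omega)

theorem support_cutPow_finite (z : ℂ) (N : ℕ) : (cutPow z N).support.Finite := by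
  refine (Set.finite_Icc (-(2 * N : ℤ)) (-3)).subset fun m hm => ?_
  by_contra h
  exact hm (if_neg h)

theorem sq_norm_zpow {q : ℝ} {z : ℂ} (hz : ‖z‖ ^ 2 = q⁻¹) (m : ℤ) :
    ‖z ^ m‖ ^ 2 = q ^ (-m) := by
  rw [norm_zpow, ← zpow_natCast, ← zpow_mul, mul_comm, zpow_mul, zpow_natCast, hz, inv_zpow,
    zpow_neg]

/-- The heights at which the cut-off of `z ^ m` is felt by the neighbors. -/
def cutEnds (N : ℕ) : Finset ℤ := Finset.Icc (-(2 * N : ℤ) - 2) (-(2 * N) + 1) ∪ Finset.Icc (-4) (-1)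

theorem card_cutEnds_le (N : ℕ) : (cutEnds N).card ≤ 8 := by
  refine (Finset.card_union_le _ _).trans ?_
  rw [Int.card_Icc, Int.card_Icc]
  omega

theorem neg_of_mem_cutEnds {N : ℕ} (hN : N ≠ 0) {m : ℤ} (hm : m ∈ cutEnds N) : m < 0 := by
  simp only [cutEnds, Finset.mem_union, Finset.mem_Icc] at hm
  omega

theorem cutPow_shift {z : ℂ} (hz : z ≠ 0) {N : ℕ} {m s : ℤ} (hs : |s| ≤ 2) :
    (m ∉ cutEnds N → cutPow z N (m + s) = z ^ s * cutPow z N m) ∧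
    ‖cutPow z N (m + s) - z ^ s * cutPow z N m‖ ≤ ‖z ^ s‖ * ‖z ^ m‖ := by
  rw [abs_le] at hs
  have e : z ^ (m + s) = z ^ s * z ^ m := by rw [add_comm, zpow_add₀ hz]
  constructor
  · intro hm
    simp only [cutEnds, Finset.mem_union, Finset.mem_Icc] at hm
    have h : (-(2 * (N : ℤ)) ≤ m + s ∧ m + s ≤ -3) ↔ (-(2 * (N : ℤ)) ≤ m ∧ m ≤ -3) := by omega
    simp only [cutPow, h]
    split_ifs
    · exact e
    · rw [mul_zero]
  · simp only [cutPow]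
    split_ifs
    · rw [e, sub_self, norm_zero]; positivity
    · rw [e, mul_zero, sub_zero, norm_mul]
    · rw [zero_sub, norm_neg, norm_mul]
    · rw [mul_zero, sub_zero, norm_zero]; positivity

/-- The cut-off functions are approximate eigenfunctions, up to a bounded error. -/
theorem exists_wNorm_shiftOp_le [Fintype k] {z : ℂ} (hz : ‖z‖ ^ 2 = (Fintype.card k : ℝ)⁻¹)
    (c₁ c₂ : ℂ) {s₁ s₂ : ℤ} (h₁ : |s₁| ≤ 2) (h₂ : |s₂| ≤ 2) : ∃ B : ℝ≥0∞, B ≠ ⊤ ∧ ∀ N : ℕ, N ≠ 0 →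
      wNorm (vertexWeight (k := k)) (eisQ (shiftOp c₁ c₂ s₁ s₂ (cutPow z N) -
        (c₁ * z ^ s₁ + c₂ * z ^ s₂) • cutPow z N)) ≤ B := by
  have hQ0 : (0 : ℝ) < Fintype.card k := by exact_mod_cast Fintype.card_pos
  have hz0 : z ≠ 0 := by
    rintro rfl
    rw [norm_zero, zero_pow two_ne_zero, eq_comm, inv_eq_zero] at hz
    exact hQ0.ne' hz
  set D : ℝ := (‖c₁‖ * ‖z ^ s₁‖ + ‖c₂‖ * ‖z ^ s₂‖) ^ 2 with hD
  refine ⟨8 * (ENNReal.ofReal (D * weightConst k * (Fintype.card k : ℝ) ^ 4) * geomSum k) ^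
    (1 / 2 : ℝ), ?_, fun N hN => ?_⟩
  · refine ENNReal.mul_ne_top (by norm_num) (ENNReal.rpow_ne_top_of_nonneg (by norm_num) ?_)
    exact ENNReal.mul_ne_top ENNReal.ofReal_ne_top geomSum_ne_top
  have e : ∀ m, (shiftOp c₁ c₂ s₁ s₂ (cutPow z N) - (c₁ * z ^ s₁ + c₂ * z ^ s₂) • cutPow z N) m =
      c₁ * (cutPow z N (m + s₁) - z ^ s₁ * cutPow z N m) +
        c₂ * (cutPow z N (m + s₂) - z ^ s₂ * cutPow z N m) := by
    intro m
    rw [Pi.sub_apply, Pi.smul_apply, shiftOp, smul_eq_mul]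
    ring
  refine (wNorm_eisQ_le (s := cutEnds N) (D := D) (fun m hm => ?_)
    (fun m hm => neg_of_mem_cutEnds hN hm) (fun m _ => ?_)).trans ?_
  · rw [e, (cutPow_shift hz0 h₁).1 hm, (cutPow_shift hz0 h₂).1 hm]
    ring
  · rw [e, ← sq_norm_zpow hz, hD, ← mul_pow]
    gcongr
    refine (norm_add_le _ _).trans ?_
    rw [norm_mul, norm_mul, add_mul, mul_assoc, mul_assoc]
    have h3 := (cutPow_shift hz0 (N := N) (m := m) h₁).2
    have h4 := (cutPow_shift hz0 (N := N) (m := m) h₂).2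
    gcongr
  · gcongr
    exact_mod_cast card_cutEnds_le N

/-- The norms of the cut-off functions are unbounded, as seen on the vertices `(n, 0, 0)`. -/
theorem le_wNorm_cutPow_sq [Fintype k] {z : ℂ} (hz : ‖z‖ ^ 2 = (Fintype.card k : ℝ)⁻¹) (N : ℕ) :
    (N : ℝ≥0∞) * ENNReal.ofReal (weightConst k * (Fintype.card k - 1) ^ 2 /
      (Fintype.card k : ℝ) ^ 7) ≤
      wNorm (vertexWeight (k := k)) (eisQ (cutPow z (N + 1))) ^ 2 := by
  classical
  have hQ0 : (0 : ℝ) < Fintype.card k := by exact_mod_cast Fintype.card_pos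
  have hwc := weightConst_pos (k := k)
  set u : ℕ → QVertex k := fun n => (dv k ![(n : ℤ), 0, 0]).toQ with hu
  have hinj : Set.InjOn u (Finset.Icc 2 (N + 1) : Finset ℕ) := by
    intro n hn n' _ h
    rw [Finset.mem_coe, Finset.mem_Icc] at hn
    exact ray_injective (by omega) h
  have hterm : ∀ n ∈ Finset.Icc 2 (N + 1), ENNReal.ofReal (weightConst k *
      (Fintype.card k - 1) ^ 2 / (Fintype.card k : ℝ) ^ 7) ≤
      ENNReal.ofReal (vertexWeight (u n)) * ‖eisQ (k := k) (cutPow z (N + 1)) (u n)‖ₑ ^ 2 := by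
    intro n hn
    rw [Finset.mem_Icc] at hn
    have hval : eisQ (k := k) (cutPow z (N + 1)) (u n) =
        (Fintype.card k - 1) * z ^ (-(2 * n) : ℤ) := by
      rw [hu, eisQ_toQ, eis_ray fun m hm => cutPow_of_nonneg hm, cutPow, if_pos]
      push_cast
      omega
    have hnorm : ‖eisQ (k := k) (cutPow z (N + 1)) (u n)‖ ^ 2 =
        ((Fintype.card k : ℝ) - 1) ^ 2 * (Fintype.card k : ℝ) ^ (2 * n) := by
      rw [hval, norm_mul, mul_pow, sq_norm_zpow hz, neg_neg]
      congr 1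
      · rw [← Complex.ofReal_natCast, ← Complex.ofReal_one, ← Complex.ofReal_sub,
          Complex.norm_real, Real.norm_eq_abs, sq_abs]
    rw [← ofReal_norm, ← ENNReal.ofReal_pow (norm_nonneg _), ← ENNReal.ofReal_mul' (by positivity)]
    apply ENNReal.ofReal_le_ofReal
    rw [hnorm]
    calc _ = weightConst k / (Fintype.card k : ℝ) ^ (2 * n + 7) *
          (((Fintype.card k : ℝ) - 1) ^ 2 * (Fintype.card k : ℝ) ^ (2 * n)) := by
          rw [pow_add]; field_simp
      _ ≤ _ := by
          gcongr
          exact le_vertexWeight_ray (by omega)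
  rw [wNorm_sq]
  refine le_trans ?_ (ENNReal.sum_le_tsum ((Finset.Icc 2 (N + 1)).image u))
  rw [Finset.sum_image hinj]
  refine le_trans ?_ (Finset.card_nsmul_le_sum _ _ _ hterm)
  rw [Nat.card_Icc, nsmul_eq_mul]
  simp

theorem wNorm_cutPow_ne_top [Fintype k] {z : ℂ} (hz : ‖z‖ ^ 2 = (Fintype.card k : ℝ)⁻¹) (N : ℕ) :
    wNorm (vertexWeight (k := k)) (eisQ (cutPow z N)) ≠ ⊤ := by
  refine ne_top_of_le_ne_top ?_ (wNorm_eisQ_le (φ := cutPow z N)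
    (s := Finset.Icc (-(2 * N : ℤ)) (-3)) (D := 1)
    (fun m hm => if_neg (by simpa using hm)) (fun m hm => ?_) (fun m hm => ?_))
  · refine ENNReal.mul_ne_top (by finiteness) (ENNReal.rpow_ne_top_of_nonneg (by norm_num) ?_)
    exact ENNReal.mul_ne_top ENNReal.ofReal_ne_top geomSum_ne_top
  · rw [Finset.mem_Icc] at hm; omega
  · rw [Finset.mem_Icc] at hm
    have e : cutPow z N m = z ^ m := if_pos hm
    rw [e, sq_norm_zpow hz, one_mul]

theorem eisQ_smul (c : ℂ) (φ : ℤ → ℂ) : eisQ (k := k) (c • φ) = c • eisQ φ := by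
  funext u
  obtain ⟨x, rfl⟩ := toQ_surjective u
  exact eis_smul c φ x

theorem shiftOp_smul (c₁ c₂ : ℂ) (s₁ s₂ : ℤ) (c : ℂ) (φ : ℤ → ℂ) :
    shiftOp c₁ c₂ s₁ s₂ (c • φ) = c • shiftOp c₁ c₂ s₁ s₂ φ := by
  funext m
  simp only [shiftOp, Pi.smul_apply, smul_eq_mul]
  ring

theorem eisQ_sub [Finite k] {φ ψ : ℤ → ℂ} (hφ : φ.support.Finite) (hψ : ψ.support.Finite) :
    eisQ (k := k) (φ - ψ) = eisQ φ - eisQ ψ := by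
  funext u
  obtain ⟨x, rfl⟩ := toQ_surjective u
  exact finsum_sub_distrib (finite_support_height hφ x) (finite_support_height hψ x)

theorem support_shiftOp_finite (c₁ c₂ : ℂ) (s₁ s₂ : ℤ) {φ : ℤ → ℂ} (hφ : φ.support.Finite) :
    (shiftOp c₁ c₂ s₁ s₂ φ).support.Finite := by
  refine ((hφ.image fun m => m - s₁).union (hφ.image fun m => m - s₂)).subset fun m hm => ?_
  by_contra h
  simp only [Set.mem_union, Set.mem_image, not_or, not_exists, not_and] at h
  refine hm ?_
  have h1 : φ (m + s₁) = 0 := by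
    by_contra h1; exact h.1 _ h1 (by ring)
  have h2 : φ (m + s₂) = 0 := by
    by_contra h2; exact h.2 _ h2 (by ring)
  rw [shiftOp, h1, h2]; ring

/-- Normalizing the cut-off functions makes the bounded error tend to zero. -/
theorem tendsto_cutPow [Fintype k] {z : ℂ} (hz : ‖z‖ ^ 2 = (Fintype.card k : ℝ)⁻¹)
    {c₁ c₂ : ℂ} {s₁ s₂ : ℤ} (h₁ : |s₁| ≤ 2) (h₂ : |s₂| ≤ 2)
    {A : (QVertex k → ℂ) → QVertex k → ℂ}
    (hA : ∀ φ : ℤ → ℂ, φ.support.Finite → A (eisQ φ) = eisQ (shiftOp c₁ c₂ s₁ s₂ φ))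
    {a : ℕ → ℂ} (hlim : Filter.Tendsto (fun N => ‖a N‖ₑ) Filter.atTop (nhds 0)) :
    Filter.Tendsto (fun N => wNorm (vertexWeight (k := k)) (A (eisQ (a N • cutPow z (N + 2))) -
      (c₁ * z ^ s₁ + c₂ * z ^ s₂) • eisQ (a N • cutPow z (N + 2)))) Filter.atTop (nhds 0) := by
  obtain ⟨B, hB, hle⟩ := exists_wNorm_shiftOp_le (k := k) hz c₁ c₂ h₁ h₂
  have h0 : Filter.Tendsto (fun N => ‖a N‖ₑ * B) Filter.atTop (nhds 0) := by
    have := ENNReal.Tendsto.mul_const hlim (Or.inr hB)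
    rwa [zero_mul] at this
  refine tendsto_of_tendsto_of_tendsto_of_le_of_le tendsto_const_nhds h0 (fun _ => zero_le)
    fun N => ?_
  have hfin := support_cutPow_finite z (N + 2)
  have e : A (eisQ (a N • cutPow z (N + 2))) -
      (c₁ * z ^ s₁ + c₂ * z ^ s₂) • eisQ (a N • cutPow z (N + 2)) =
      a N • eisQ (shiftOp c₁ c₂ s₁ s₂ (cutPow z (N + 2)) -
        (c₁ * z ^ s₁ + c₂ * z ^ s₂) • cutPow z (N + 2)) := by
    rw [hA _ (hfin.subset (Function.support_const_smul_subset _ _)), shiftOp_smul, eisQ_smul,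
      eisQ_smul, eisQ_sub (support_shiftOp_finite _ _ _ _ hfin)
      (hfin.subset (Function.support_const_smul_subset _ _)), eisQ_smul, smul_sub,
      smul_comm (a N)]
  simp only [e, wNorm_smul]
  gcongr
  exact hle _ (by omega)

/-- The function `z ^ m` of the height is a common eigenfunction of the two shift operators; for
`|z|² = 1 / q` its cut-offs have bounded error but unbounded norm. -/
theorem mem_automorphicSpectrum [Fintype k] {z : ℂ} (hz : ‖z‖ ^ 2 = (Fintype.card k : ℝ)⁻¹) :
    ((Fintype.card k + 1) * z ^ (-1 : ℤ) + (Fintype.card k : ℂ) ^ 2 * z ^ (2 : ℤ),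
      1 * z ^ (-2 : ℤ) + ((Fintype.card k : ℂ) ^ 2 + Fintype.card k) * z ^ (1 : ℤ)) ∈
      automorphicSpectrum k := by
  have hQ1 : (1 : ℝ) < Fintype.card k := by exact_mod_cast Fintype.one_lt_card
  have hQ0 : (0 : ℝ) < Fintype.card k := by linarith
  have hQ2 : (0 : ℝ) < Fintype.card k - 1 := by linarith
  have hwc := weightConst_pos (k := k)
  set W : ℕ → ℝ≥0∞ := fun N => wNorm (vertexWeight (k := k)) (eisQ (cutPow z (N + 2))) with hW
  set b : ℝ≥0∞ := ENNReal.ofReal (weightConst k * (Fintype.card k - 1) ^ 2 /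
    (Fintype.card k : ℝ) ^ 7) with hb
  have hb0 : b ≠ 0 := by
    rw [hb, Ne, ENNReal.ofReal_eq_zero, not_le]
    positivity
  have hle : ∀ N : ℕ, ((N + 1 : ℕ) : ℝ≥0∞) * b ≤ W N ^ 2 := fun N => le_wNorm_cutPow_sq hz (N + 1)
  have hWtop : ∀ N, W N ≠ ⊤ := fun N => wNorm_cutPow_ne_top hz _
  have hW0 : ∀ N, W N ≠ 0 := by
    intro N h
    have := hle N
    rw [h, zero_pow two_ne_zero, nonpos_iff_eq_zero, mul_eq_zero] at this
    rcases this with h | h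
    · exact N.succ_ne_zero (by exact_mod_cast h)
    · exact hb0 h
  have hlim : Filter.Tendsto (fun N => (W N)⁻¹) Filter.atTop (nhds 0) := by
    apply tendsto_zero_of_sq
    have h1 : Filter.Tendsto (fun N : ℕ => ((N + 1 : ℕ) : ℝ≥0∞)⁻¹ * b⁻¹) Filter.atTop (nhds 0) := by
      have := ENNReal.Tendsto.mul_const (b := b⁻¹) ((Filter.tendsto_add_atTop_iff_nat 1).2
        ENNReal.tendsto_inv_nat_nhds_zero) (Or.inr (ENNReal.inv_ne_top.2 hb0))
      rwa [zero_mul] at this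
    refine tendsto_of_tendsto_of_tendsto_of_le_of_le tendsto_const_nhds h1 (fun _ => zero_le)
      fun N => ?_
    simp only
    rw [← ENNReal.inv_pow, ← ENNReal.mul_inv (Or.inr ENNReal.ofReal_ne_top) (Or.inr hb0),
      ENNReal.inv_le_inv]
    exact hle N
  have ha : ∀ N, ‖(((W N).toReal⁻¹ : ℝ) : ℂ)‖ₑ = (W N)⁻¹ := by
    intro N
    have hpos : 0 < (W N).toReal := ENNReal.toReal_pos (hW0 N) (hWtop N)
    rw [← ofReal_norm, Complex.norm_real, Real.norm_of_nonneg (by positivity),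
      ENNReal.ofReal_inv_of_pos hpos, ENNReal.ofReal_toReal (hWtop N)]
  -- the unit vectors are the cut-off series divided by their norms `W N`
  refine ⟨fun N => eisQ ((((W N).toReal⁻¹ : ℝ) : ℂ) • cutPow z (N + 2)), fun N => ?_, ?_, ?_⟩
  · change wNorm _ (eisQ (_ • _)) = 1
    rw [eisQ_smul, wNorm_smul, ha]
    exact ENNReal.inv_mul_cancel (hW0 N) (hWtop N)
  · exact tendsto_cutPow hz (by norm_num) (by norm_num) (fun φ hφ => weightedAdj_one_eisQ hφ)
      (by simpa only [ha] using hlim)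
  · exact tendsto_cutPow hz (by norm_num) (by norm_num) (fun φ hφ => weightedAdj_neg_one_eisQ hφ)
      (by simpa only [ha] using hlim)

end Automorphic

section Conclusion
variable {k : Type*} [Field k]

/-! ### Comparison of the spectra -/

/-- The curve in terms of the square root `r` of `q`. -/
theorem exists_of_mem_Sigma1 {q : ℕ} {z : ℂ} (hz : z ∈ Sigma1 q) : ∃ (r : ℝ) (u : ℂ), 0 ≤ r ∧
    r ^ 2 = q ∧ ‖u‖ = 1 ∧ z = (r ^ 3 + r) * u + r ^ 2 * u⁻¹ ^ 2 := by
  obtain ⟨θ, rfl⟩ := hz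
  refine ⟨√q, Complex.exp (θ * Complex.I), Real.sqrt_nonneg _, Real.sq_sqrt (Nat.cast_nonneg _),
    Complex.norm_exp_ofReal_mul_I θ, ?_⟩
  have h1 : ((q : ℝ) ^ (1 / 2 : ℝ)) = √q := (Real.sqrt_eq_rpow _).symm
  have h3 : ((q : ℝ) ^ (3 / 2 : ℝ)) = √q ^ 3 := by
    rw [Real.sqrt_eq_rpow, ← Real.rpow_natCast, ← Real.rpow_mul (Nat.cast_nonneg _)]
    norm_num
  have h2 : (q : ℂ) = ((√q : ℝ) : ℂ) ^ 2 := by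
    rw [← Complex.ofReal_pow, Real.sq_sqrt (Nat.cast_nonneg _), Complex.ofReal_natCast]
  have h4 : Complex.exp (-2 * θ * Complex.I) = (Complex.exp (θ * Complex.I))⁻¹ ^ 2 := by
    rw [← Complex.exp_neg, ← Complex.exp_nat_mul]
    congr 1
    push_cast
    ring
  rw [h1, h3, h4, Complex.ofReal_pow]
  linear_combination (Complex.exp (θ * Complex.I))⁻¹ ^ 2 * h2

theorem star_curve {r : ℝ} {u : ℂ} (hu : ‖u‖ = 1) :
    star (((r : ℂ) ^ 3 + r) * u + (r : ℂ) ^ 2 * u⁻¹ ^ 2) = (r ^ 3 + r) * u⁻¹ + r ^ 2 * u ^ 2 := by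
  have h : star u⁻¹ = u := by rw [star_inv₀, star_eq_inv hu, inv_inv]
  rw [star_add, star_mul', star_mul', star_add, star_pow, star_pow, star_pow, h, star_eq_inv hu,
    show star (r : ℂ) = r from Complex.conj_ofReal r]

theorem mem_automorphicSpectrum_of_mem_Sigma1 [Fintype k] {z : ℂ}
    (hz : z ∈ Sigma1 (Fintype.card k)) : (z, star z) ∈ automorphicSpectrum k := by
  obtain ⟨r, u, hr, hrq, hu, rfl⟩ := exists_of_mem_Sigma1 hz
  have hQ0 : (0 : ℝ) < Fintype.card k := by exact_mod_cast Fintype.card_pos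
  have hr0 : (r : ℂ) ≠ 0 := by
    rintro h
    rw [Complex.ofReal_eq_zero.1 h] at hrq
    rw [← hrq] at hQ0
    simp at hQ0
  have hu0 : u ≠ 0 := by rintro rfl; simp at hu
  have hq : (Fintype.card k : ℂ) = (r : ℂ) ^ 2 := by exact_mod_cast hrq.symm
  have h := mem_automorphicSpectrum (k := k) (z := (r : ℂ)⁻¹ * u⁻¹) (by
    rw [norm_mul, norm_inv, norm_inv, hu, Complex.norm_real, inv_one, mul_one, inv_pow, ← hrq,
      Real.norm_eq_abs, sq_abs])
  convert h using 2
  · rw [hq, zpow_neg_one, zpow_ofNat]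
    field_simp
  · rw [star_curve hu, hq, zpow_one, zpow_neg, zpow_ofNat]
    field_simp
    ring

/-- A function of the color is multiplied by `(q² + q + 1) ξ`, the number of neighbors of one color
times a root of unity. -/
theorem norm_of_mem_trivialSpectrum [Fintype k] {p : ℂ × ℂ} (hp : p ∈ trivialSpectrum k) :
    ‖p.1‖ = (Fintype.card k : ℝ) ^ 2 + Fintype.card k + 1 := by
  obtain ⟨f, ⟨ξ, hξ, hf⟩, h, -⟩ := hp
  have hn : ‖ξ‖ = 1 := Complex.norm_eq_one_of_pow_eq_one hξ three_ne_zero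
  have h1 := congrFun h (x₀ k).toQ
  rw [weightedAdj_toQ, Pi.smul_apply, hf] at h1
  have h2 := coloredAdj_one (fun y : Vertex k => f y.toQ) 1
  simp only [hf, color_smul_pl] at h2
  rw [one_smul, Finset.sum_const, Finset.card_univ, card_PIdx] at h2
  simp only [hf] at h1
  rw [h1] at h2
  have h3 := congrArg norm h2
  rw [smul_eq_mul, norm_mul, norm_pow, hn, one_pow, mul_one, nsmul_eq_mul, norm_mul, norm_pow, hn,
    one_pow, mul_one, Complex.norm_natCast] at h3
  rw [h3]
  push_cast
  rfl

/-- The difference is at least `(r³ - 1)(r - 1) > 0`, where `r² = q`. -/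
theorem norm_lt_of_mem_Sigma1 {q : ℕ} (hq : 1 < q) {z : ℂ} (hz : z ∈ Sigma1 q) :
    ‖z‖ < (q : ℝ) ^ 2 + q + 1 := by
  obtain ⟨r, u, hr, hrq, hu, rfl⟩ := exists_of_mem_Sigma1 hz
  have hr1 : 1 < r := by
    have : (1 : ℝ) < r ^ 2 := by rw [hrq]; exact_mod_cast hq
    nlinarith
  have h1 : ‖((r : ℂ) ^ 3 + r) * u + (r : ℂ) ^ 2 * u⁻¹ ^ 2‖ ≤ r ^ 3 + r + r ^ 2 := by
    refine (norm_add_le _ _).trans (add_le_add ?_ ?_)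
    · rw [norm_mul, hu, mul_one]
      refine (norm_add_le _ _).trans ?_
      rw [norm_pow, Complex.norm_real, Real.norm_of_nonneg hr]
    · rw [norm_mul, norm_pow, norm_pow, norm_inv, hu, Complex.norm_real, Real.norm_of_nonneg hr]
      simp
  have h2 : 0 < (r ^ 3 - 1) * (r - 1) :=
    mul_pos (sub_pos.2 (one_lt_pow₀ hr1 three_ne_zero)) (sub_pos.2 hr1)
  rw [← hrq]
  nlinarith

/-- Both curves parametrize the coefficients of cubics with constant term `-1`, but the cubic of
a point of the first one has the root `q^{1/2} e^{iθ}`, which is not on the unit circle. -/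
theorem notMem_Sigma2_of_mem_Sigma1 {q : ℕ} (hq : 1 < q) {z : ℂ} (hz : z ∈ Sigma1 q) :
    z ∉ Sigma2 q := by
  rintro ⟨s₁, s₂, s₃, h1, h2, h3, h123, he⟩
  obtain ⟨r, u, hr, hrq, hu, rfl⟩ := exists_of_mem_Sigma1 hz
  have hr1 : 1 < r := by
    have : (1 : ℝ) < r ^ 2 := by rw [hrq]; exact_mod_cast hq
    nlinarith
  have hr0 : (r : ℂ) ≠ 0 := by exact_mod_cast (zero_lt_one.trans hr1).ne'
  have hu0 : u ≠ 0 := by rintro rfl; simp at hu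
  have hs1 : s₁ ≠ 0 := by rintro rfl; simp at h1
  have hs2 : s₂ ≠ 0 := by rintro rfl; simp at h2
  have hs3 : s₃ ≠ 0 := by rintro rfl; simp at h3
  have hqc : (q : ℂ) = (r : ℂ) ^ 2 := by exact_mod_cast hrq.symm
  have he' := congrArg star he
  rw [star_curve hu, star_mul', star_add, star_add, star_eq_inv h1, star_eq_inv h2,
    star_eq_inv h3, star_natCast, hqc] at he'
  rw [hqc] at he
  have i1 : s₁⁻¹ = s₂ * s₃ := by field_simp; linear_combination -h123
  have i2 : s₂⁻¹ = s₁ * s₃ := by field_simp; linear_combination -h123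
  have i3 : s₃⁻¹ = s₁ * s₂ := by field_simp; linear_combination -h123
  rw [i1, i2, i3] at he'
  -- `q (r u - s₁)(r u - s₂)(r u - s₃)` depends only on `z` and `star z`, hence can be evaluated on
  -- either parametrization
  have key : (r : ℂ) ^ 2 * ((r * u - s₁) * (r * u - s₂) * (r * u - s₃)) = 0 := by
    have e1 : u⁻¹ * u = 1 := inv_mul_cancel₀ hu0
    linear_combination (r : ℂ) ^ 2 * u ^ 2 * he - r * u * he' - (r : ℂ) ^ 2 * h123 +
      ((r : ℂ) ^ 2 - (r : ℂ) ^ 4 * (u⁻¹ * u)) * e1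
  have hroot : (r * u - s₁) * (r * u - s₂) * (r * u - s₃) = 0 :=
    (mul_eq_zero.1 key).resolve_left (pow_ne_zero 2 hr0)
  have hnorm : ‖(r : ℂ) * u‖ = r := by
    rw [norm_mul, hu, mul_one, Complex.norm_real, Real.norm_of_nonneg hr]
  rcases mul_eq_zero.1 hroot with h | h
  · rcases mul_eq_zero.1 h with h | h
    · rw [sub_eq_zero.1 h, h1] at hnorm; exact hr1.ne hnorm
    · rw [sub_eq_zero.1 h, h2] at hnorm; exact hr1.ne hnorm
  · rw [sub_eq_zero.1 h, h3] at hnorm; exact hr1.ne hnorm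

theorem Sigma1_nonempty (q : ℕ) : (Sigma1 q).Nonempty := ⟨_, 0, rfl⟩

end Conclusion

end

end PGLBuilding

theorem mainTheorem2 (k : Type*) [Field k] [Finite k] :
    ¬ PGLBuilding.IsRamanujan k ∧
    (∀ z ∈ PGLBuilding.Sigma1 (Nat.card k),
      (z, star z) ∈ PGLBuilding.automorphicSpectrum k ∧
      (z, star z) ∉ PGLBuilding.trivialSpectrum k ∧
      (z, star z) ∉ PGLBuilding.buildingSpectrum k) ∧
    PGLBuilding.buildingSpectrum k =
      {p : ℂ × ℂ | p.1 ∈ PGLBuilding.Sigma2 (Nat.card k) ∧ p.2 = star p.1} := by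
  have := Fintype.ofFinite k
  rw [Nat.card_eq_fintype_card]
  have hq : 1 < Fintype.card k := Fintype.one_lt_card
  have h2 : ∀ z ∈ PGLBuilding.Sigma1 (Fintype.card k),
      (z, star z) ∈ PGLBuilding.automorphicSpectrum k ∧
      (z, star z) ∉ PGLBuilding.trivialSpectrum k ∧
      (z, star z) ∉ PGLBuilding.buildingSpectrum k := by
    intro z hz
    refine ⟨PGLBuilding.mem_automorphicSpectrum_of_mem_Sigma1 hz, fun h => ?_, fun h => ?_⟩
    · exact (PGLBuilding.norm_lt_of_mem_Sigma1 hq hz).ne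
        (PGLBuilding.norm_of_mem_trivialSpectrum h)
    · exact PGLBuilding.notMem_Sigma2_of_mem_Sigma1 hq hz
        (PGLBuilding.mem_Sigma2_of_mem_buildingSpectrum h).1
  refine ⟨fun h => ?_, h2, ?_⟩
  · obtain ⟨z, hz⟩ := PGLBuilding.Sigma1_nonempty (Fintype.card k)
    obtain ⟨h3, h4, h5⟩ := h2 z hz
    exact h5 (h _ h3 h4)
  · ext ⟨a, b⟩
    constructor
    · exact fun h => PGLBuilding.mem_Sigma2_of_mem_buildingSpectrum h
    · rintro ⟨h3, h4⟩
      have h5 := PGLBuilding.mem_buildingSpectrum_of_mem_Sigma2 h3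
      rwa [← h4] at h5
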